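/- **Setting.** Let $\Gamma$ be the Dynkin diagram of a simply-laced affine root system ($\tilde A_n$, a cycle with $n+1\ge 3$ vertices; $\tilde D_n$, $n\ge 4$; $\tilde E_6,\tilde E_7,\tilde E_8$) with vertex set $V$, and let $V=S\sqcup T$ be a partition such that adjacent vertices lie in different parts (this excludes $\tilde A_n$ with $n$ even). Write $i\sim j$ for adjacent vertices and $N(i)=\#\{j: j\sim i\}$. Let $H$ assign to each finite field $\mathbb F_q$ with $q\equiv 1 \bmod 4$ and each tuple $(f_i)_{i\in V}$ of monic polynomials in $\mathbb F_q[t]$ a complex weight $H((f_i))$, and put $$Z(\mathbf x)=\sum_{(f_i)\text{ monic}}H((f_i))\prod_{i\in V}x_i^{\deg f_i}=\sum_{a\in\mathbb Z_{\ge0}^V}c_a(q)\,\mathbf x^a .$$ With $|a|=\sum_i a_i$, assume the four axioms: 1. (Twisted multiplicativity) if $\prod_i f_i$ and $\prod_i g_i$ are coprime, then $H((f_ig_i))=H((f_i))H((g_i))\prod_{i\sim j}\left(\frac{f_i}{g_j}\right)$, the product being over ordered pairs of adjacent vertices and $\left(\frac{\cdot}{\cdot}\right)$ being the quadratic residue symbol;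 2. (Local-to-global) $c_a(q)$ is the value at $q$ of a polynomial $c_a\in\mathbb C[X]$ of degree at most $|a|$, independent of $q$, and $H((p^{a_i}))=q^{|a|\deg p}\,c_a(q^{-\deg p})$ for all monic irreducible $p\in\mathbb F_q[t]$; 3. (Dominance) if $|a|\ge2$, the polynomial $c_a$ has nonzero terms only in degrees greater than $(|a|+1)/2$; 4. (Initial conditions) $H(1,\dots,1,f,1,\dots,1)=1$ for every monic $f$ in any position. For a ring containing an invertible element $q$, let $R(\mathbf x_S)=(-q)^{|T|}\operatorname{Res}_{\mathbf x_T=(q^{-1},\dots,q^{-1})}Z(\mathbf x)$ denote the formal power series in $\mathbf x_S=(x_i)_{i\in S}$ obtained from $\prod_{i\in T}(1-qx_i)\cdot Z(\mathbf x)$ by setting $x_i=q^{-1}$ for all $i\in T$. For $a=(a_i)_{i\in S}$ and $i\in T$ put $A(i)=\sum_{j\sim i}a_j$; let $a'_i=a_i$ for $i\in S$ and $a'_i=A(i)$ for $i\in T$. For monic $f=(f_i)_{i\in S}$ let $f'_i=f_i$ for $i\in S$ and $f'_i=\prod_{j\sim i}f_j$ for $i\in T$. **Statement.** For every finite field $\mathbb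 F_q$ with $q\equiv1\bmod4$: * (a) $R(\mathbf x_S)$ is well defined: each of its coefficients only involves a finite sum. * (b) The coefficient of $\prod_{i\in S}x_i^{a_i}$ in $R(\mathbf x_S)$ is $c_{a'}(q)\,q^{-\sum_{i\in S}a_iN(i)}$, and it vanishes unless $A(i)$ is even for all $i\in T$. * (c) $$R(\mathbf x_S)=\sum_{(f_i)_{i\in S}\text{ monic}}H((f'_i)_{i\in V})\prod_{i\in S}\bigl(q^{-N(i)/2}x_i\bigr)^{\deg f_i},$$ and $H((f'_i))=0$ unless $\prod_{j\sim i}f_j$ is a perfect square for all $i\in T$. * (d) The weights $(f_i)_{i\in S}\mapsto H((f'_i))$ are multiplicative: if $\prod_{i\in S}f_i$ and $\prod_{i\in S}g_i$ are coprime, then $H((f'_ig'_i))=H((f'_i))H((g'_i))$. * (e) $R$ has the Euler product (as formal power series: every coefficient of the finite partial products is eventually constant) $$R(\mathbf x_S)=\prod_{p\text{ monic irreducible}}\ \sum_{a\in\mathbb Z_{\ge0}^S}H\bigl((p^{a'_i})_{i\in V}\bigr)\prod_{i\in S}\bigl(q^{-N(i)/2}x_i\bigr)^{a_i\deg p}.$$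 Now regard $q$ as an indeterminate, so that $Z=\sum_a c_a(q)\mathbf x^a\in\mathbb C[q,q^{-1}][[\mathbf x]]$. Then: * (f) $R(\mathbf x_S)$ is well defined in $\mathbb C[q,q^{-1}][[\mathbf x_S]]$, in the sense of (a), and the coefficient formula of (b) holds in $\mathbb C[q,q^{-1}]$. There is a unique family of complex numbers $\lambda(\mu,\nu)$, $\mu\in\mathbb Z$, $0\ne\nu\in\mathbb Z_{\ge0}^S$, with $$R(\mathbf x_S)=\prod_{\mu,\nu}\Bigl(1-q^{\mu}\prod_{i\in S}x_i^{\nu_i}\Bigr)^{-\lambda(\mu,\nu)}$$ as formal power series (factors expanded by the binomial series, convergence as in (e)). * (g) These factors come in symmetric pairs: if $\lambda(\mu,\nu)\neq0$, then $\mu'=1-\mu+\sum_{i\in S}(1-N(i)/2)\nu_i$ is an integer and $\lambda(\mu',\nu)=\lambda(\mu,\nu)$. -/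

import Mathlib

open scoped Polynomial

namespace AffineMDS

noncomputable section

/-! ### The simply-laced affine Dynkin diagrams -/

/-- The diagram of type `D̃ₙ` (for `4 ≤ n`) on the vertices `0, …, n`: the path `1 - 2 - ⋯ - (n-1)`
together with a leaf `0` attached to `2` and a leaf `n` attached to `n - 2`. -/
def diagramD (n : ℕ) : SimpleGraph (Fin (n + 1)) :=
  SimpleGraph.fromRel fun i j =>
    (i.val = 0 ∧ j.val = 2) ∨ (1 ≤ i.val ∧ j.val = i.val + 1 ∧ j.val + 1 ≤ n) ∨
      (i.val + 2 = n ∧ j.val = n)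

/-- The graph on `Fin m` with the listed edges. -/
def diagramOfList (m : ℕ) (l : List (ℕ × ℕ)) : SimpleGraph (Fin m) :=
  SimpleGraph.fromRel fun i j => (i.val, j.val) ∈ l

/-- Type `Ẽ₆`: three legs of length two at the vertex `6`. -/
def diagramE6 : SimpleGraph (Fin 7) :=
  diagramOfList 7 [(0, 1), (1, 6), (2, 3), (3, 6), (4, 5), (5, 6)]

/-- Type `Ẽ₇`: legs of lengths three, one, three at the vertex `7`. -/
def diagramE7 : SimpleGraph (Fin 8) :=
  diagramOfList 8 [(0, 1), (1, 2), (2, 7), (3, 7), (4, 5), (5, 6), (6, 7)]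

/-- Type `Ẽ₈`: legs of lengths two, one, five at the vertex `8`. -/
def diagramE8 : SimpleGraph (Fin 9) :=
  diagramOfList 9 [(0, 1), (1, 8), (2, 8), (3, 4), (4, 5), (5, 6), (6, 7), (7, 8)]

/-- `Γ` is (isomorphic to) the Dynkin diagram of a simply-laced affine root system:
`Ãₙ` (`n ≥ 2`, a cycle on `n + 1` vertices), `D̃ₙ` (`n ≥ 4`), `Ẽ₆`, `Ẽ₇` or `Ẽ₈`. -/
def IsAffineDiagram {V : Type*} (Γ : SimpleGraph V) : Prop :=
  (∃ n, 2 ≤ n ∧ Nonempty (Γ ≃g SimpleGraph.cycleGraph (n + 1))) ∨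
  (∃ n, 4 ≤ n ∧ Nonempty (Γ ≃g diagramD n)) ∨
  Nonempty (Γ ≃g diagramE6) ∨ Nonempty (Γ ≃g diagramE7) ∨ Nonempty (Γ ≃g diagramE8)

/-! ### Quadratic residue symbols in `F[t]` -/

open Classical in
/-- The quadratic residue symbol `(f / p)` for a prime `p`. -/
def primeSymbol {F : Type*} [Field F] (f p : F[X]) : ℤ :=
  if p ∣ f then 0 else if ∃ h : F[X], p ∣ f - h ^ 2 then 1 else -1

open Classical in
/-- The quadratic residue symbol `(f / g)`, extended multiplicatively in `g`. -/
def residueSymbol {F : Type*} [Field F] (f g : F[X]) : ℤ :=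
  ((UniqueFactorizationMonoid.normalizedFactors g).map (primeSymbol f)).prod

/-! ### Weights, the series `Z`, and the four axioms -/

/-- Tuples of monic polynomials with prescribed degrees. -/
def monicTuples {σ : Type*} (F : Type*) [Field F] (a : σ →₀ ℕ) : Set (σ → F[X]) :=
  {f | ∀ i, (f i).Monic ∧ (f i).natDegree = a i}

/-- The formal power series `∑_f w(f) ∏ᵢ xᵢ ^ deg fᵢ` over all tuples `f` of monic polynomials.
Over a finite field each coefficient is a finite sum. -/
def degreeSeries {σ : Type*} (F : Type*) [Field F] (w : (σ → F[X]) → ℂ) : MvPowerSeries σ ℂ :=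
  fun a => ∑ᶠ f ∈ monicTuples F a, w f

/-- There are finitely many tuples of monic polynomials of given degrees over a finite field. -/
theorem finite_monicTuples {σ : Type*} [Finite σ] (F : Type*) [Field F] [Finite F]
    (a : σ →₀ ℕ) : (monicTuples F a).Finite := by
  have key : ∀ n : ℕ, {f : F[X] | f.Monic ∧ f.natDegree = n}.Finite := by
    intro n
    refine Set.Finite.of_injOn (f := fun (f : F[X]) (i : Fin (n + 1)) => f.coeff i)
      (t := Set.univ) (fun _ _ => Set.mem_univ _) ?_ Set.finite_univ
    intro f hf g hg h
    ext k
    by_cases hk : k < n + 1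
    · exact congrFun h ⟨k, hk⟩
    · have h1 : f.natDegree < k := by rw [hf.2]; omega
      have h2 : g.natDegree < k := by rw [hg.2]; omega
      rw [Polynomial.coeff_eq_zero_of_natDegree_lt h1,
        Polynomial.coeff_eq_zero_of_natDegree_lt h2]
  exact (Set.Finite.pi' fun i => key (a i)).subset fun f hf i => hf i

/-- A choice of weights `H(f₁, …, fₙ₊₁) ∈ ℂ` over every finite field. -/
abbrev Weights (V : Type*) : Type _ :=
  ∀ (F : Type) [Field F] [Finite F], (V → F[X]) → ℂ

/-- The multiple Dirichlet series `Z` over the finite field `F`. -/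
def Z {V : Type*} (H : Weights V) (F : Type) [Field F] [Finite F] : MvPowerSeries V ℂ :=
  degreeSeries F (H F)

/-- The four axioms for a family of weights `H` over all finite fields `F` of cardinality
`q ≡ 1 mod 4`; the polynomial `c a` is the coefficient of `∏ xᵢ ^ aᵢ` in `Z`, as a polynomial
in `q`. -/
structure SatisfiesAxioms {V : Type*} [Fintype V] [DecidableEq V] (Γ : SimpleGraph V)
    [DecidableRel Γ.Adj] (H : Weights V) (c : (V →₀ ℕ) → ℂ[X]) : Prop where
  /-- Twisted multiplicativity; the product of residue symbols is over all ordered pairs of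
  adjacent vertices. -/
  twisted_mul : ∀ (F : Type) [Field F] [Finite F], Nat.card F % 4 = 1 →
    ∀ f g : V → F[X], (∀ i, (f i).Monic) → (∀ i, (g i).Monic) →
      IsCoprime (∏ i, f i) (∏ i, g i) →
      H F (fun i => f i * g i) =
        H F f * H F g * ∏ i, ∏ j with Γ.Adj i j, (residueSymbol (f i) (g j) : ℂ)
  /-- The coefficients of `Z` are the values at `q` of the polynomials `c a`. -/
  coeff_eq : ∀ (F : Type) [Field F] [Finite F], Nat.card F % 4 = 1 →
    ∀ a : V →₀ ℕ, MvPowerSeries.coeff a (Z H F) = (c a).eval (Nat.card F : ℂ)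
  /-- The polynomial `c a` has degree at most `∑ aᵢ`. -/
  natDegree_le : ∀ a : V →₀ ℕ, (c a).natDegree ≤ ∑ i, a i
  /-- The local-to-global principle. -/
  local_global : ∀ (F : Type) [Field F] [Finite F], Nat.card F % 4 = 1 →
    ∀ p : F[X], p.Monic → Irreducible p → ∀ a : V →₀ ℕ,
      H F (fun i => p ^ a i) =
        ((Nat.card F : ℂ) ^ p.natDegree) ^ (∑ i, a i) *
          (c a).eval (((Nat.card F : ℂ) ^ p.natDegree)⁻¹)
  /-- Dominance: `c a` only has terms of degree greater than `(∑ aᵢ + 1) / 2`, except for the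
  constant and linear coefficients of `Z`. -/
  dominance : ∀ a : V →₀ ℕ, 2 ≤ ∑ i, a i → ∀ d, (c a).coeff d ≠ 0 → (∑ i, a i) + 1 < 2 * d
  /-- Initial conditions. -/
  initial : ∀ (F : Type) [Field F] [Finite F], Nat.card F % 4 = 1 →
    ∀ (i : V) (f : F[X]), f.Monic → H F (Pi.mulSingle i f) = 1

/-! ### The residue -/

section Residue

variable {V : Type*} [Fintype V] [DecidableEq V]

/-- Combine exponents of the variables in `S` and of those outside `S`. -/
def glueExp (S : Finset V) (a : S →₀ ℕ) (b : {i // i ∉ S} →₀ ℕ) : V →₀ ℕ :=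
  Finsupp.equivFunOnFinite.symm fun i => if h : i ∈ S then a ⟨i, h⟩ else b ⟨i, h⟩

variable {A : Type*} [CommRing A]

/-- `∏_{i ∈ T} (1 - q xᵢ) · Z`, where `T` is the complement of `S`. -/
def clearPoles (q : A) (S : Finset V) (Z : MvPowerSeries V A) : MvPowerSeries V A :=
  (∏ i ∈ Sᶜ, (1 - MvPowerSeries.C q * MvPowerSeries.X i)) * Z

/-- The formal residue is defined: for each monomial in the variables `x_S`, evaluating
`∏_{i ∈ T} (1 - q xᵢ) · Z` at given values of the `xᵢ`, `i ∈ T`, only involves finite sums. -/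
def ResidueExists (q : A) (S : Finset V) (Z : MvPowerSeries V A) : Prop :=
  ∀ a : S →₀ ℕ,
    {b : {i // i ∉ S} →₀ ℕ | MvPowerSeries.coeff (glueExp S a b) (clearPoles q S Z) ≠ 0}.Finite

/-- The formal residue `(-q)^|T| Res_{x_T = q⁻¹} Z`, a power series in the variables `x_S`:
multiply `Z` by `∏_{i ∈ T} (1 - q xᵢ)` and set `xᵢ = q⁻¹` for all `i ∈ T`. Here `T` is the
complement of `S` and `q'` stands for the inverse of `q` in the coefficient ring `A`. -/
def residue (q q' : A) (S : Finset V) (Z : MvPowerSeries V A) : MvPowerSeries S A :=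
  fun a => ∑ᶠ b : {i // i ∉ S} →₀ ℕ,
    MvPowerSeries.coeff (glueExp S a b) (clearPoles q S Z) * ∏ i, q' ^ b i

variable (Γ : SimpleGraph V) [DecidableRel Γ.Adj]

/-- `A(i) = ∑_{j ∼ i} aⱼ` for a vertex `i` outside `S`, all of whose neighbours are in `S`. -/
def nbrSum (S : Finset V) (a : S →₀ ℕ) (i : V) : ℕ := ∑ j ∈ Finset.univ.filter (fun j : S => Γ.Adj i j), a j

/-- `∏_{j ∼ i} fⱼ` for a vertex `i` outside `S`, all of whose neighbours are in `S`. -/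
def nbrProd {F : Type*} [Field F] (S : Finset V) (f : S → F[X]) (i : V) : F[X] :=
  ∏ j ∈ Finset.univ.filter (fun j : S => Γ.Adj i j), f j

/-- `a'ᵢ = aᵢ` for `i ∈ S` and `a'ᵢ = A(i)` for `i ∈ T`. -/
def extendExp (S : Finset V) (a : S →₀ ℕ) : V →₀ ℕ :=
  Finsupp.equivFunOnFinite.symm fun i => if h : i ∈ S then a ⟨i, h⟩ else nbrSum Γ S a i

/-- `f'ᵢ = fᵢ` for `i ∈ S` and `f'ᵢ = ∏_{j ∼ i} fⱼ` for `i ∈ T`. -/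
def extendPoly {F : Type*} [Field F] (S : Finset V) (f : S → F[X]) : V → F[X] :=
  fun i => if h : i ∈ S then f ⟨i, h⟩ else nbrProd Γ S f i

/-- `q ^ (-N(i)/2)`, where `N(i)` is the number of neighbours of `i`. -/
def sqrtWeight (q : ℕ) (i : V) : ℂ := ((Real.sqrt q : ℝ) : ℂ)⁻¹ ^ Γ.degree i

/-- The Euler factor `∑_a H(p^{a'}) ∏_{i ∈ S} (q^{-N(i)/2} xᵢ)^{aᵢ deg p}` at a prime `p`. -/
def eulerFactor (H : Weights V) (S : Finset V) (F : Type) [Field F] [Finite F] (p : F[X]) :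
    MvPowerSeries S ℂ :=
  fun m => if ∀ i, p.natDegree ∣ m i then
      H F (fun i => p ^ extendExp Γ S (m.mapRange (· / p.natDegree) (Nat.zero_div _)) i) *
        ∏ i : S, sqrtWeight Γ (Nat.card F) i ^ m i
    else 0

end Residue

/-! ### Formal infinite products -/

/-- The family `f` of formal power series has the formal product `P`: each coefficient of the
finite partial products is eventually equal to that of `P`. -/
def FormalHasProd {ι σ A : Type*} [CommRing A] (f : ι → MvPowerSeries σ A)
    (P : MvPowerSeries σ A) : Prop :=
  ∀ m : σ →₀ ℕ, ∀ᶠ s : Finset ι in Filter.atTop,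
    MvPowerSeries.coeff m (∏ i ∈ s, f i) = MvPowerSeries.coeff m P

/-- The power series `(1 - q^μ x^ν)^{-l} = ∑_k (l (l+1) ⋯ (l+k-1) / k!) q^{kμ} x^{kν}`, for
`ν ≠ 0` (then `m = k ν` forces `k ≤ ∑ mᵢ`), with coefficients Laurent polynomials in `q`. -/
def binomialFactor {σ : Type*} (μ : ℤ) (ν : σ →₀ ℕ) (l : ℂ) :
    MvPowerSeries σ (LaurentPolynomial ℂ) :=
  open Classical in
  fun m => ∑ k ∈ Finset.range (m.degree + 1),
    if m = k • ν then
      LaurentPolynomial.C ((ascPochhammer ℂ k).eval l / (k.factorial : ℂ)) *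
        LaurentPolynomial.T (k * μ)
    else 0

/-- `P = ∏_{μ, ν ≠ 0} (1 - q^μ x^ν)^{-lam(μ, ν)}` as formal power series. -/
def IsFactorization {σ : Type*} (P : MvPowerSeries σ (LaurentPolynomial ℂ))
    (lam : ℤ → {ν : σ →₀ ℕ // ν ≠ 0} → ℂ) : Prop :=
  FormalHasProd (fun k : ℤ × {ν : σ →₀ ℕ // ν ≠ 0} => binomialFactor k.1 k.2.1 (lam k.1 k.2)) P

/-- The series `Z` with `q` an indeterminate: `∑_a c_a(q) x^a`. -/
def formalZ {V : Type*} (c : (V →₀ ℕ) → ℂ[X]) : MvPowerSeries V (LaurentPolynomial ℂ) :=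
  fun a => Polynomial.toLaurent (c a)

/-- The residue of `Z` with `q` an indeterminate. -/
def formalResidue {V : Type*} [Fintype V] [DecidableEq V] (S : Finset V)
    (c : (V →₀ ℕ) → ℂ[X]) : MvPowerSeries S (LaurentPolynomial ℂ) :=
  residue (LaurentPolynomial.T 1) (LaurentPolynomial.T (-1)) S (formalZ c)

end

end AffineMDS

open AffineMDS

open scoped Polynomial

namespace AffineMDS

noncomputable section

/-! ### Properties of the quadratic residue symbol -/

section Symbol

open Polynomial UniqueFactorizationMonoid

/-! The whole theorem comes from a functional equation in each single variable. Fix a vertex i and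
the polynomials u_j in the other positions. By twisted multiplicativity, the series ∑_g H(u, g)
x_i^(deg g) is a palindromic polynomial times the quadratic L-series of D₀, the squarefree part of
∏_{j ∼ i} u_j (`IsTwisted.exists_vertexSeries_eq`), provided the local weights at the primes
dividing the u_j are already palindromic. The functional equation of the L-series comes from
quadratic Gauss sums (`symbolSeries_odd`, `symbolSeries_even`), and reciprocity carries no sign
because q ≡ 1 mod 4.

The local weights are again the coefficients c_a, evaluated at q^(-deg p), so global and local
functional equations are proved together, by induction on the total degree in the other variables
(`SatisfiesAxioms.stableFE`). The tuples not covered by the induction hypothesis are the powers of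
one linear polynomial. They contribute q times the dual of the unknown coefficient, so the defect e
in the functional equation satisfies e(q) = q^M e(1/q). Dominance puts all terms of e above degree
M/2, which forces e = 0 (`eq_zero_of_dominant`).

It follows that, in x_i, each coefficient is a polynomial of degree at most A(i), divided by 1 - q
x_i when A(i) is even, and a polynomial of degree less than A(i) when A(i) is odd. Since T contains
no edges, this holds for all i ∈ T at once. After the poles are cleared, only exponents up to A(i)
survive, and evaluation at q⁻¹ telescopes to the coefficient at a' (`coeff_residue`). That
coefficient sums H over all g_i of degree A(i). The sum vanishes when D₀ ≠ 1, by degrees; when D₀ =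
1, palindromicity makes it q^(A(i)/2) times the weight at g_i = ∏_{j ∼ i} f_j
(`IsTwisted.sum_monics`). So the surviving weights have squares at the positions in T, every residue
symbol in the twist is 1, and the residue has an Euler product.

For the factorization, each new degree ν determines the exponents λ(μ, ν) as the coefficients of a
Laurent polynomial. For the symmetry, local-to-global says that the Euler factor of R at p is R
itself with q replaced by q^(-deg p) and the variables rescaled (`SatisfiesAxioms.eulerFactor_eq`).
Inserting the factorization into every Euler factor turns each (1 - q^μ x^ν)^(-λ) into a power of
the zeta function of F[t], which is again a factor of the same shape with μ replaced by μ'. This is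
a second factorization of R, and uniqueness matches the two. -/

theorem quadraticChar_norm (F K : Type*) [Field F] [Fintype F] [DecidableEq F] [Field K]
    [Fintype K] [DecidableEq K] [Algebra F K] (hF : ringChar F ≠ 2) (x : K) :
    quadraticChar F (Algebra.norm F x) = quadraticChar K x := by
  have hK : ringChar K ≠ 2 := by rwa [← Algebra.ringChar_eq F K]
  by_cases hx : x = 0
  · subst hx
    simp [Algebra.norm_zero]
  have hN : Algebra.norm F x ≠ 0 := Algebra.norm_ne_zero_iff.mpr hx
  rw [quadraticChar_eq_pow_of_char_ne_two hF hN, quadraticChar_eq_pow_of_char_ne_two hK hx]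
  -- Euler's criterion on both sides: the norm is x ^ ((|K| - 1) / (|F| - 1)), so its power (|F| -
  -- 1) / 2 is x ^ ((|K| - 1) / 2).
  have key : algebraMap F K (Algebra.norm F x ^ (Fintype.card F / 2)) =
      x ^ (Fintype.card K / 2) := by
    rw [map_pow, FiniteField.algebraMap_norm_eq_pow, ← pow_mul]
    congr 1
    rw [Nat.card_eq_fintype_card, Nat.card_eq_fintype_card]
    have h1 : Fintype.card F % 2 = 1 := FiniteField.odd_card_of_char_ne_two hF
    have h2 : Fintype.card K % 2 = 1 := FiniteField.odd_card_of_char_ne_two hK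
    have h3 : Fintype.card F - 1 ∣ Fintype.card K - 1 := by
      rw [Module.card_eq_pow_finrank (K := F) (V := K)]
      simpa using Nat.sub_dvd_pow_sub_pow (Fintype.card F) 1 (Module.finrank F K)
    obtain ⟨k, hk⟩ := h3
    have h4 : 1 < Fintype.card F := Fintype.one_lt_card
    rw [hk, Nat.mul_div_cancel_left _ (by omega)]
    obtain ⟨a, ha⟩ : ∃ a, Fintype.card F = 2 * a + 1 := ⟨Fintype.card F / 2, by omega⟩
    obtain ⟨b, hb⟩ : ∃ b, Fintype.card K = 2 * b + 1 := ⟨Fintype.card K / 2, by omega⟩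
    rw [ha, hb] at hk ⊢
    simp only [Nat.add_sub_cancel] at hk
    have : (2 * a + 1) / 2 = a := by omega
    have h' : (2 * b + 1) / 2 = b := by omega
    rw [this, h']
    have : 2 * b = 2 * (k * a) := by rw [hk]; ring
    omega
  rw [← key]
  have : (algebraMap F K (Algebra.norm F x ^ (Fintype.card F / 2)) = 1) ↔
      Algebra.norm F x ^ (Fintype.card F / 2) = 1 := by
    rw [← map_one (algebraMap F K)]
    exact (algebraMap F K).injective.eq_iff
  simp only [this]

/-- In an algebraic closure both sides are the product of f(θ) over the roots θ of p. These roots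
are distinct because F is perfect, so they correspond to the embeddings of F[t]/p. -/
theorem norm_mk_eq_resultant {F : Type*} [Field F] [Finite F] {p : F[X]} (hp : p.Monic)
    (hirr : Irreducible p) (f : F[X]) :
    Algebra.norm F (AdjoinRoot.mk p f) = resultant p f := by
  classical
  have : Fact (Irreducible p) := ⟨hirr⟩
  let pb := AdjoinRoot.powerBasis hirr.ne_zero
  have : Module.Finite F (AdjoinRoot p) := pb.finite
  let Ω := AlgebraicClosure F
  apply (algebraMap F Ω).injective
  have hmin : minpoly F pb.gen = p := by
    rw [AdjoinRoot.minpoly_powerBasis_gen hirr.ne_zero, hp.leadingCoeff]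
    simp
  rw [Algebra.norm_eq_prod_embeddings F Ω]
  have h1 : algebraMap F Ω (resultant p f) =
      ((p.aroots Ω).map (fun θ => aeval θ f)).prod := by
    rw [← resultant_map_map]
    have h := resultant_eq_prod_eval (p.map (algebraMap F Ω)) (f.map (algebraMap F Ω))
      f.natDegree natDegree_map_le (IsAlgClosed.splits _)
    rw [natDegree_map, (hp.map _).leadingCoeff, one_pow, one_mul] at h
    rw [h]
    simp only [aroots_def, eval_map_algebraMap]
  rw [h1]
  have hsep : p.Separable := PerfectField.separable_of_irreducible hirr
  rw [@Fintype.prod_equiv (AdjoinRoot p →ₐ[F] Ω) _ _ _ _ _ pb.liftEquiv'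
    (fun σ => σ (AdjoinRoot.mk p f)) (fun x => aeval x.1 f) ?_]
  · rw [Finset.prod_mem_multiset _ _ (fun x : Ω => aeval x f) (fun _ => rfl), hmin,
      Finset.prod_eq_multiset_prod, Multiset.toFinset_val, Multiset.dedup_eq_self.mpr]
    exact nodup_roots hsep.map
  · intro σ
    simp only [PowerBasis.liftEquiv'_apply_coe]
    have : pb.gen = AdjoinRoot.root p := AdjoinRoot.powerBasis_gen _
    rw [this, Polynomial.aeval_algHom_apply, AdjoinRoot.aeval_eq]

/-- The symbol is the quadratic character of the field F[t]/p, which factors through the norm to F,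
and that norm is a resultant. -/
theorem primeSymbol_eq_quadraticChar {F : Type*} [Field F] [Fintype F] [DecidableEq F]
    (hF : ringChar F ≠ 2) {p : F[X]} (hp : p.Monic) (hirr : Irreducible p) (f : F[X]) :
    primeSymbol f p = quadraticChar F (resultant p f) := by
  classical
  have : Fact (Irreducible p) := ⟨hirr⟩
  let pb := AdjoinRoot.powerBasis hirr.ne_zero
  have : Module.Finite F (AdjoinRoot p) := pb.finite
  have : Finite (AdjoinRoot p) := Module.finite_of_finite F
  let := Fintype.ofFinite (AdjoinRoot p)
  rw [← norm_mk_eq_resultant hp hirr, quadraticChar_norm F (AdjoinRoot p) hF, primeSymbol,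
    quadraticChar_apply, quadraticCharFun]
  simp only [AdjoinRoot.mk_eq_zero]
  congr 2
  refine propext ⟨?_, ?_⟩
  · rintro ⟨h, hh⟩
    refine ⟨AdjoinRoot.mk p h, ?_⟩
    rw [← map_mul, AdjoinRoot.mk_eq_mk]
    simpa [sq] using hh
  · rintro ⟨y, hy⟩
    obtain ⟨h, rfl⟩ := AdjoinRoot.mk_surjective y
    refine ⟨h, ?_⟩
    rw [← map_mul, AdjoinRoot.mk_eq_mk] at hy
    simpa [sq] using hy

variable {F : Type*} [Field F]

theorem residueSymbol_one_right (f : F[X]) : residueSymbol f 1 = 1 := by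
  simp [residueSymbol]

open Classical in
theorem residueSymbol_mul_right (f : F[X]) {g h : F[X]} (hg : g ≠ 0) (hh : h ≠ 0) :
    residueSymbol f (g * h) = residueSymbol f g * residueSymbol f h := by
  simp [residueSymbol, normalizedFactors_mul hg hh]

open Classical in
theorem residueSymbol_prime (f : F[X]) {p : F[X]} (hp : p.Monic) (hirr : Irreducible p) :
    residueSymbol f p = primeSymbol f p := by
  simp [residueSymbol, normalizedFactors_irreducible hirr, hp.normalize_eq_self]

open Classical in
theorem residueSymbol_congr {f₁ f₂ g : F[X]} (h : g ∣ f₁ - f₂) :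
    residueSymbol f₁ g = residueSymbol f₂ g := by
  unfold residueSymbol
  congr 1
  refine Multiset.map_congr rfl fun p hp => ?_
  have hpd : p ∣ f₁ - f₂ := (dvd_of_mem_normalizedFactors hp).trans h
  unfold primeSymbol
  have h1 : p ∣ f₁ ↔ p ∣ f₂ := by
    constructor
    · intro h'
      simpa using dvd_sub h' hpd
    · intro h'
      simpa using dvd_add h' hpd
  have h2 : (∃ h, p ∣ f₁ - h ^ 2) ↔ ∃ h, p ∣ f₂ - h ^ 2 := by
    refine exists_congr fun k => ?_
    constructor
    · intro h'
      have := dvd_sub h' hpd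
      simpa using this
    · intro h'
      have := dvd_add h' hpd
      simpa using this
  simp only [h1, h2]

theorem residueSymbol_mul_right_monic (f : F[X]) {g h : F[X]} (hg : g.Monic) (hh : h.Monic) :
    residueSymbol f (g * h) = residueSymbol f g * residueSymbol f h :=
  residueSymbol_mul_right f hg.ne_zero hh.ne_zero

theorem residueSymbol_pow_right (f : F[X]) {g : F[X]} (hg : g.Monic) (n : ℕ) :
    residueSymbol f (g ^ n) = residueSymbol f g ^ n := by
  induction n with
  | zero => simp [residueSymbol_one_right]
  | succ n ih => rw [pow_succ, residueSymbol_mul_right_monic f (hg.pow n) hg, ih, pow_succ]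

theorem residueSymbol_prod_right {ι : Type*} (f : F[X]) (s : Finset ι) (g : ι → F[X])
    (hg : ∀ i ∈ s, (g i).Monic) :
    residueSymbol f (∏ i ∈ s, g i) = ∏ i ∈ s, residueSymbol f (g i) := by
  classical
  induction s using Finset.induction_on with
  | empty => simp [residueSymbol_one_right]
  | insert a s ha ih =>
    rw [Finset.prod_insert ha, Finset.prod_insert ha, residueSymbol_mul_right_monic, ih]
    · exact fun i hi => hg i (Finset.mem_insert_of_mem hi)
    · exact hg a (Finset.mem_insert_self _ _)
    · exact monic_prod_of_monic _ _ fun i hi => hg i (Finset.mem_insert_of_mem hi)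

/-- Induction over monic polynomials, one monic irreducible factor at a time. -/
theorem monic_induction {P : F[X] → Prop} (h1 : P 1)
    (hmul : ∀ p g : F[X], p.Monic → Irreducible p → g.Monic → P g → P (p * g)) :
    ∀ g : F[X], g.Monic → P g := by
  intro g
  induction hn : g.natDegree using Nat.strong_induction_on generalizing g with
  | _ n ih =>
    intro hg
    by_cases hd : g.natDegree = 0
    · rw [hg.natDegree_eq_zero.mp hd]
      exact h1
    · obtain ⟨p, hp, hpirr, ⟨r, hr⟩⟩ := exists_monic_irreducible_factor g
        (by intro h; exact hd (natDegree_eq_zero_of_isUnit h))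
      have hrm : r.Monic := by
        rw [hr] at hg
        exact hp.of_mul_monic_left hg
      rw [hr]
      refine hmul p r hp hpirr hrm (ih _ ?_ r rfl hrm)
      rw [← hn, hr, hp.natDegree_mul hrm]
      have := hpirr.natDegree_pos
      omega

/-- Reciprocity, multiplicativity in the upper argument and vanishing for non-coprime arguments are
all read off from this formula. -/
theorem residueSymbol_eq_quadraticChar [Fintype F] [DecidableEq F]
    (hF : ringChar F ≠ 2) (f : F[X]) : ∀ g : F[X], g.Monic →
    residueSymbol f g = quadraticChar F (resultant g f) := by
  refine monic_induction ?_ ?_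
  · rw [residueSymbol_one_right]
    simp
  · intro p g hp hirr hg ih
    rw [residueSymbol_mul_right_monic f hp hg, residueSymbol_prime f hp hirr, ih,
      primeSymbol_eq_quadraticChar hF hp hirr, ← map_mul, hp.natDegree_mul hg,
      resultant_mul_left _ _ _ _ le_rfl]

theorem ringChar_ne_two [Finite F] (hq : Nat.card F % 4 = 1) : ringChar F ≠ 2 := by
  have := Fintype.ofFinite F
  intro h
  have := FiniteField.even_card_of_char_two h
  rw [Nat.card_eq_fintype_card] at hq
  omega

/-- Exchanging the arguments of a resultant costs a power of -1, and -1 is a square in F because q ≡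
1 mod 4. -/
theorem residueSymbol_comm [Finite F] (hq : Nat.card F % 4 = 1) {f g : F[X]}
    (hf : f.Monic) (hg : g.Monic) : residueSymbol f g = residueSymbol g f := by
  classical
  have := Fintype.ofFinite F
  have h2 := ringChar_ne_two hq
  rw [residueSymbol_eq_quadraticChar h2 f g hg, residueSymbol_eq_quadraticChar h2 g f hf,
    resultant_comm, map_mul, map_pow]
  have : quadraticChar F (-1) = 1 := by
    rw [quadraticChar_one_iff_isSquare (by simp)]
    rw [FiniteField.isSquare_neg_one_iff, ← Nat.card_eq_fintype_card]
    omega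
  rw [this, one_pow, one_mul]

theorem residueSymbol_mul_left [Finite F] (hq : Nat.card F % 4 = 1) (f₁ f₂ : F[X]) {g : F[X]}
    (hg : g.Monic) : residueSymbol (f₁ * f₂) g = residueSymbol f₁ g * residueSymbol f₂ g := by
  classical
  have := Fintype.ofFinite F
  have h2 := ringChar_ne_two hq
  -- Degrees add only for nonzero factors. The symbol of 0 vanishes except modulo 1, where every
  -- symbol is 1.
  by_cases h1 : f₁ = 0 ∨ f₂ = 0
  · by_cases hd : g = 1
    · simp [hd, residueSymbol_one_right]
    · have hz : residueSymbol 0 g = 0 := by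
        rw [residueSymbol_eq_quadraticChar h2 _ g hg, quadraticChar_eq_zero_iff,
          resultant_eq_zero_iff]
        refine ⟨Or.inl hg.ne_zero, ?_⟩
        rw [isCoprime_zero_right]
        intro h
        exact hd (hg.eq_one_of_isUnit h)
      rcases h1 with rfl | rfl <;> simp [hz]
  · push Not at h1
    rw [residueSymbol_eq_quadraticChar h2 _ g hg, residueSymbol_eq_quadraticChar h2 _ g hg,
      residueSymbol_eq_quadraticChar h2 _ g hg, ← map_mul, natDegree_mul h1.1 h1.2,
      resultant_mul_right _ _ _ _ le_rfl]

open Classical in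
theorem residueSymbol_one_left (g : F[X]) : residueSymbol 1 g = 1 := by
  unfold residueSymbol
  refine Multiset.prod_eq_one fun x hx => ?_
  obtain ⟨p, hp, rfl⟩ := Multiset.mem_map.mp hx
  have hirr := irreducible_of_normalized_factor p hp
  rw [primeSymbol, if_neg, if_pos ⟨1, by simp⟩]
  exact fun h => hirr.not_isUnit (isUnit_of_dvd_one h)

theorem residueSymbol_pow_left [Finite F] (hq : Nat.card F % 4 = 1) (f : F[X]) {g : F[X]}
    (hg : g.Monic) (n : ℕ) : residueSymbol (f ^ n) g = residueSymbol f g ^ n := by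
  induction n with
  | zero => simp [residueSymbol_one_left]
  | succ n ih => rw [pow_succ, residueSymbol_mul_left hq _ _ hg, ih, pow_succ]

theorem residueSymbol_prod_left [Finite F] (hq : Nat.card F % 4 = 1) {ι : Type*} (s : Finset ι)
    (f : ι → F[X]) {g : F[X]} (hg : g.Monic) :
    residueSymbol (∏ i ∈ s, f i) g = ∏ i ∈ s, residueSymbol (f i) g := by
  classical
  induction s using Finset.induction_on with
  | empty => simp [residueSymbol_one_left]
  | insert a s ha ih =>
    rw [Finset.prod_insert ha, Finset.prod_insert ha, residueSymbol_mul_left hq _ _ hg, ih]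

theorem residueSymbol_eq_zero [Finite F] (hq : Nat.card F % 4 = 1) {f g : F[X]}
    (hg : g.Monic) (h : ¬ IsCoprime f g) : residueSymbol f g = 0 := by
  classical
  have := Fintype.ofFinite F
  rw [residueSymbol_eq_quadraticChar (ringChar_ne_two hq) f g hg, quadraticChar_eq_zero_iff,
    resultant_eq_zero_iff]
  exact ⟨Or.inl hg.ne_zero, fun h' => h h'.symm⟩

theorem residueSymbol_sq [Finite F] (hq : Nat.card F % 4 = 1) {f g : F[X]}
    (hg : g.Monic) (h : IsCoprime f g) : residueSymbol f g ^ 2 = 1 := by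
  classical
  have := Fintype.ofFinite F
  rw [residueSymbol_eq_quadraticChar (ringChar_ne_two hq) f g hg]
  refine quadraticChar_sq_one ?_
  rw [Ne, resultant_eq_zero_iff]
  exact fun h' => h'.2 h.symm

theorem residueSymbol_C [Fintype F] [DecidableEq F] (hq : Nat.card F % 4 = 1) (c : F) {g : F[X]}
    (hg : g.Monic) : residueSymbol (C c) g = quadraticChar F c ^ g.natDegree := by
  rw [residueSymbol_eq_quadraticChar (ringChar_ne_two hq) _ g hg, resultant_C_right,
    Polynomial.coeff_natDegree, hg.leadingCoeff, one_pow, one_mul, map_pow]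

end Symbol

end

end AffineMDS

open scoped Polynomial

namespace AffineMDS

noncomputable section

/-! ### Gauss sums modulo squarefree polynomials -/

section Gauss

open Polynomial

instance finite_degreeLT (F : Type*) [Field F] [Finite F] (n : ℕ) : Finite (degreeLT F n) :=
  Finite.of_equiv _ (degreeLTEquiv F n).symm.toEquiv

instance fintypeDegreeLT (F : Type*) [Field F] [Finite F] (n : ℕ) : Fintype (degreeLT F n) :=
  Fintype.ofFinite _

variable {F : Type*} [Field F]

theorem card_degreeLT [Finite F] (n : ℕ) : Nat.card (degreeLT F n) = Nat.card F ^ n := by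
  rw [Nat.card_congr (degreeLTEquiv F n).toEquiv, Nat.card_pi, Finset.prod_const,
    Finset.card_univ, Fintype.card_fin]

/-- The coefficient of `1/t` in the expansion of `g / D` in powers of `1/t`. -/
def resid (D : F[X]) : F[X] →ₗ[F] F := (lcoeff F (D.natDegree - 1)).comp (modByMonicHom D)

theorem resid_apply (D g : F[X]) : resid D g = (g %ₘ D).coeff (D.natDegree - 1) := rfl

theorem resid_eq_zero_of_dvd {D g : F[X]} (hD : D.Monic) (h : D ∣ g) : resid D g = 0 := by
  rw [resid_apply, (modByMonic_eq_zero_iff_dvd hD).mpr h, coeff_zero]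

theorem resid_congr {D g₁ g₂ : F[X]} (hD : D.Monic) (h : D ∣ g₁ - g₂) :
    resid D g₁ = resid D g₂ := by
  rw [← sub_eq_zero, ← map_sub, resid_eq_zero_of_dvd hD h]

theorem resid_of_degree_lt {D g : F[X]} (hD : D.Monic) (h : g.degree < D.degree) :
    resid D g = g.coeff (D.natDegree - 1) := by
  rw [resid_apply, (modByMonic_eq_self_iff hD).mpr h]

theorem degree_modByMonic_lt_natDegree {D : F[X]} (hD : D.Monic) (g : F[X]) :
    (g %ₘ D).degree < D.natDegree :=
  (degree_modByMonic_lt g hD).trans_eq (degree_eq_natDegree hD.ne_zero)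

/-- The fractions g / D₁ and g D₂ / (D₁ D₂) coincide. This lets additive characters modulo D₁ and D₂
be combined into one modulo D₁ D₂. -/
theorem resid_mul_right {D₁ D₂ : F[X]} (h₁ : D₁.Monic) (h₂ : D₂.Monic) (g : F[X]) :
    resid (D₁ * D₂) (g * D₂) = resid D₁ g := by
  by_cases h0 : D₁ = 1
  · subst h0
    rw [resid_eq_zero_of_dvd (h₁.mul h₂) (by simp), resid_eq_zero_of_dvd h₁ (one_dvd g)]
  have hpos : 0 < D₁.natDegree := by
    rw [Nat.pos_iff_ne_zero]
    exact fun h => h0 (h₁.natDegree_eq_zero.mp h)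
  have hr := degree_modByMonic_lt_natDegree h₁ g
  have hr' : (g %ₘ D₁).natDegree ≤ D₁.natDegree - 1 := by
    have := natDegree_modByMonic_lt g h₁ h0
    omega
  have hlt : ((g %ₘ D₁) * D₂).degree < (D₁ * D₂).degree := by
    rw [h₂.degree_mul, h₂.degree_mul, degree_eq_natDegree h₁.ne_zero,
      degree_eq_natDegree h₂.ne_zero]
    by_cases h : g %ₘ D₁ = 0
    · rw [h, degree_zero, WithBot.bot_add, ← Nat.cast_add]
      exact WithBot.bot_lt_coe _
    · rw [degree_eq_natDegree h] at hr ⊢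
      norm_cast at hr ⊢
      omega
  have hdvd : D₁ * D₂ ∣ g * D₂ - (g %ₘ D₁) * D₂ := by
    rw [← sub_mul]
    refine mul_dvd_mul_right ?_ _
    refine ⟨g /ₘ D₁, ?_⟩
    linear_combination -(modByMonic_add_div g D₁)
  rw [resid_congr (h₁.mul h₂) hdvd, resid_of_degree_lt (h₁.mul h₂) hlt, resid_apply,
    h₁.natDegree_mul h₂, show D₁.natDegree + D₂.natDegree - 1 = (D₁.natDegree - 1) +
    D₂.natDegree by omega, coeff_mul_add_eq_of_natDegree_le hr' le_rfl, h₂.coeff_natDegree,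
    mul_one]

/-- A nonzero functional is onto F, so it pulls a nontrivial character back to a nontrivial one. -/
theorem sum_addChar_linearMap {ψ : AddChar F ℂ} (hψ : ψ ≠ 1) {M : Type*} [AddCommGroup M]
    [Module F M] [Fintype M] (l : M →ₗ[F] F) [Decidable (l = 0)] :
    ∑ m, ψ (l m) = if l = 0 then (Nat.card M : ℂ) else 0 := by
  classical
  have h := AddChar.sum_eq_ite (ψ.compAddMonoidHom l.toAddMonoidHom)
  simp only [AddChar.compAddMonoidHom_apply, LinearMap.toAddMonoidHom_coe] at h
  rw [h, Nat.card_eq_fintype_card]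
  refine if_congr ?_ rfl rfl
  constructor
  · intro h0
    by_contra hl
    apply hψ
    ext x
    obtain ⟨y, rfl⟩ := LinearMap.surjective hl x
    exact DFunLike.congr_fun h0 y
  · rintro rfl
    ext x
    simp

variable [Finite F]

theorem bijective_degreeLT_of_injective {α : Type*} [Finite α] {n : ℕ} (f : α → degreeLT F n)
    (hf : Function.Injective f) (hc : Nat.card α = Nat.card F ^ n) : Function.Bijective f := by
  have := Fintype.ofFinite α
  rw [Fintype.bijective_iff_injective_and_card]
  refine ⟨hf, ?_⟩
  rw [← Nat.card_eq_fintype_card, ← Nat.card_eq_fintype_card, hc, card_degreeLT]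

/-- Chinese remainder theorem on reduced representatives: coprimality gives injectivity, and
counting gives the rest. -/
theorem sum_degreeLT_mul {A : Type*} [AddCommMonoid A] {D₁ D₂ : F[X]} (h₁ : D₁.Monic)
    (h₂ : D₂.Monic) (hc : IsCoprime D₁ D₂) (φ : F[X] → A) :
    ∑ h : degreeLT F (D₁ * D₂).natDegree, φ h =
      ∑ x : degreeLT F D₁.natDegree, ∑ y : degreeLT F D₂.natDegree,
        φ (x * D₂ + y * D₁) := by
  rw [← Fintype.sum_prod_type']
  symm
  have hmem : ∀ z : degreeLT F D₁.natDegree × degreeLT F D₂.natDegree,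
      (z.1 * D₂ + z.2 * D₁ : F[X]) ∈ degreeLT F (D₁ * D₂).natDegree := by
    rintro ⟨⟨x, hx⟩, ⟨y, hy⟩⟩
    rw [mem_degreeLT] at hx hy ⊢
    rw [h₁.natDegree_mul h₂]
    have aux : ∀ {m n : ℕ} {a b : F[X]}, a.degree < (m : WithBot ℕ) → b.Monic →
        b.natDegree = n → (a * b).degree < ((m + n : ℕ) : WithBot ℕ) := by
      intro m n a b ha hb hn
      rw [hb.degree_mul, degree_eq_natDegree hb.ne_zero, hn]
      by_cases h : a = 0
      · rw [h, degree_zero, WithBot.bot_add]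
        exact WithBot.bot_lt_coe _
      · rw [degree_eq_natDegree h] at ha ⊢
        norm_cast at ha ⊢
        omega
    refine (degree_add_le _ _).trans_lt (max_lt (aux hx h₂ rfl) ?_)
    rw [add_comm]
    exact aux hy h₁ rfl
  refine Fintype.sum_bijective (fun z => ⟨z.1 * D₂ + z.2 * D₁, hmem z⟩)
    (bijective_degreeLT_of_injective _ ?_ ?_) _ _ fun z => rfl
  · rintro ⟨⟨x, hx⟩, ⟨y, hy⟩⟩ ⟨⟨x', hx'⟩, ⟨y', hy'⟩⟩ h
    simp only [Subtype.mk.injEq] at h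
    rw [mem_degreeLT] at hx hy hx' hy'
    have e1 : D₁ ∣ x - x' := by
      refine hc.dvd_of_dvd_mul_right (?_ : D₁ ∣ (x - x') * D₂)
      refine ⟨y' - y, ?_⟩
      linear_combination h
    have e2 : D₂ ∣ y - y' := by
      refine hc.symm.dvd_of_dvd_mul_right (?_ : D₂ ∣ (y - y') * D₁)
      refine ⟨x' - x, ?_⟩
      linear_combination h
    have z1 : x - x' = 0 := by
      refine eq_zero_of_dvd_of_degree_lt e1 ?_
      rw [degree_eq_natDegree h₁.ne_zero]
      exact (degree_sub_le _ _).trans_lt (max_lt hx hx')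
    have z2 : y - y' = 0 := by
      refine eq_zero_of_dvd_of_degree_lt e2 ?_
      rw [degree_eq_natDegree h₂.ne_zero]
      exact (degree_sub_le _ _).trans_lt (max_lt hy hy')
    simp only [Prod.mk.injEq, Subtype.mk.injEq]
    exact ⟨sub_eq_zero.mp z1, sub_eq_zero.mp z2⟩
  · rw [Nat.card_prod, card_degreeLT, card_degreeLT, h₁.natDegree_mul h₂, pow_add]

theorem sum_degreeLT_add {A : Type*} [AddCommMonoid A] (a b : ℕ) (φ : F[X] → A) :
    ∑ h : degreeLT F (a + b), φ h =
      ∑ v : degreeLT F b, ∑ u : degreeLT F a, φ ((u : F[X]) + (v : F[X]) * X ^ a) := by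
  rw [← Fintype.sum_prod_type']
  symm
  have hmem : ∀ z : degreeLT F b × degreeLT F a,
      ((z.2 : F[X]) + (z.1 : F[X]) * X ^ a) ∈ degreeLT F (a + b) := by
    rintro ⟨⟨v, hv⟩, ⟨u, hu⟩⟩
    rw [mem_degreeLT] at hu hv ⊢
    change (u + v * X ^ a).degree < _
    refine (degree_add_le _ _).trans_lt (max_lt (hu.trans_le ?_) ?_)
    · exact_mod_cast Nat.le_add_right a b
    · rw [degree_mul, degree_X_pow]
      by_cases h : v = 0
      · rw [h, degree_zero, WithBot.bot_add]
        exact WithBot.bot_lt_coe _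
      · rw [degree_eq_natDegree h] at hv ⊢
        norm_cast at hv ⊢
        omega
  refine Fintype.sum_bijective (fun z => ⟨(z.2 : F[X]) + (z.1 : F[X]) * X ^ a, hmem z⟩)
    (bijective_degreeLT_of_injective _ ?_ ?_) _ _ fun z => rfl
  · rintro ⟨⟨v, hv⟩, ⟨u, hu⟩⟩ ⟨⟨v', hv'⟩, ⟨u', hu'⟩⟩ h
    simp only [Subtype.mk.injEq] at h
    rw [mem_degreeLT] at hu hu'
    have e : (X : F[X]) ^ a ∣ u - u' := ⟨v' - v, by linear_combination h⟩
    have z : u - u' = 0 := by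
      refine eq_zero_of_dvd_of_degree_lt e ?_
      rw [degree_X_pow]
      exact (degree_sub_le _ _).trans_lt (max_lt hu hu')
    have hu : u = u' := sub_eq_zero.mp z
    subst hu
    have hv : v = v' := by
      have : v * X ^ a = v' * X ^ a := add_left_cancel h
      exact mul_right_cancel₀ (pow_ne_zero _ X_ne_zero) this
    subst hv
    rfl
  · rw [Nat.card_prod, card_degreeLT, card_degreeLT, pow_add, mul_comm]

/-- The quadratic Gauss sum `∑_b ψ(u b² / D)` over residues `b` modulo `D`. -/
def squareSum (ψ : AddChar F ℂ) (D u : F[X]) : ℂ :=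
  ∑ b : degreeLT F D.natDegree, ψ (resid D (u * (b : F[X]) ^ 2))

/-- The Gauss sum `∑_h (h / D) ψ(g h / D)` over residues `h` modulo `D`. -/
def symbolSum (ψ : AddChar F ℂ) (D g : F[X]) : ℂ :=
  ∑ h : degreeLT F D.natDegree, (residueSymbol (h : F[X]) D : ℂ) * ψ (resid D (g * h))

/-- Both Gauss sums modulo `D` are the values of the residue symbol, up to the same constant. -/
def GaussRelation (ψ : AddChar F ℂ) (D : F[X]) : Prop :=
  (∀ u, IsCoprime u D → squareSum ψ D u = residueSymbol u D * squareSum ψ D 1) ∧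
    ∀ g, symbolSum ψ D g = residueSymbol g D * squareSum ψ D 1

theorem gaussRelation_one (ψ : AddChar F ℂ) : GaussRelation ψ 1 := by
  have h1 : ∀ φ : F[X] → ℂ, ∑ h : degreeLT F (1 : F[X]).natDegree, φ h = φ 0 := by
    intro φ
    have : Subsingleton (degreeLT F (1 : F[X]).natDegree) := by
      rw [natDegree_one, degreeLT]
      constructor
      rintro ⟨a, ha⟩ ⟨b, hb⟩
      have := mem_degreeLT.mp ha
      have := mem_degreeLT.mp hb
      simp_all
    rw [Fintype.sum_subsingleton _ (0 : degreeLT F (1 : F[X]).natDegree)]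
    simp
  constructor
  · intro u _
    rw [squareSum, squareSum, h1 (fun b => ψ (resid 1 (u * b ^ 2))),
      h1 (fun b => ψ (resid 1 (1 * b ^ 2)))]
    simp [residueSymbol_one_right]
  · intro g
    rw [symbolSum, squareSum, h1 (fun h => (residueSymbol h 1 : ℂ) * ψ (resid 1 (g * h))),
      h1 (fun b => ψ (resid 1 (1 * b ^ 2)))]
    simp [residueSymbol_one_right]

/-- Under the Chinese remainder theorem both sums factor, each factor being twisted by the other
modulus. The twists contribute (D₂/D₁)(D₁/D₂), which is 1 by reciprocity. The relation for square
sums is carried along because it evaluates the constant `squareSum ψ (D₁ * D₂) 1`. -/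
theorem GaussRelation.mul (hq : Nat.card F % 4 = 1) {ψ : AddChar F ℂ} {D₁ D₂ : F[X]}
    (h₁ : D₁.Monic) (h₂ : D₂.Monic) (hc : IsCoprime D₁ D₂)
    (r₁ : GaussRelation ψ D₁) (r₂ : GaussRelation ψ D₂) : GaussRelation ψ (D₁ * D₂) := by
  have hs : ∀ u, squareSum ψ (D₁ * D₂) u =
      squareSum ψ D₁ (u * D₂) * squareSum ψ D₂ (u * D₁) := by
    intro u
    rw [squareSum, sum_degreeLT_mul h₁ h₂ hc (fun b => ψ (resid (D₁ * D₂) (u * b ^ 2))),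
      squareSum, squareSum, Finset.sum_mul_sum]
    refine Finset.sum_congr rfl fun x _ => Finset.sum_congr rfl fun y _ => ?_
    rw [← AddChar.map_add_eq_mul, ← resid_mul_right h₁ h₂, ← resid_mul_right h₂ h₁,
      mul_comm D₂ D₁, ← map_add]
    congr 1
    refine resid_congr (h₁.mul h₂) ⟨2 * u * x * y, ?_⟩
    ring
  have ht : ∀ g, symbolSum ψ (D₁ * D₂) g = residueSymbol D₂ D₁ * residueSymbol D₁ D₂ *
      (symbolSum ψ D₁ g * symbolSum ψ D₂ g) := by
    intro g
    rw [symbolSum, sum_degreeLT_mul h₁ h₂ hc (fun h => (residueSymbol h (D₁ * D₂) : ℂ) *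
      ψ (resid (D₁ * D₂) (g * h))), symbolSum, symbolSum, Finset.sum_mul_sum, Finset.mul_sum]
    refine Finset.sum_congr rfl fun x _ => ?_
    rw [Finset.mul_sum]
    refine Finset.sum_congr rfl fun y _ => ?_
    have e1 : ψ (resid (D₁ * D₂) (g * (x * D₂ + y * D₁))) =
        ψ (resid D₁ (g * x)) * ψ (resid D₂ (g * y)) := by
      rw [← AddChar.map_add_eq_mul, ← resid_mul_right h₁ h₂, ← resid_mul_right h₂ h₁,
        mul_comm D₂ D₁, ← map_add]
      congr 2
      ring
    have e2 : residueSymbol (x * D₂ + y * D₁ : F[X]) D₁ =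
        residueSymbol (x : F[X]) D₁ * residueSymbol D₂ D₁ := by
      rw [← residueSymbol_mul_left hq _ _ h₁]
      exact residueSymbol_congr ⟨y, by ring⟩
    have e3 : residueSymbol (x * D₂ + y * D₁ : F[X]) D₂ =
        residueSymbol (y : F[X]) D₂ * residueSymbol D₁ D₂ := by
      rw [← residueSymbol_mul_left hq _ _ h₂]
      exact residueSymbol_congr ⟨x, by ring⟩
    rw [e1, residueSymbol_mul_right_monic _ h₁ h₂, e2, e3]
    push_cast
    ring
  have hrec : (residueSymbol D₂ D₁ * residueSymbol D₁ D₂ : ℂ) = 1 := by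
    rw [residueSymbol_comm hq h₂ h₁, ← sq]
    exact_mod_cast residueSymbol_sq hq h₂ hc
  have hone : squareSum ψ (D₁ * D₂) 1 = squareSum ψ D₁ 1 * squareSum ψ D₂ 1 := by
    rw [hs, one_mul, one_mul, r₁.1 _ hc.symm, r₂.1 _ hc]
    linear_combination squareSum ψ D₁ 1 * squareSum ψ D₂ 1 * hrec
  constructor
  · intro u hu
    have hu₁ : IsCoprime u D₁ := hu.of_mul_right_left
    have hu₂ : IsCoprime u D₂ := hu.of_mul_right_right
    rw [hs, r₁.1 _ (hu₁.mul_left hc.symm), r₂.1 _ (hu₂.mul_left hc), hone,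
      residueSymbol_mul_left hq _ _ h₁, residueSymbol_mul_left hq _ _ h₂,
      residueSymbol_mul_right_monic _ h₁ h₂]
    push_cast
    linear_combination residueSymbol u D₁ * residueSymbol u D₂ *
      squareSum ψ D₁ 1 * squareSum ψ D₂ 1 * hrec
  · intro g
    rw [ht, hrec, r₁.2, r₂.2, hone, residueSymbol_mul_right_monic _ h₁ h₂]
    push_cast
    ring

/-- An element y has 1 + χ(y) square roots and ∑ ψ(u y) = 0, so for u ≠ 0 the sum over squares is
the twisted sum ∑ χ(y) ψ(u y); scaling y pulls out χ(u). At g = 0 both sides vanish because ∑ χ = 0.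
-/
theorem gaussRelation_field {K : Type*} [Field K] [Fintype K] [DecidableEq K]
    (hK : ringChar K ≠ 2) {ψ : AddChar K ℂ} (hψ : ψ ≠ 1) :
    (∀ u, u ≠ 0 → ∑ x : K, ψ (u * x ^ 2) = quadraticChar K u * ∑ x : K, ψ (x ^ 2)) ∧
    ∀ g, ∑ x : K, (quadraticChar K x : ℂ) * ψ (g * x) =
      quadraticChar K g * ∑ x : K, ψ (x ^ 2) := by
  have hA : ∀ u : K, u ≠ 0 → ∑ x : K, ψ (u * x ^ 2) =
      ∑ x : K, (quadraticChar K x : ℂ) * ψ (u * x) := by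
    intro u hu
    have h0 : ∑ x : K, ψ (u * x) = 0 := by
      rw [Fintype.sum_equiv (Equiv.mulLeft₀ u hu) (fun x => ψ (u * x)) (fun x => ψ x)
        (fun x => rfl)]
      exact AddChar.sum_eq_zero_of_ne_one hψ
    have h1 : ∑ x : K, ψ (u * x ^ 2) =
        ∑ y : K, ∑ x ∈ Finset.univ.filter (fun x : K => x ^ 2 = y), ψ (u * y) := by
      rw [← Finset.sum_fiberwise_of_maps_to (s := Finset.univ) (t := Finset.univ)
        (g := fun x : K => x ^ 2) (fun _ _ => Finset.mem_univ _)]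
      refine Finset.sum_congr rfl fun y _ => Finset.sum_congr rfl fun x hx => ?_
      rw [(Finset.mem_filter.mp hx).2]
    rw [h1, ← add_zero (∑ x : K, (quadraticChar K x : ℂ) * ψ (u * x)), ← h0,
      ← Finset.sum_add_distrib]
    refine Finset.sum_congr rfl fun y _ => ?_
    rw [Finset.sum_const, nsmul_eq_mul]
    have h2 := quadraticChar_card_sqrts hK y
    have h3 : {x : K | x ^ 2 = y}.toFinset = Finset.univ.filter (fun x : K => x ^ 2 = y) := by
      ext x
      simp
    rw [h3] at h2
    have h4 : ((Finset.univ.filter (fun x : K => x ^ 2 = y)).card : ℂ) =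
        (quadraticChar K y : ℂ) + 1 := by exact_mod_cast h2
    rw [h4]
    ring
  have hB : ∀ g : K, g ≠ 0 → ∑ x : K, (quadraticChar K x : ℂ) * ψ (g * x) =
      quadraticChar K g * ∑ x : K, (quadraticChar K x : ℂ) * ψ x := by
    intro g hg
    rw [Finset.mul_sum]
    refine Fintype.sum_equiv (Equiv.mulLeft₀ g hg) _ _ fun x => ?_
    change (quadraticChar K x : ℂ) * ψ (g * x) =
      quadraticChar K g * ((quadraticChar K (g * x) : ℂ) * ψ (g * x))
    rw [map_mul (quadraticChar K), Int.cast_mul]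
    have : (quadraticChar K g : ℂ) ^ 2 = 1 := by exact_mod_cast quadraticChar_sq_one hg
    linear_combination (-(quadraticChar K x : ℂ) * ψ (g * x)) * this
  have hC : ∑ x : K, ψ (x ^ 2) = ∑ x : K, (quadraticChar K x : ℂ) * ψ x := by
    have := hA 1 one_ne_zero
    simpa using this
  constructor
  · intro u hu
    rw [hA u hu, hB u hu, hC]
  · intro g
    by_cases hg : g = 0
    · subst hg
      rw [MulChar.map_zero, Int.cast_zero, zero_mul]
      simp only [zero_mul, AddChar.map_zero_eq_one, mul_one]
      exact_mod_cast quadraticChar_sum_zero hK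
    · rw [hB g hg, hC]

/-- The field case for F[t]/p with the character ψ ∘ `resid p`, which is nontrivial since `resid p`
takes the value c at c t^(deg p - 1). -/
theorem gaussRelation_prime (hq : Nat.card F % 4 = 1) {ψ : AddChar F ℂ} (hψ : ψ ≠ 1)
    {p : F[X]} (hp : p.Monic) (hirr : Irreducible p) : GaussRelation ψ p := by
  classical
  have : Fact (Irreducible p) := ⟨hirr⟩
  have := Fintype.ofFinite F
  let pb := AdjoinRoot.powerBasis hirr.ne_zero
  have : Module.Finite F (AdjoinRoot p) := pb.finite
  have : Finite (AdjoinRoot p) := Module.finite_of_finite F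
  let _ := Fintype.ofFinite (AdjoinRoot p)
  have hF := ringChar_ne_two hq
  have hK : ringChar (AdjoinRoot p) ≠ 2 := by rwa [← Algebra.ringChar_eq F (AdjoinRoot p)]
  let l : AdjoinRoot p →ₗ[F] F :=
    (lcoeff F (p.natDegree - 1)).comp (AdjoinRoot.modByMonicHom hp)
  have hl : ∀ g, l (AdjoinRoot.mk p g) = resid p g := by
    intro g
    simp [l, resid_apply, AdjoinRoot.modByMonicHom_mk]
  let Ψ : AddChar (AdjoinRoot p) ℂ := ψ.compAddMonoidHom l.toAddMonoidHom
  have hΨ : ∀ g, Ψ (AdjoinRoot.mk p g) = ψ (resid p g) := fun g => by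
    rw [← hl]
    rfl
  have hpos := hirr.natDegree_pos
  have hΨ1 : Ψ ≠ 1 := by
    intro h
    apply hψ
    ext c
    have h1 := hΨ (C c * X ^ (p.natDegree - 1))
    rw [h] at h1
    rw [AddChar.one_apply] at h1 ⊢
    rw [h1, resid_of_degree_lt hp]
    · simp
    · refine (degree_C_mul_X_pow_le _ _).trans_lt ?_
      rw [degree_eq_natDegree hp.ne_zero]
      exact_mod_cast Nat.sub_lt hpos one_pos
  have hsym : ∀ g, residueSymbol g p = quadraticChar (AdjoinRoot p) (AdjoinRoot.mk p g) := by
    intro g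
    rw [residueSymbol_prime g hp hirr, primeSymbol_eq_quadraticChar hF hp hirr,
      ← norm_mk_eq_resultant hp hirr, quadraticChar_norm F (AdjoinRoot p) hF]
  have hbij : Function.Bijective
      (fun h : degreeLT F p.natDegree => AdjoinRoot.mk p (h : F[X])) := by
    constructor
    · rintro ⟨a, ha⟩ ⟨b, hb⟩ h
      rw [AdjoinRoot.mk_eq_mk] at h
      rw [mem_degreeLT] at ha hb
      have z : a - b = 0 := by
        refine eq_zero_of_dvd_of_degree_lt h ?_
        rw [degree_eq_natDegree hp.ne_zero]
        exact (degree_sub_le _ _).trans_lt (max_lt ha hb)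
      simpa using sub_eq_zero.mp z
    · intro y
      obtain ⟨g, rfl⟩ := AdjoinRoot.mk_surjective y
      refine ⟨⟨g %ₘ p, mem_degreeLT.mpr (degree_modByMonic_lt_natDegree hp g)⟩, ?_⟩
      simp only [AdjoinRoot.mk_eq_mk]
      refine ⟨-(g /ₘ p), ?_⟩
      linear_combination modByMonic_add_div g p
  have hsq : ∀ u, squareSum ψ p u = ∑ x : AdjoinRoot p, Ψ (AdjoinRoot.mk p u * x ^ 2) := by
    intro u
    refine Fintype.sum_bijective _ hbij _ _ fun x => ?_
    rw [← map_pow, ← map_mul, hΨ]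
  have hsy : ∀ g, symbolSum ψ p g = ∑ x : AdjoinRoot p,
      (quadraticChar (AdjoinRoot p) x : ℂ) * Ψ (AdjoinRoot.mk p g * x) := by
    intro u
    refine Fintype.sum_bijective _ hbij _ _ fun x => ?_
    rw [← map_mul, hΨ, hsym]
  obtain ⟨k1, k2⟩ := gaussRelation_field hK hΨ1
  constructor
  · intro u hu
    rw [hsq, hsq, hsym, k1, map_one]
    · simp
    · rw [Ne, AdjoinRoot.mk_eq_zero]
      intro h
      exact hirr.not_isUnit (hu.isUnit_of_dvd' h dvd_rfl)
  · intro g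
    rw [hsy, hsq, hsym, k2, map_one]
    simp

theorem gaussRelation_of_squarefree (hq : Nat.card F % 4 = 1) {ψ : AddChar F ℂ} (hψ : ψ ≠ 1) :
    ∀ D : F[X], D.Monic → Squarefree D → GaussRelation ψ D := by
  refine monic_induction (fun _ => gaussRelation_one ψ) ?_
  intro p g hp hirr hg ih hs
  have hc : IsCoprime p g := by
    rw [hirr.coprime_iff_not_dvd]
    intro h
    exact hirr.not_isUnit (hs p (mul_dvd_mul_left p h))
  exact (gaussRelation_prime hq hψ hp hirr).mul hq hp hg hc (ih hs.of_mul_right)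

end Gauss

end

end AffineMDS

open scoped Polynomial

namespace AffineMDS

noncomputable section

/-! ### Palindromic polynomials and the functional equation of quadratic `L`-functions -/

section Palindromic

open Polynomial

/-- `P` has degree at most `2 m` and satisfies `P(x) = (q^{1/2} x)^{2 m} P(1 / (q x))`. -/
def IsPal (q : ℂ) (m : ℕ) (P : ℂ[X]) : Prop :=
  P.natDegree ≤ 2 * m ∧ ∀ j k, j + k = 2 * m → q ^ k * P.coeff j = q ^ m * P.coeff k

/-- Turns the condition on coefficients into a polynomial identity, in which products are immediate.
-/
theorem isPal_iff_reflect {q : ℂ} (hq : q ≠ 0) {m : ℕ} {P : ℂ[X]} (hP : P.natDegree ≤ 2 * m) :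
    IsPal q m P ↔ reflect (2 * m) P = C (q ^ m) * P.comp (C q⁻¹ * X) := by
  constructor
  · rintro ⟨_, h⟩
    ext k
    rw [coeff_reflect, coeff_C_mul, comp_C_mul_X_coeff]
    by_cases hk : k ≤ 2 * m
    · rw [revAt_le hk, mul_comm (P.coeff k), ← mul_assoc, mul_right_comm,
        ← h (2 * m - k) k (by omega), inv_pow, mul_comm (q ^ k), mul_assoc,
        mul_inv_cancel₀ (pow_ne_zero _ hq), mul_one]
    · rw [revAt_eq_self_of_lt (by omega), coeff_eq_zero_of_natDegree_lt (by omega)]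
      simp
  · intro h
    refine ⟨hP, fun j k hjk => ?_⟩
    have h1 := congrArg (fun R => R.coeff k) h
    rw [coeff_reflect, coeff_C_mul, comp_C_mul_X_coeff, revAt_le (by omega),
      show 2 * m - k = j by omega] at h1
    rw [h1, inv_pow]
    field_simp

theorem IsPal.mul {q : ℂ} (hq : q ≠ 0) {m n : ℕ} {P Q : ℂ[X]} (hP : IsPal q m P)
    (hQ : IsPal q n Q) : IsPal q (m + n) (P * Q) := by
  have h : (P * Q).natDegree ≤ 2 * (m + n) := by
    refine natDegree_mul_le.trans ?_
    have := hP.1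
    have := hQ.1
    omega
  rw [isPal_iff_reflect hq h, mul_add, reflect_mul _ _ hP.1 hQ.1,
    (isPal_iff_reflect hq hP.1).mp hP, (isPal_iff_reflect hq hQ.1).mp hQ, mul_comp, pow_add,
    C_mul]
  ring

theorem isPal_one (q : ℂ) : IsPal q 0 1 := by
  refine ⟨by simp, fun j k h => ?_⟩
  obtain ⟨rfl, rfl⟩ : j = 0 ∧ k = 0 := by omega
  rfl

theorem IsPal.add {q : ℂ} {m : ℕ} {P Q : ℂ[X]} (hP : IsPal q m P) (hQ : IsPal q m Q) :
    IsPal q m (P + Q) := by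
  refine ⟨(natDegree_add_le _ _).trans (max_le hP.1 hQ.1), fun j k h => ?_⟩
  rw [coeff_add, coeff_add, mul_add, mul_add, hP.2 j k h, hQ.2 j k h]

theorem isPal_zero (q : ℂ) (m : ℕ) : IsPal q m 0 :=
  ⟨by simp, fun j k _ => by simp⟩

theorem IsPal.C_mul {q : ℂ} {m : ℕ} {P : ℂ[X]} (hP : IsPal q m P) (a : ℂ) :
    IsPal q m (C a * P) := by
  refine ⟨(natDegree_C_mul_le _ _).trans hP.1, fun j k h => ?_⟩
  rw [coeff_C_mul, coeff_C_mul]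
  linear_combination a * hP.2 j k h

theorem isPal_sum {ι : Type*} {q : ℂ} {m : ℕ} (s : Finset ι) {P : ι → ℂ[X]}
    (h : ∀ i ∈ s, IsPal q m (P i)) : IsPal q m (∑ i ∈ s, P i) := by
  classical
  induction s using Finset.induction_on with
  | empty => simpa using isPal_zero q m
  | insert a s ha ih =>
    rw [Finset.sum_insert ha]
    exact (h a (Finset.mem_insert_self _ _)).add
      (ih fun i hi => h i (Finset.mem_insert_of_mem hi))

theorem isPal_linear (q : ℂ) : IsPal q 1 ((1 - C q * X) * (1 - X)) := by
  have e : (1 - C q * X) * (1 - X) = C 1 + C (-(q + 1)) * X + C q * X ^ 2 := by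
    simp only [map_one, map_neg, map_add]
    ring
  have c : ∀ n, ((1 - C q * X) * (1 - X)).coeff n =
      if n = 0 then 1 else if n = 1 then -(q + 1) else if n = 2 then q else 0 := by
    intro n
    rw [e, coeff_add, coeff_add, coeff_C, coeff_C_mul_X, coeff_C_mul_X_pow]
    split_ifs <;> simp_all
  constructor
  · rw [natDegree_le_iff_coeff_eq_zero]
    intro n hn
    rw [c, if_neg (by omega), if_neg (by omega), if_neg (by omega)]
  · intro j k h
    have h3 : (j = 0 ∧ k = 2) ∨ (j = 1 ∧ k = 1) ∨ (j = 2 ∧ k = 0) := by omega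
    rcases h3 with ⟨rfl, rfl⟩ | ⟨rfl, rfl⟩ | ⟨rfl, rfl⟩ <;> simp [c, sq]

/-- Substituting `x ↦ ε x ^ d` in a palindromic polynomial, for a sign `ε`. -/
theorem IsPal.expand {q : ℂ} {m : ℕ} {P : ℂ[X]} {d : ℕ} (hd : 0 < d)
    (hP : IsPal (q ^ d) m P) {ε : ℂ} (hε : ε ^ 2 = 1) :
    IsPal q (d * m) (Polynomial.expand ℂ d (P.comp (C ε * X))) := by
  constructor
  · rw [natDegree_expand]
    have h1 : (P.comp (C ε * X)).natDegree ≤ 2 * m := by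
      refine natDegree_comp_le.trans ?_
      calc P.natDegree * (C ε * X).natDegree ≤ P.natDegree * 1 :=
            Nat.mul_le_mul_left _ ((natDegree_C_mul_le _ _).trans natDegree_X_le)
        _ ≤ 2 * m := by simpa using hP.1
    calc _ ≤ 2 * m * d := Nat.mul_le_mul_right _ h1
      _ = _ := by ring
  · intro j k h
    rw [coeff_expand hd, coeff_expand hd]
    by_cases hj : d ∣ j
    · have hk : d ∣ k := by
        rw [← Nat.dvd_add_right hj, h]
        exact ⟨2 * m, by ring⟩
      obtain ⟨a, rfl⟩ := hj
      obtain ⟨b, rfl⟩ := hk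
      rw [if_pos (dvd_mul_right _ _), if_pos (dvd_mul_right _ _), Nat.mul_div_cancel_left _ hd,
        Nat.mul_div_cancel_left _ hd, comp_C_mul_X_coeff, comp_C_mul_X_coeff, pow_mul, pow_mul]
      have hab : a + b = 2 * m := by
        have : d * (a + b) = d * (2 * m) := by
          rw [mul_add, h]
          ring
        exact Nat.eq_of_mul_eq_mul_left hd this
      have hs : ε ^ a = ε ^ b := by
        have h1 : ε ^ a * ε ^ b = 1 := by rw [← pow_add, hab, pow_mul, hε, one_pow]
        have h2 : ε ^ b * ε ^ b = 1 := by rw [← sq, ← pow_mul, mul_comm, pow_mul, hε, one_pow]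
        have h3 : ε ^ b ≠ 0 := by
          intro h0
          rw [h0] at h2
          simp at h2
        exact mul_right_cancel₀ h3 (h1.trans h2.symm)
      rw [hs]
      linear_combination ε ^ b * hP.2 a b hab
    · have hk : ¬ d ∣ k := by
        intro hk
        apply hj
        rw [← Nat.dvd_add_left hk, h]
        exact ⟨2 * m, by ring⟩
      rw [if_neg hj, if_neg hk]
      simp

end Palindromic

/-! ### The functional equation of quadratic L-functions over F[t] -/

section LFunction

open Polynomial

variable {F : Type*} [Field F]

theorem resid_mul_X_pow {D h : F[X]} (hD : D.Monic) (h0 : h ≠ 0) {j : ℕ}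
    (hj : h.natDegree + j + 1 = D.natDegree) : resid D (h * X ^ j) = h.leadingCoeff := by
  rw [resid_of_degree_lt hD]
  · rw [show D.natDegree - 1 = h.natDegree + j by omega, coeff_mul_X_pow, coeff_natDegree]
  · rw [degree_mul, degree_X_pow, degree_eq_natDegree h0, degree_eq_natDegree hD.ne_zero]
    norm_cast
    omega

theorem resid_eq_zero_of_natDegree {D g : F[X]} (hD : D.Monic)
    (hg : g.natDegree + 1 < D.natDegree) : resid D g = 0 := by
  rw [resid_of_degree_lt hD]
  · exact coeff_eq_zero_of_natDegree_lt (by omega)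
  · refine degree_le_natDegree.trans_lt ?_
    rw [degree_eq_natDegree hD.ne_zero]
    norm_cast
    omega

/-- The pairing `u ↦ h u / D` on polynomials of degree less than `k`. -/
def residPairing (D h : F[X]) (k : ℕ) : degreeLT F k →ₗ[F] F :=
  (resid D).comp ((LinearMap.mulLeft F h).comp (degreeLT F k).subtype)

theorem residPairing_apply (D h : F[X]) (k : ℕ) (u : degreeLT F k) :
    residPairing D h k u = resid D (h * (u : F[X])) := rfl

/-- If h has degree at least deg D - k, some power of t raises it to degree deg D - 1 and exposes
its leading coefficient; otherwise every product h u stays below degree deg D - 1. This duality k ↔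
deg D - k is the source of the functional equations. -/
theorem residPairing_eq_zero_iff {D h : F[X]} (hD : D.Monic) (hh : h.degree < D.natDegree)
    (k : ℕ) : residPairing D h k = 0 ↔ h ∈ degreeLT F (D.natDegree - k) := by
  by_cases h0 : h = 0
  · rw [h0]
    simp only [zero_mem, iff_true]
    ext u
    rw [residPairing_apply]
    simp
  rw [degree_eq_natDegree h0] at hh
  norm_cast at hh
  rw [mem_degreeLT, degree_eq_natDegree h0]
  norm_cast
  constructor
  · intro hl0
    by_contra hc
    have hj : (X : F[X]) ^ (D.natDegree - 1 - h.natDegree) ∈ degreeLT F k := by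
      rw [mem_degreeLT, degree_X_pow]
      norm_cast
      omega
    have h1 := residPairing_apply D h k ⟨_, hj⟩
    rw [hl0, LinearMap.zero_apply] at h1
    simp only at h1
    rw [resid_mul_X_pow hD h0 (by omega)] at h1
    exact h0 (leadingCoeff_eq_zero.mp h1.symm)
  · intro hc
    ext u
    rw [residPairing_apply, LinearMap.zero_apply]
    by_cases hu0 : (u : F[X]) = 0
    · simp [hu0]
    have hu := mem_degreeLT.mp u.2
    rw [degree_eq_natDegree hu0] at hu
    norm_cast at hu
    refine resid_eq_zero_of_natDegree hD ?_
    have := natDegree_mul_le (p := h) (q := (u : F[X]))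
    omega

variable [Finite F]

/-- The monic polynomials of degree `k`. -/
def monics (F : Type*) [Field F] [Finite F] (k : ℕ) : Finset F[X] :=
  open Classical in Finset.univ.image fun u : degreeLT F k => X ^ k + (u : F[X])

theorem mem_monics {k : ℕ} {g : F[X]} : g ∈ monics F k ↔ g.Monic ∧ g.natDegree = k := by
  simp only [monics, Finset.mem_image, Finset.mem_univ, true_and, Subtype.exists, exists_prop]
  constructor
  · rintro ⟨u, hu, rfl⟩
    rw [mem_degreeLT] at hu
    refine ⟨monic_X_pow_add hu, ?_⟩
    rw [natDegree_add_eq_left_of_degree_lt, natDegree_X_pow]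
    rwa [degree_X_pow]
  · rintro ⟨h1, rfl⟩
    refine ⟨g - X ^ g.natDegree, ?_, by ring⟩
    rw [mem_degreeLT, ← degree_eq_natDegree h1.ne_zero]
    refine degree_sub_lt_left ?_ h1.ne_zero ?_
    · rw [degree_X_pow, degree_eq_natDegree h1.ne_zero]
    · rw [h1.leadingCoeff, leadingCoeff_X_pow]

theorem sum_monics {A : Type*} [AddCommMonoid A] (k : ℕ) (φ : F[X] → A) :
    ∑ g ∈ monics F k, φ g = ∑ u : degreeLT F k, φ (X ^ k + (u : F[X])) := by
  classical
  rw [monics, Finset.sum_image]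
  intro u _ v _ h
  simpa using h

theorem monics_zero : monics F 0 = {1} := by
  ext g
  rw [mem_monics, Finset.mem_singleton]
  constructor
  · rintro ⟨h, h0⟩
    exact h.natDegree_eq_zero.mp h0
  · rintro rfl
    simp

theorem sum_degreeLT_zero {A : Type*} [AddCommMonoid A] (φ : F[X] → A) :
    ∑ h : degreeLT F 0, φ h = φ 0 := by
  have : Subsingleton (degreeLT F 0) := by
    constructor
    rintro ⟨a, ha⟩ ⟨b, hb⟩
    have := mem_degreeLT.mp ha
    have := mem_degreeLT.mp hb
    simp_all
  rw [Fintype.sum_subsingleton _ (0 : degreeLT F 0)]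
  simp

theorem sum_degreeLT_one [Fintype F] {A : Type*} [AddCommMonoid A] (φ : F[X] → A) :
    ∑ h : degreeLT F 1, φ h = ∑ c : F, φ (C c) := by
  symm
  refine Fintype.sum_bijective (fun c => (⟨C c, ?_⟩ : degreeLT F 1))
    (bijective_degreeLT_of_injective _ ?_ (by simp)) _ _ fun c => rfl
  · rw [mem_degreeLT]
    exact degree_C_le.trans_lt (by norm_num)
  · intro a b h
    simpa using h

theorem sum_degreeLT_restrict {A : Type*} [AddCommMonoid A] {m n : ℕ} (h : m ≤ n)
    (φ : F[X] → A) :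
    ∑ x : degreeLT F m, φ x = ∑ x : degreeLT F n,
      open Classical in if (x : F[X]) ∈ degreeLT F m then φ x else 0 := by
  classical
  refine Fintype.sum_of_injective
    (fun x : degreeLT F m => (⟨x, degreeLT_mono h x.2⟩ : degreeLT F n)) ?_ _ _ ?_ ?_
  · rintro ⟨a, ha⟩ ⟨b, hb⟩ hab
    rw [Subtype.mk.injEq] at hab ⊢
    exact hab
  · intro x hx
    rw [if_neg]
    intro hm
    exact hx ⟨⟨x, hm⟩, rfl⟩
  · rintro ⟨x, hx⟩
    simp [hx]

theorem sum_degreeLT_succ [Fintype F] [DecidableEq F] {A : Type*} [AddCommMonoid A] (n : ℕ)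
    (φ : F[X] → A) :
    ∑ h : degreeLT F (n + 1), φ h = ∑ h : degreeLT F n, φ h +
      ∑ c ∈ Finset.univ.erase (0 : F), ∑ g ∈ monics F n, φ (C c * g) := by
  rw [sum_degreeLT_add, sum_degreeLT_one (fun v => ∑ u : degreeLT F n, φ ((u : F[X]) + v * X ^ n)),
    ← Finset.add_sum_erase _ _ (Finset.mem_univ (0 : F))]
  congr 1
  · simp
  · refine Finset.sum_congr rfl fun c hc => ?_
    have hc0 : c ≠ 0 := (Finset.mem_erase.mp hc).1
    rw [sum_monics]
    symm
    refine Fintype.sum_equiv (LinearEquiv.smulOfNeZero F (degreeLT F n) c hc0).toEquiv _ _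
      fun u => ?_
    congr 1
    simp [smul_eq_C_mul]
    ring

/-- `∑ψ(c²)` over the finite field. -/
theorem squareSum_one {ψ : AddChar F ℂ} (hψ : ψ ≠ 1) (hq : Nat.card F % 4 = 1) {D : F[X]}
    (hD : D.Monic) (m : ℕ) :
    (D.natDegree = 2 * m → squareSum ψ D 1 = (Nat.card F : ℂ) ^ m) ∧
    (D.natDegree = 2 * m + 1 → squareSum ψ D 1 =
      (Nat.card F : ℂ) ^ m * ∑ v : degreeLT F 1, ψ ((v : F[X]).coeff 0 ^ 2)) := by
  classical
  have h2 : (2 : F) ≠ 0 := Ring.two_ne_zero (ringChar_ne_two hq)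
  -- Write the residue as u + v t^m with deg u < m. Then u² does not reach degree deg D - 1, so the
  -- exponent is affine in u. Orthogonality leaves only deg v < b - m, that is v = 0 when b = m and
  -- v constant when b = m + 1.
  have main : ∀ b, m + b = D.natDegree → m ≤ b → b ≤ m + 1 →
      squareSum ψ D 1 = (Nat.card F : ℂ) ^ m *
        ∑ v : degreeLT F (b - m), ψ (resid D ((v : F[X]) ^ 2 * X ^ (2 * m))) := by
    intro b hb hmb hbm
    rw [squareSum, ← hb, sum_degreeLT_add m b (fun h => ψ (resid D (1 * h ^ 2))),
      sum_degreeLT_restrict (show b - m ≤ b by omega)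
        (fun v => ψ (resid D (v ^ 2 * X ^ (2 * m)))), Finset.mul_sum]
    refine Finset.sum_congr rfl fun v _ => ?_
    let l : degreeLT F m →ₗ[F] F := (resid D).comp
      ((LinearMap.mulLeft F (2 * (v : F[X]) * X ^ m)).comp (degreeLT F m).subtype)
    have hl : ∀ u, l u = resid D (2 * (v : F[X]) * X ^ m * (u : F[X])) := fun u => rfl
    have e : ∀ u : degreeLT F m, ψ (resid D (1 * ((u : F[X]) + (v : F[X]) * X ^ m) ^ 2)) =
        ψ (l u) * ψ (resid D ((v : F[X]) ^ 2 * X ^ (2 * m))) := by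
      intro u
      rw [← AddChar.map_add_eq_mul]
      congr 1
      have hu : resid D ((u : F[X]) ^ 2) = 0 := by
        by_cases hu0 : (u : F[X]) = 0
        · simp [hu0]
        · have := mem_degreeLT.mp u.2
          rw [degree_eq_natDegree hu0] at this
          norm_cast at this
          refine resid_eq_zero_of_natDegree hD ?_
          rw [natDegree_pow]
          omega
      have : 1 * ((u : F[X]) + (v : F[X]) * X ^ m) ^ 2 = (u : F[X]) ^ 2 +
        2 * (v : F[X]) * X ^ m * (u : F[X]) + (v : F[X]) ^ 2 * X ^ (2 * m) := by ring
      rw [this, map_add, map_add, hu, zero_add, hl]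
    rw [Finset.sum_congr rfl fun u _ => e u, ← Finset.sum_mul, sum_addChar_linearMap hψ,
      card_degreeLT]
    have hiff : l = 0 ↔ (v : F[X]) ∈ degreeLT F (b - m) := by
      constructor
      · intro h0
        by_contra hv
        have hv0 : (v : F[X]) ≠ 0 := by
          intro h
          rw [h] at hv
          exact hv (zero_mem _)
        rw [mem_degreeLT, degree_eq_natDegree hv0] at hv
        have hvb := mem_degreeLT.mp v.2
        rw [degree_eq_natDegree hv0] at hvb
        norm_cast at hv hvb
        have h20 : (2 : F[X]) * v ≠ 0 := mul_ne_zero (by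
          rw [show (2 : F[X]) = C 2 from rfl]
          exact C_ne_zero.mpr h2) hv0
        have hnd : (2 * (v : F[X])).natDegree = (v : F[X]).natDegree := by
          rw [show (2 : F[X]) = C 2 from rfl, natDegree_C_mul h2]
        have hj : (X : F[X]) ^ (b - 1 - (v : F[X]).natDegree) ∈ degreeLT F m := by
          rw [mem_degreeLT, degree_X_pow]
          norm_cast
          omega
        have h1 := hl ⟨_, hj⟩
        rw [h0, LinearMap.zero_apply] at h1
        simp only at h1
        rw [mul_assoc, ← pow_add, resid_mul_X_pow hD h20 (by rw [hnd]; omega)] at h1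
        exact h20 (leadingCoeff_eq_zero.mp h1.symm)
      · intro hv
        ext u
        rw [hl, LinearMap.zero_apply]
        by_cases hv0 : (v : F[X]) = 0
        · simp [hv0]
        by_cases hu0 : (u : F[X]) = 0
        · simp [hu0]
        have h3 := mem_degreeLT.mp u.2
        rw [degree_eq_natDegree hu0] at h3
        rw [mem_degreeLT, degree_eq_natDegree hv0] at hv
        norm_cast at h3 hv
        refine resid_eq_zero_of_natDegree hD ?_
        refine lt_of_le_of_lt (Nat.add_le_add_right (natDegree_mul_le.trans
          (Nat.add_le_add_right (natDegree_mul_le.trans (Nat.add_le_add_right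
            (natDegree_mul_le) _)) _)) _) ?_
        rw [natDegree_X_pow, show (2 : F[X]) = C 2 from rfl, natDegree_C]
        omega
    simp only [hiff]
    split_ifs
    · push_cast
      ring
    · simp
  constructor
  · intro h
    rw [main m (by omega) le_rfl (by omega), Nat.sub_self,
      sum_degreeLT_zero (fun v => ψ (resid D (v ^ 2 * X ^ (2 * m))))]
    simp
  · intro h
    rw [main (m + 1) (by omega) (by omega) le_rfl, Nat.add_sub_cancel_left]
    congr 1
    refine Finset.sum_congr rfl fun v _ => ?_
    congr 1
    have hv := mem_degreeLT.mp v.2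
    have hv' : (v : F[X]) = C ((v : F[X]).coeff 0) := by
      refine eq_C_of_degree_le_zero ?_
      exact Order.le_of_lt_succ hv
    conv_lhs => rw [hv', ← C_pow]
    rw [resid_of_degree_lt hD]
    · rw [h, Nat.add_sub_cancel, coeff_C_mul, coeff_X_pow, if_pos rfl, mul_one]
    · refine (degree_C_mul_X_pow_le _ _).trans_lt ?_
      rw [degree_eq_natDegree hD.ne_zero, h]
      norm_cast
      omega

/-- Finite Poisson summation: expand (g/D) as a Gauss sum over h and put g = t^k + u. Summing over u
leaves only the h of degree less than deg D - k. -/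
theorem squareSum_mul_sum_monics (hq : Nat.card F % 4 = 1) {ψ : AddChar F ℂ} (hψ : ψ ≠ 1)
    {D : F[X]} (hD : D.Monic) (hs : Squarefree D) (k : ℕ) :
    squareSum ψ D 1 * ∑ g ∈ monics F k, (residueSymbol g D : ℂ) =
      (Nat.card F : ℂ) ^ k * ∑ h : degreeLT F (D.natDegree - k),
        (residueSymbol (h : F[X]) D : ℂ) * ψ (resid D ((h : F[X]) * X ^ k)) := by
  classical
  have hG := (gaussRelation_of_squarefree hq hψ D hD hs).2
  have hG' : ∀ g, squareSum ψ D 1 * (residueSymbol g D : ℂ) = symbolSum ψ D g := fun g => by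
    rw [hG, mul_comm]
  simp only [Finset.mul_sum, hG', symbolSum]
  rw [Finset.sum_comm, sum_degreeLT_restrict (show D.natDegree - k ≤ D.natDegree by omega)
    (fun h => (Nat.card F : ℂ) ^ k * ((residueSymbol h D : ℂ) * ψ (resid D (h * X ^ k))))]
  refine Finset.sum_congr rfl fun h _ => ?_
  have hl := residPairing_apply D (h : F[X]) k
  have hiff := residPairing_eq_zero_iff hD (mem_degreeLT.mp h.2) k
  have e : ∀ u : degreeLT F k, (residueSymbol (h : F[X]) D : ℂ) *
      ψ (resid D ((X ^ k + (u : F[X])) * (h : F[X]))) =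
      (residueSymbol (h : F[X]) D : ℂ) * ψ (resid D ((h : F[X]) * X ^ k)) * ψ (residPairing D (h : F[X]) k u) := by
    intro u
    rw [mul_assoc, ← AddChar.map_add_eq_mul, hl, ← map_add]
    congr 3
    ring
  rw [sum_monics k (fun g => (residueSymbol (h : F[X]) D : ℂ) * ψ (resid D (g * (h : F[X])))),
    Finset.sum_congr rfl fun u _ => e u, ← Finset.mul_sum, sum_addChar_linearMap hψ,
    card_degreeLT]
  simp only [hiff]
  split_ifs
  · push_cast
    ring
  · simp

theorem exists_addChar_ne_one (F : Type*) [Field F] [Finite F] : ∃ ψ : AddChar F ℂ, ψ ≠ 1 := by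
  obtain ⟨ψ, hψ⟩ := AddChar.exists_apply_ne_zero.mpr (one_ne_zero (α := F))
  exact ⟨ψ, fun h => hψ (by rw [h, AddChar.one_apply])⟩

theorem residueSymbol_C_mul_monic (hq : Nat.card F % 4 = 1) [Fintype F] [DecidableEq F] (c : F)
    (g : F[X]) {D : F[X]} (hD : D.Monic) :
    residueSymbol (C c * g) D = quadraticChar F c ^ D.natDegree * residueSymbol g D := by
  rw [residueSymbol_mul_left hq _ _ hD, residueSymbol_C hq c hD]

theorem residueSymbol_zero_left (hq : Nat.card F % 4 = 1) {D : F[X]} (hD : D.Monic)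
    (h1 : D ≠ 1) : residueSymbol 0 D = 0 := by
  refine residueSymbol_eq_zero hq hD fun h => ?_
  rw [isCoprime_zero_left] at h
  exact h1 (hD.eq_one_of_isUnit h)

/-- The quadratic `L`-series `∑_g (g / D) x ^ deg g`. -/
def symbolSeries (D : F[X]) : PowerSeries ℂ :=
  PowerSeries.mk fun k => ∑ g ∈ monics F k, (residueSymbol g D : ℂ)

theorem card_monics (k : ℕ) : (monics F k).card = Nat.card F ^ k := by
  have := sum_monics k (fun _ : F[X] => 1)
  simp only [Finset.sum_const, smul_eq_mul, mul_one, Finset.card_univ] at this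
  rw [this, ← Nat.card_eq_fintype_card, card_degreeLT]

theorem symbolSeries_one :
    (1 - PowerSeries.C (Nat.card F : ℂ) * PowerSeries.X) * symbolSeries (1 : F[X]) = 1 := by
  have h : symbolSeries (1 : F[X]) = PowerSeries.mk fun k => (Nat.card F : ℂ) ^ k := by
    ext k
    simp [symbolSeries, residueSymbol_one_right, card_monics]
  rw [h]
  ext k
  rw [sub_mul, one_mul, map_sub, mul_assoc, PowerSeries.coeff_C_mul]
  cases k with
  | zero => simp
  | succ k =>
    rw [PowerSeries.coeff_succ_X_mul]
    simp [PowerSeries.coeff_one, pow_succ']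

/-- In odd degree the symbol is nontrivial on constants, so it sums to zero over all polynomials of
bounded degree. In Poisson summation only the h of exact degree deg D - 1 - k remain. Their leading
coefficients produce the Gauss sum of F, which also occurs in `squareSum_one` and cancels. -/
theorem symbolSeries_odd (hq : Nat.card F % 4 = 1) {D : F[X]} (hD : D.Monic)
    (hs : Squarefree D) {m : ℕ} (hm : D.natDegree = 2 * m + 1) :
    ∃ P : ℂ[X], IsPal (Nat.card F) m P ∧ symbolSeries D = P := by
  classical
  have := Fintype.ofFinite F
  have hq0 : (Nat.card F : ℂ) ≠ 0 := by
    rw [Nat.cast_ne_zero]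
    omega
  have hD1 : D ≠ 1 := by
    rintro rfl
    simp at hm
  have h2 := ringChar_ne_two hq
  obtain ⟨ψ, hψ⟩ := exists_addChar_ne_one F
  have hmain := squareSum_mul_sum_monics hq hψ hD hs
  have hγ := (squareSum_one hψ hq hD m).2 hm
  have hτ : ∑ v : degreeLT F 1, ψ ((v : F[X]).coeff 0 ^ 2) =
      ∑ c : F, (quadraticChar F c : ℂ) * ψ c := by
    rw [sum_degreeLT_one (fun v => ψ (v.coeff 0 ^ 2))]
    simp only [coeff_C_zero]
    have := (gaussRelation_field h2 hψ).2 1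
    simpa using this.symm
  -- If the Gauss sum vanished, so would ∑ₓ χ(x) ψ(g x) for every g. Fourier inversion at x = 1
  -- would then give q = 0.
  have hτ0 : ∑ c : F, (quadraticChar F c : ℂ) * ψ c ≠ 0 := by
    intro h0
    have h3 := (gaussRelation_field h2 hψ).2
    have h4 : ∑ g : F, ∑ x : F, (quadraticChar F x : ℂ) * ψ (g * x) * ψ (-g) = 0 := by
      refine Finset.sum_eq_zero fun g _ => ?_
      rw [← Finset.sum_mul, h3 g]
      have : ∑ x : F, ψ (x ^ 2) = 0 := by
        have := h3 1
        simp only [one_mul, map_one, Int.cast_one] at this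
        rw [← this, h0]
      rw [this]
      simp
    rw [Finset.sum_comm] at h4
    have h5 : ∀ x : F, ∑ g : F, (quadraticChar F x : ℂ) * ψ (g * x) * ψ (-g) =
        if x = 1 then (Nat.card F : ℂ) else 0 := by
      intro x
      have h6 : ∀ g : F, (quadraticChar F x : ℂ) * ψ (g * x) * ψ (-g) =
          (quadraticChar F x : ℂ) * ψ (LinearMap.mulRight F (x - 1) g) := by
        intro g
        rw [mul_assoc, ← AddChar.map_add_eq_mul, LinearMap.mulRight_apply]
        congr 2
        ring
      rw [Finset.sum_congr rfl fun g _ => h6 g, ← Finset.mul_sum, sum_addChar_linearMap hψ]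
      have h7 : LinearMap.mulRight F (x - 1) = 0 ↔ x = 1 := by
        rw [LinearMap.mulRight_eq_zero_iff, sub_eq_zero]
      simp only [h7]
      split_ifs with hx
      · simp [hx]
      · simp
    simp only [h5, Finset.sum_ite_eq', Finset.mem_univ, if_true] at h4
    exact hq0 h4
  rw [hτ] at hγ
  have hpow : ∀ c : F, (quadraticChar F c) ^ D.natDegree = quadraticChar F c := by
    intro c
    rw [hm]
    by_cases hc : c = 0
    · simp [hc]
    · rw [pow_succ, pow_mul, quadraticChar_sq_one hc, one_pow, one_mul]
  have hz : ∀ k, D.natDegree ≤ k → ∑ g ∈ monics F k, (residueSymbol g D : ℂ) = 0 := by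
    intro k hk
    have h3 := hmain k
    rw [Nat.sub_eq_zero_of_le hk, sum_degreeLT_zero (fun h => (residueSymbol h D : ℂ) *
      ψ (resid D (h * X ^ k))), residueSymbol_zero_left hq hD hD1, hγ] at h3
    simp only [Int.cast_zero, zero_mul, mul_zero] at h3
    exact (mul_eq_zero.mp h3).resolve_left (mul_ne_zero (pow_ne_zero _ hq0) hτ0)
  have hlow : ∀ n, ∑ h : degreeLT F n, (residueSymbol (h : F[X]) D : ℂ) = 0 := by
    intro n
    induction n with
    | zero =>
      rw [sum_degreeLT_zero (fun h => (residueSymbol h D : ℂ)),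
        residueSymbol_zero_left hq hD hD1, Int.cast_zero]
    | succ n ih =>
      rw [sum_degreeLT_succ n (fun h => (residueSymbol h D : ℂ)), ih, zero_add]
      simp only [residueSymbol_C_mul_monic hq _ _ hD, hpow, Int.cast_mul, ← Finset.mul_sum,
        ← Finset.sum_mul]
      have : ∑ c ∈ Finset.univ.erase (0 : F), (quadraticChar F c : ℂ) = 0 := by
        rw [Finset.sum_erase _ (by simp)]
        exact_mod_cast quadraticChar_sum_zero h2
      rw [this, zero_mul]
  have hfe : ∀ j k, j + k = 2 * m → (Nat.card F : ℂ) ^ k *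
      ∑ g ∈ monics F j, (residueSymbol g D : ℂ) =
      (Nat.card F : ℂ) ^ m * ∑ g ∈ monics F k, (residueSymbol g D : ℂ) := by
    intro j k hjk
    have h3 := hmain k
    rw [show D.natDegree - k = j + 1 by omega, sum_degreeLT_succ j (fun h =>
      (residueSymbol h D : ℂ) * ψ (resid D (h * X ^ k)))] at h3
    have h4 : ∑ h : degreeLT F j, (residueSymbol (h : F[X]) D : ℂ) *
        ψ (resid D ((h : F[X]) * X ^ k)) = 0 := by
      rw [← hlow j]
      refine Finset.sum_congr rfl fun h _ => ?_
      have : resid D ((h : F[X]) * X ^ k) = 0 := by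
        by_cases h0 : (h : F[X]) = 0
        · simp [h0]
        have hh := mem_degreeLT.mp h.2
        rw [degree_eq_natDegree h0] at hh
        norm_cast at hh
        refine resid_eq_zero_of_natDegree hD ?_
        have := natDegree_mul_le (p := (h : F[X])) (q := X ^ k)
        rw [natDegree_X_pow] at this
        omega
      rw [this, AddChar.map_zero_eq_one, mul_one]
    have h5 : ∀ c ∈ Finset.univ.erase (0 : F), ∑ g ∈ monics F j,
        (residueSymbol (C c * g) D : ℂ) * ψ (resid D (C c * g * X ^ k)) =
        (quadraticChar F c : ℂ) * ψ c * ∑ g ∈ monics F j, (residueSymbol g D : ℂ) := by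
      intro c hc
      have hc0 : c ≠ 0 := (Finset.mem_erase.mp hc).1
      rw [Finset.mul_sum]
      refine Finset.sum_congr rfl fun g hg => ?_
      obtain ⟨hg1, hg2⟩ := mem_monics.mp hg
      rw [residueSymbol_C_mul_monic hq _ _ hD, hpow, resid_mul_X_pow hD
        (mul_ne_zero (C_ne_zero.mpr hc0) hg1.ne_zero) (by rw [natDegree_C_mul hc0]; omega),
        leadingCoeff_mul, leadingCoeff_C, hg1.leadingCoeff, mul_one]
      push_cast
      ring
    rw [h4, zero_add, Finset.sum_congr rfl h5, ← Finset.sum_mul,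
      Finset.sum_erase _ (by simp), hγ] at h3
    refine mul_left_cancel₀ hτ0 ?_
    linear_combination -h3
  refine ⟨∑ k ∈ Finset.range (2 * m + 1), Polynomial.monomial k
    (∑ g ∈ monics F k, (residueSymbol g D : ℂ)), ?_, ?_⟩
  · have hc : ∀ n, (∑ k ∈ Finset.range (2 * m + 1), Polynomial.monomial k
        (∑ g ∈ monics F k, (residueSymbol g D : ℂ))).coeff n =
        ∑ g ∈ monics F n, (residueSymbol g D : ℂ) := by
      intro n
      simp only [finsetSum_coeff, coeff_monomial, Finset.sum_ite_eq', Finset.mem_range]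
      split_ifs with h
      · rfl
      · exact (hz n (by omega)).symm
    constructor
    · rw [natDegree_le_iff_coeff_eq_zero]
      intro n hn
      rw [hc, hz n (by omega)]
    · intro j k hjk
      rw [hc, hc, hfe j k hjk]
  · ext n
    rw [Polynomial.coeff_coe, symbolSeries, PowerSeries.coeff_mk]
    simp only [finsetSum_coeff, coeff_monomial, Finset.sum_ite_eq', Finset.mem_range]
    split_ifs with h
    · rfl
    · exact hz n (by omega)

/-- In even degree the symbol is trivial on nonzero constants. Poisson summation relates the sums
Λ(n) over all polynomials of degree less than n, and Λ(n + 1) - Λ(n) is q - 1 times the n-th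
coefficient of the L-series. Hence the factor 1 - x, with cofactor ∑ Λ(k + 1) x^k / (q - 1). -/
theorem symbolSeries_even (hq : Nat.card F % 4 = 1) {D : F[X]} (hD : D.Monic)
    (hs : Squarefree D) {m : ℕ} (hm : D.natDegree = 2 * m + 2) :
    ∃ P : ℂ[X], IsPal (Nat.card F) m P ∧ symbolSeries D = ((1 - X : ℂ[X]) * P : ℂ[X]) := by
  classical
  have := Fintype.ofFinite F
  have hq0 : (Nat.card F : ℂ) ≠ 0 := by
    rw [Nat.cast_ne_zero]
    omega
  have hq1 : (Nat.card F : ℂ) - 1 ≠ 0 := by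
    rw [sub_ne_zero]
    have : 1 < Nat.card F := Finite.one_lt_card
    exact_mod_cast this.ne'
  have hD1 : D ≠ 1 := by
    rintro rfl
    simp at hm
  obtain ⟨ψ, hψ⟩ := exists_addChar_ne_one F
  have hG := (gaussRelation_of_squarefree hq hψ D hD hs).2
  have hγ := (squareSum_one hψ hq hD (m + 1)).1 (by omega)
  have hpow : ∀ c : F, c ≠ 0 → (quadraticChar F c) ^ D.natDegree = 1 := by
    intro c hc
    rw [hm, show 2 * m + 2 = 2 * (m + 1) by ring, pow_mul, quadraticChar_sq_one hc, one_pow]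
  let Λ : ℕ → ℂ := fun n => ∑ h : degreeLT F n, (residueSymbol (h : F[X]) D : ℂ)
  have hΛ0 : Λ 0 = 0 := by
    simp only [Λ]
    rw [sum_degreeLT_zero (fun h => (residueSymbol h D : ℂ)),
        residueSymbol_zero_left hq hD hD1, Int.cast_zero]
  have hΛs : ∀ n, Λ (n + 1) = Λ n + ((Nat.card F : ℂ) - 1) *
      ∑ g ∈ monics F n, (residueSymbol g D : ℂ) := by
    intro n
    simp only [Λ]
    rw [sum_degreeLT_succ n (fun h => (residueSymbol h D : ℂ))]
    congr 1
    have : ∀ c ∈ Finset.univ.erase (0 : F), ∑ g ∈ monics F n,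
        (residueSymbol (C c * g) D : ℂ) = ∑ g ∈ monics F n, (residueSymbol g D : ℂ) := by
      intro c hc
      refine Finset.sum_congr rfl fun g _ => ?_
      rw [residueSymbol_C_mul_monic hq _ _ hD, hpow c (Finset.mem_erase.mp hc).1, one_mul]
    rw [Finset.sum_congr rfl this, Finset.sum_const, Finset.card_erase_of_mem
      (Finset.mem_univ _), Finset.card_univ, nsmul_eq_mul, ← Nat.card_eq_fintype_card,
      Nat.cast_sub Finite.card_pos, Nat.cast_one]
  have hfeΛ : ∀ j k, j + k = 2 * m + 2 → (Nat.card F : ℂ) ^ (m + 1) * Λ k =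
      (Nat.card F : ℂ) ^ k * Λ j := by
    intro j k hjk
    have hk : k ≤ D.natDegree := by omega
    simp only [Λ]
    have hG' : ∀ g, squareSum ψ D 1 * (residueSymbol g D : ℂ) = symbolSum ψ D g := fun g => by
      rw [hG, mul_comm]
    rw [← hγ]
    simp only [Finset.mul_sum, hG', symbolSum]
    rw [Finset.sum_comm, sum_degreeLT_restrict (show j ≤ D.natDegree by omega)
      (fun h => (Nat.card F : ℂ) ^ k * (residueSymbol h D : ℂ))]
    refine Finset.sum_congr rfl fun h _ => ?_
    have hl : ∀ u : degreeLT F k, ψ (resid D ((u : F[X]) * (h : F[X]))) =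
        ψ (residPairing D (h : F[X]) k u) := fun u => by
      rw [residPairing_apply, mul_comm]
    simp only [hl]
    rw [← Finset.mul_sum, sum_addChar_linearMap hψ, card_degreeLT]
    have hiff := residPairing_eq_zero_iff hD (mem_degreeLT.mp h.2) k
    rw [show D.natDegree - k = j by omega] at hiff
    simp only [hiff]
    split_ifs
    · push_cast
      ring
    · simp
  have hz : ∀ k, D.natDegree ≤ k → ∑ g ∈ monics F k, (residueSymbol g D : ℂ) = 0 := by
    intro k hk
    have h3 := squareSum_mul_sum_monics hq hψ hD hs k
    rw [Nat.sub_eq_zero_of_le hk, sum_degreeLT_zero (fun h => (residueSymbol h D : ℂ) *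
      ψ (resid D (h * X ^ k))), residueSymbol_zero_left hq hD hD1, hγ] at h3
    simp only [Int.cast_zero, zero_mul, mul_zero] at h3
    exact (mul_eq_zero.mp h3).resolve_left (pow_ne_zero _ hq0)
  have hΛd : Λ (2 * m + 2) = 0 := by
    have := hfeΛ 0 (2 * m + 2) (by omega)
    rw [hΛ0, mul_zero] at this
    exact (mul_eq_zero.mp this).resolve_left (pow_ne_zero _ hq0)
  have hc : ∀ n, (∑ k ∈ Finset.range (2 * m + 1), Polynomial.monomial k
        (((Nat.card F : ℂ) - 1)⁻¹ * Λ (k + 1))).coeff n =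
        if n < 2 * m + 1 then ((Nat.card F : ℂ) - 1)⁻¹ * Λ (n + 1) else 0 := by
    intro n
    simp only [finsetSum_coeff, coeff_monomial, Finset.sum_ite_eq', Finset.mem_range]
  refine ⟨∑ k ∈ Finset.range (2 * m + 1), Polynomial.monomial k
    (((Nat.card F : ℂ) - 1)⁻¹ * Λ (k + 1)), ⟨?_, ?_⟩, ?_⟩
  · rw [natDegree_le_iff_coeff_eq_zero]
    intro n hn
    rw [hc, if_neg (by omega)]
  · intro j k hjk
    rw [hc, hc, if_pos (by omega), if_pos (by omega)]
    have h3 := hfeΛ (j + 1) (k + 1) (by omega)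
    refine mul_left_cancel₀ hq0 ?_
    linear_combination -((Nat.card F : ℂ) - 1)⁻¹ * h3
  · ext n
    rw [Polynomial.coeff_coe, symbolSeries, PowerSeries.coeff_mk, sub_mul, one_mul, coeff_sub, hc]
    have h3 := hΛs n
    cases n with
    | zero =>
      rw [coeff_X_mul_zero, sub_zero, if_pos (by omega), h3, hΛ0, zero_add,
        inv_mul_cancel_left₀ hq1]
    | succ n =>
      rw [coeff_X_mul, hc]
      by_cases h1 : n + 1 < 2 * m + 1
      · rw [if_pos h1, if_pos (by omega), h3]
        field_simp
        ring
      · rw [if_neg h1]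
        by_cases h2 : n < 2 * m + 1
        · obtain rfl : n = 2 * m := by omega
          rw [if_pos h2]
          rw [hΛd] at h3
          field_simp
          linear_combination -h3
        · rw [if_neg h2, hz _ (by omega), sub_zero]

end LFunction

end

end AffineMDS

open scoped Polynomial

namespace AffineMDS

noncomputable section

/-! ### Splitting off a prime from a series over tuples of monic polynomials -/

section Peel

open Polynomial

theorem finiteMultiplicity_of_irreducible {F : Type*} [Field F] {p g : F[X]}
    (hirr : Irreducible p) (hg : g ≠ 0) : FiniteMultiplicity p g :=
  FiniteMultiplicity.of_not_isUnit hirr.not_isUnit hg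

theorem exists_monic_eq_pow_mul {F : Type*} [Field F] {p g : F[X]} (hp : p.Monic)
    (hirr : Irreducible p) (hg : g.Monic) :
    ∃ g' : F[X], g'.Monic ∧ g = p ^ multiplicity p g * g' ∧ ¬ p ∣ g' := by
  obtain ⟨g', h1, h2⟩ :=
    (finiteMultiplicity_of_irreducible hirr hg.ne_zero).exists_eq_pow_mul_and_not_dvd
  refine ⟨g', ?_, h1, h2⟩
  rw [h1] at hg
  exact (hp.pow _).of_mul_monic_left hg

theorem multiplicity_pow_mul {F : Type*} [Field F] {p g' : F[X]} (hirr : Irreducible p)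
    (h : ¬ p ∣ g') (a : ℕ) : multiplicity p (p ^ a * g') = a := by
  refine multiplicity_eq_of_dvd_of_not_dvd (dvd_mul_right _ _) ?_
  rw [pow_succ]
  intro h'
  exact h ((mul_dvd_mul_iff_left (pow_ne_zero _ hirr.ne_zero)).mp h')

theorem multiplicity_mul_natDegree_le {F : Type*} [Field F] {p g : F[X]} (hp : p.Monic)
    (hirr : Irreducible p) (hg : g.Monic) : p.natDegree * multiplicity p g ≤ g.natDegree := by
  obtain ⟨g', h1, h2, h3⟩ := exists_monic_eq_pow_mul hp hirr hg
  conv_rhs => rw [h2]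
  rw [(hp.pow _).natDegree_mul h1, hp.natDegree_pow]
  rw [mul_comm]
  omega

variable {σ : Type*} [Finite σ] {F : Type*} [Field F] [Finite F]

/-- The tuples of monic polynomials of given degrees, as a finite set. -/
def tuples (F : Type*) [Field F] [Finite F] (a : σ →₀ ℕ) : Finset (σ → F[X]) :=
  (finite_monicTuples F a).toFinset

theorem mem_tuples {a : σ →₀ ℕ} {f : σ → F[X]} :
    f ∈ tuples F a ↔ ∀ i, (f i).Monic ∧ (f i).natDegree = a i := by
  simp [tuples, monicTuples]

theorem coeff_degreeSeries (w : (σ → F[X]) → ℂ) (a : σ →₀ ℕ) :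
    MvPowerSeries.coeff a (degreeSeries F w) = ∑ f ∈ tuples F a, w f :=
  finsum_mem_eq_finite_toFinset_sum _ _

/-- The series `∑_a α(a) x ^ (d a)`. -/
def dilate (d : ℕ) (α : (σ →₀ ℕ) → ℂ) : MvPowerSeries σ ℂ :=
  fun m => open Classical in
    if ∀ i, d ∣ m i then α (m.mapRange (· / d) (Nat.zero_div _)) else 0

/-- Tuples are sorted by their vector of multiplicities at p; each one is uniquely p^a times a tuple
prime to p in every position. -/
theorem degreeSeries_eq_dilate_mul {p : F[X]} (hp : p.Monic) (hirr : Irreducible p)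
    {φ φ' : (σ → F[X]) → ℂ} {α : (σ →₀ ℕ) → ℂ}
    (h : ∀ (a : σ →₀ ℕ) (f : σ → F[X]), (∀ i, (f i).Monic) → (∀ i, ¬ p ∣ f i) →
      φ (fun i => p ^ a i * f i) = α a * φ' f) :
    degreeSeries F φ = dilate p.natDegree α *
      degreeSeries F (fun f => open Classical in if ∀ i, ¬ p ∣ f i then φ' f else 0) := by
  classical
  have hd := hirr.natDegree_pos
  ext m
  rw [coeff_degreeSeries, MvPowerSeries.coeff_mul]
  let v : (σ → F[X]) → σ →₀ ℕ := fun f =>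
    Finsupp.equivFunOnFinite.symm fun i => p.natDegree * multiplicity p (f i)
  have hv : ∀ f i, v f i = p.natDegree * multiplicity p (f i) := fun f i => rfl
  rw [← Finset.sum_fiberwise_of_maps_to (t := Finset.HasAntidiagonal.antidiagonal m)
    (g := fun f => (v f, m - v f))]
  swap
  · intro f hf
    rw [Finset.HasAntidiagonal.mem_antidiagonal]
    refine add_tsub_cancel_of_le fun i => ?_
    rw [mem_tuples] at hf
    rw [hv, ← (hf i).2]
    exact multiplicity_mul_natDegree_le hp hirr (hf i).1
  refine Finset.sum_congr rfl fun bc hbc => ?_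
  obtain ⟨b, c⟩ := bc
  rw [Finset.HasAntidiagonal.mem_antidiagonal] at hbc
  simp only at hbc
  rw [coeff_degreeSeries, MvPowerSeries.coeff_apply, dilate]
  split_ifs with hdiv
  · set a : σ →₀ ℕ := b.mapRange (· / p.natDegree) (Nat.zero_div _) with ha
    have hab : ∀ i, b i = p.natDegree * a i := fun i => by
      rw [ha, Finsupp.mapRange_apply, Nat.mul_div_cancel' (hdiv i)]
    rw [Finset.mul_sum]
    simp only [mul_ite, mul_zero]
    rw [← Finset.sum_filter]
    symm
    refine Finset.sum_bij (fun f _ => fun i => p ^ a i * f i) ?_ ?_ ?_ ?_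
    · intro f hf
      rw [Finset.mem_filter, mem_tuples] at hf
      obtain ⟨hf1, hf2⟩ := hf
      have hvb : v (fun i => p ^ a i * f i) = b := by
        ext i
        rw [hv, multiplicity_pow_mul hirr (hf2 i), hab]
      rw [Finset.mem_filter, mem_tuples]
      refine ⟨fun i => ⟨(hp.pow _).mul (hf1 i).1, ?_⟩, ?_⟩
      · rw [(hp.pow _).natDegree_mul (hf1 i).1, hp.natDegree_pow, (hf1 i).2, ← hbc,
          Finsupp.add_apply, hab, mul_comm]
      · rw [hvb, ← hbc, add_tsub_cancel_left]
    · intro f _ g _ hfg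
      funext i
      exact mul_left_cancel₀ (pow_ne_zero _ hp.ne_zero) (congrFun hfg i)
    · intro f hf
      rw [Finset.mem_filter, mem_tuples] at hf
      obtain ⟨hf1, hf2⟩ := hf
      choose f' h1 h2 h3 using fun i => exists_monic_eq_pow_mul hp hirr (hf1 i).1
      have hvb : v f = b := congrArg Prod.fst hf2
      have hm : ∀ i, multiplicity p (f i) = a i := by
        intro i
        have := hv f i
        rw [hvb, hab] at this
        exact (Nat.eq_of_mul_eq_mul_left hd this).symm
      refine ⟨f', ?_, ?_⟩
      · rw [Finset.mem_filter, mem_tuples]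
        refine ⟨fun i => ⟨h1 i, ?_⟩, h3⟩
        have h4 := (hf1 i).2
        rw [h2 i, (hp.pow _).natDegree_mul (h1 i), hp.natDegree_pow, ← hbc, Finsupp.add_apply,
          hab, hm, mul_comm] at h4
        omega
      · funext i
        rw [← hm i]
        exact (h2 i).symm
    · intro f hf
      rw [Finset.mem_filter, mem_tuples] at hf
      exact (h a f (fun i => (hf.1 i).1) hf.2).symm
  · rw [zero_mul]
    refine Finset.sum_eq_zero fun f hf => ?_
    exfalso
    apply hdiv
    intro i
    have hvb : v f = b := congrArg Prod.fst (Finset.mem_filter.mp hf).2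
    rw [← hvb, hv]
    exact dvd_mul_right _ _

/-- The one-variable series `∑_g φ(g) x ^ deg g` over monic polynomials `g`. -/
def monicSeries (φ : F[X] → ℂ) : PowerSeries ℂ :=
  PowerSeries.mk fun k => ∑ g ∈ monics F k, φ g

theorem monicSeries_eq_degreeSeries (φ : F[X] → ℂ) :
    monicSeries φ = degreeSeries F (fun f : Unit → F[X] => φ (f ())) := by
  refine MvPowerSeries.ext fun m => ?_
  rw [coeff_degreeSeries]
  have hm : m = Finsupp.single () (m ()) := by
    ext
    simp
  rw [show MvPowerSeries.coeff m (monicSeries φ) = PowerSeries.coeff (m ()) (monicSeries φ) by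
    conv_lhs => rw [hm]
    rfl]
  rw [monicSeries, PowerSeries.coeff_mk]
  refine Finset.sum_bij (fun g _ => fun _ => g) ?_ ?_ ?_ ?_
  · intro g hg
    rw [mem_tuples]
    intro i
    exact mem_monics.mp hg
  · intro g _ g' _ hgg
    exact congrFun hgg ()
  · intro f hf
    rw [mem_tuples] at hf
    exact ⟨f (), mem_monics.mpr (hf ()), funext fun _ => rfl⟩
  · intro g _
    rfl

theorem monicSeries_eq_mul {p : F[X]} (hp : p.Monic) (hirr : Irreducible p)
    {φ φ' : F[X] → ℂ} {α : ℕ → ℂ}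
    (h : ∀ (a : ℕ) (g : F[X]), g.Monic → ¬ p ∣ g → φ (p ^ a * g) = α a * φ' g) :
    monicSeries φ = PowerSeries.expand p.natDegree hirr.natDegree_pos.ne' (PowerSeries.mk α) *
      monicSeries (fun g => open Classical in if p ∣ g then 0 else φ' g) := by
  classical
  rw [monicSeries_eq_degreeSeries, degreeSeries_eq_dilate_mul (α := fun a => α (a ()))
    (φ' := fun f => φ' (f ())) hp hirr (fun a f hf hpf => h _ _ (hf ()) (hpf ())),
    monicSeries_eq_degreeSeries]
  congr 1
  · refine PowerSeries.ext fun n => ?_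
    rw [PowerSeries.coeff_expand]
    rw [PowerSeries.coeff, MvPowerSeries.coeff_apply, dilate, PowerSeries.coeff_mk]
    by_cases hn : p.natDegree ∣ n
    · rw [if_pos hn, if_pos (fun _ => by rwa [Finsupp.single_eq_same]), Finsupp.mapRange_apply,
        Finsupp.single_eq_same]
    · rw [if_neg hn, if_neg fun h => hn (by simpa using h ())]
  · congr 1
    funext f
    by_cases hf : p ∣ f ()
    · rw [if_pos hf, if_neg fun h => h () hf]
    · rw [if_neg hf, if_pos fun _ => hf]

end Peel

end

end AffineMDS

open scoped Polynomial

namespace AffineMDS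

noncomputable section

/-! ### Twisted multiplicative weights: the series in one variable -/

section Vertex

open Polynomial

variable {V : Type*} [Fintype V] [DecidableEq V] (Γ : SimpleGraph V) [DecidableRel Γ.Adj]
variable {F : Type*} [Field F]

/-- The product of the residue symbols `(fᵢ / gⱼ)` over ordered pairs of adjacent vertices. -/
def twist (f g : V → F[X]) : ℤ := ∏ i, ∏ j with Γ.Adj i j, residueSymbol (f i) (g j)

/-- Twisted multiplicativity and the initial conditions over a fixed field. -/
structure IsTwisted (h : (V → F[X]) → ℂ) : Prop where
  mul : ∀ f g : V → F[X], (∀ i, (f i).Monic) → (∀ i, (g i).Monic) →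
    IsCoprime (∏ i, f i) (∏ i, g i) →
      h (fun i => f i * g i) = h f * h g * twist Γ f g
  single : ∀ (i : V) (f : F[X]), f.Monic → h (Pi.mulSingle i f) = 1

/-- The product of the `uⱼ` over the neighbours `j` of `i`. -/
def nbrs (i : V) (u : V → F[X]) : F[X] := ∏ j with Γ.Adj i j, u j

theorem twist_update {i : V} {f g : V → F[X]} (hf : f i = 1) (hg : g i = 1) (x y : F[X]) :
    twist Γ (Function.update f i x) (Function.update g i y) =
      twist Γ f g * (∏ j with Γ.Adj i j, residueSymbol x (g j)) *
        ∏ j with Γ.Adj i j, residueSymbol (f j) y := by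
  have key : ∀ j l, Γ.Adj j l →
      residueSymbol (Function.update f i x j) (Function.update g i y l) =
      residueSymbol (f j) (g l) * (if j = i then residueSymbol x (g l) else 1) *
        (if l = i then residueSymbol (f j) y else 1) := by
    intro j l hjl
    by_cases h1 : j = i
    · subst h1
      have h2 : l ≠ j := hjl.ne'
      simp [h2, hf, residueSymbol_one_left]
    · by_cases h2 : l = i
      · subst h2
        simp [h1, hg, residueSymbol_one_right]
      · simp [h1, h2]
  have e : ∀ j, ∏ l with Γ.Adj j l,
      residueSymbol (Function.update f i x j) (Function.update g i y l) =
      (∏ l with Γ.Adj j l, residueSymbol (f j) (g l)) *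
      (if j = i then ∏ l with Γ.Adj i l, residueSymbol x (g l) else 1) *
      (if Γ.Adj i j then residueSymbol (f j) y else 1) := by
    intro j
    rw [Finset.prod_congr rfl fun l hl => key j l (Finset.mem_filter.mp hl).2,
      Finset.prod_mul_distrib, Finset.prod_mul_distrib]
    congr 1
    · congr 1
      split_ifs with h
      · rw [h]
      · simp
    · rw [Finset.prod_filter, Finset.prod_eq_single i]
      · by_cases h : Γ.Adj i j
        · rw [if_pos h, if_pos h.symm, if_pos rfl]
        · rw [if_neg h, if_neg fun h' => h h'.symm]
      · intro l _ hl
        simp [hl]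
      · simp
  rw [twist, Finset.prod_congr rfl fun j _ => e j, Finset.prod_mul_distrib,
    Finset.prod_mul_distrib, Finset.prod_ite_eq' Finset.univ i, if_pos (Finset.mem_univ _),
    Finset.prod_filter (fun j => Γ.Adj i j) (fun j => residueSymbol (f j) y)]
  rfl

variable {Γ}

theorem isCoprime_pow_of_not_dvd {p x : F[X]} (hirr : Irreducible p) (h : ¬ p ∣ x) (n : ℕ) :
    IsCoprime (p ^ n) x :=
  ((hirr.coprime_iff_not_dvd).mpr h).pow_left

/-- The data of a prime `p` split off from a tuple `u` with `uᵢ = 1`. -/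
structure SplitPrime (i : V) (p : F[X]) (b : V → ℕ) (u' : V → F[X]) : Prop where
  monic : p.Monic
  irr : Irreducible p
  b_self : b i = 0
  u_self : u' i = 1
  u_monic : ∀ j, (u' j).Monic
  not_dvd : ∀ j, ¬ p ∣ u' j

theorem nbrs_monic {i : V} {u : V → F[X]} (h : ∀ j, (u j).Monic) : (nbrs Γ i u).Monic :=
  monic_prod_of_monic _ _ fun j _ => h j

theorem SplitPrime.not_dvd_nbrs {i : V} {p : F[X]} {b : V → ℕ} {u' : V → F[X]}
    (hs : SplitPrime i p b u') : ¬ p ∣ nbrs Γ i u' := by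
  intro h
  obtain ⟨j, _, hj⟩ := (hs.irr.prime.dvd_finsetProd_iff _).mp h
  exact hs.not_dvd j hj

variable [Finite F]

/-- The position i enters the symbols in two ways: p^k meets the neighbouring u'_j, and g meets the
powers of p at the neighbours of i. The latter gives (p/g) to the total exponent of p around i, so
only its parity matters. -/
theorem IsTwisted.update_mul {h : (V → F[X]) → ℂ} (hh : IsTwisted Γ h)
    (hq : Nat.card F % 4 = 1) {i : V} {p : F[X]} {b : V → ℕ} {u' : V → F[X]}
    (hs : SplitPrime i p b u') (k : ℕ) {g : F[X]} (hg : g.Monic) (hpg : ¬ p ∣ g) :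
    h (Function.update (fun j => p ^ b j * u' j) i (p ^ k * g)) =
      h (Function.update (fun j => p ^ b j) i (p ^ k)) * h (Function.update u' i g) *
        (twist Γ (fun j => p ^ b j) u' * residueSymbol p (nbrs Γ i u') ^ k *
          residueSymbol p g ^ (∑ j with Γ.Adj i j, b j) : ℤ) := by
  have hbi : (fun j => p ^ b j) i = 1 := by simp [hs.b_self]
  have e : Function.update (fun j => p ^ b j * u' j) i (p ^ k * g) =
      fun j => Function.update (fun j => p ^ b j) i (p ^ k) j * Function.update u' i g j := by
    funext j
    by_cases hj : j = i
    · subst hj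
      simp
    · simp [hj]
  rw [e, hh.mul, twist_update Γ hbi hs.u_self]
  · congr 3
    · congr 1
      rw [← residueSymbol_prod_right _ _ _ fun j _ => hs.u_monic j,
        residueSymbol_pow_left hq _ (monic_prod_of_monic _ _ fun j _ => hs.u_monic j)]
      rfl
    · rw [← residueSymbol_prod_left hq _ _ hg, Finset.prod_pow_eq_pow_sum,
        residueSymbol_pow_left hq _ hg]
  · intro j
    by_cases hj : j = i
    · subst hj
      simpa using hs.monic.pow k
    · simpa [hj] using hs.monic.pow (b j)
  · intro j
    by_cases hj : j = i
    · subst hj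
      simpa using hg
    · simpa [hj] using hs.u_monic j
  · refine IsCoprime.prod_left fun j _ => IsCoprime.prod_right fun l _ => ?_
    have h1 : ∃ n, Function.update (fun j => p ^ b j) i (p ^ k) j = p ^ n := by
      by_cases hj : j = i
      · subst hj
        exact ⟨k, by simp⟩
      · exact ⟨b j, by simp [hj]⟩
    obtain ⟨n, hn⟩ := h1
    rw [hn]
    refine isCoprime_pow_of_not_dvd hs.irr ?_ n
    by_cases hl : l = i
    · subst hl
      simpa using hpg
    · simpa [hl] using hs.not_dvd l

/-- The series `∑_g h(u, g) (g / E) x ^ deg g`, with `g` in position `i`. -/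
def vertexSeries (h : (V → F[X]) → ℂ) (i : V) (u : V → F[X]) (E : F[X]) : PowerSeries ℂ :=
  monicSeries fun g => h (Function.update u i g) * (residueSymbol g E : ℂ)

theorem vertexSeries_one {h : (V → F[X]) → ℂ} (hh : IsTwisted Γ h) (i : V) (E : F[X]) :
    vertexSeries h i (fun _ => 1) E = symbolSeries E := by
  rw [vertexSeries, symbolSeries, monicSeries]
  congr 1
  funext k
  refine Finset.sum_congr rfl fun g hg => ?_
  have := hh.single i g (mem_monics.mp hg).1
  rw [Pi.mulSingle] at this
  rw [show (fun _ => 1 : V → F[X]) = 1 from rfl, this, one_mul]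

theorem monicSeries_congr {φ φ' : F[X] → ℂ} (h : ∀ g : F[X], g.Monic → φ g = φ' g) :
    monicSeries φ = monicSeries φ' := by
  rw [monicSeries, monicSeries]
  congr 1
  funext k
  exact Finset.sum_congr rfl fun g hg => h g (mem_monics.mp hg).1

theorem rescale_mk (δ : ℂ) (α : ℕ → ℂ) :
    PowerSeries.rescale δ (PowerSeries.mk α) = PowerSeries.mk fun k => δ ^ k * α k := by
  ext k
  simp

theorem IsTwisted.vertexSeries_eq_mul {h : (V → F[X]) → ℂ} (hh : IsTwisted Γ h)
    (hq : Nat.card F % 4 = 1) {i : V} {p : F[X]} {b : V → ℕ} {u' : V → F[X]}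
    (hs : SplitPrime i p b u') {E : F[X]} (hE : E.Monic) :
    vertexSeries h i (fun j => p ^ b j * u' j) E =
      PowerSeries.C (twist Γ (fun j => p ^ b j) u' : ℂ) *
      PowerSeries.expand p.natDegree hs.irr.natDegree_pos.ne'
        (PowerSeries.rescale (residueSymbol p (nbrs Γ i u' * E) : ℂ)
          (PowerSeries.mk fun k => h (Function.update (fun j => p ^ b j) i (p ^ k)))) *
      monicSeries (fun g => open Classical in if p ∣ g then 0 else
        h (Function.update u' i g) * (residueSymbol g E : ℂ) *
          (residueSymbol p g : ℂ) ^ (∑ j with Γ.Adj i j, b j)) := by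
  rw [← PowerSeries.expand_C p.natDegree hs.irr.natDegree_pos.ne', ← map_mul, rescale_mk]
  rw [vertexSeries, monicSeries_eq_mul hs.monic hs.irr (φ' := fun g =>
    h (Function.update u' i g) * (residueSymbol g E : ℂ) *
          (residueSymbol p g : ℂ) ^ (∑ j with Γ.Adj i j, b j))
    (α := fun k => (twist Γ (fun j => p ^ b j) u' : ℂ) *
      ((residueSymbol p (nbrs Γ i u' * E) : ℂ) ^ k *
        h (Function.update (fun j => p ^ b j) i (p ^ k))))]
  · congr 2
    ext k
    rw [PowerSeries.coeff_C_mul, PowerSeries.coeff_mk, PowerSeries.coeff_mk]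
  · intro k g hg hpg
    rw [hh.update_mul hq hs k hg hpg, residueSymbol_mul_left hq _ _ hE,
      residueSymbol_pow_left hq _ hE,
      residueSymbol_mul_right_monic _ (nbrs_monic hs.u_monic) hE]
    push_cast
    ring

/-- With odd exponent one symbol (g/p) survives. It joins the modulus E, and its vanishing for p ∣ g
removes those g automatically. -/
theorem IsTwisted.vertexSeries_odd {h : (V → F[X]) → ℂ} (hh : IsTwisted Γ h)
    (hq : Nat.card F % 4 = 1) {i : V} {p : F[X]} {b : V → ℕ} {u' : V → F[X]}
    (hs : SplitPrime i p b u') {E : F[X]} (hE : E.Monic)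
    (hv : Odd (∑ j with Γ.Adj i j, b j)) :
    vertexSeries h i (fun j => p ^ b j * u' j) E =
      PowerSeries.C (twist Γ (fun j => p ^ b j) u' : ℂ) *
      PowerSeries.expand p.natDegree hs.irr.natDegree_pos.ne'
        (PowerSeries.rescale (residueSymbol p (nbrs Γ i u' * E) : ℂ)
          (PowerSeries.mk fun k => h (Function.update (fun j => p ^ b j) i (p ^ k)))) *
      vertexSeries h i u' (E * p) := by
  rw [hh.vertexSeries_eq_mul hq hs hE]
  congr 1
  refine monicSeries_congr fun g hg => ?_
  rw [residueSymbol_mul_right_monic _ hE hs.monic]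
  by_cases hpg : p ∣ g
  · have : residueSymbol g p = 0 := residueSymbol_eq_zero hq hs.monic fun hc =>
      hs.irr.not_isUnit (hc.isUnit_of_dvd' hpg dvd_rfl)
    rw [if_pos hpg, this]
    simp
  · rw [if_neg hpg, residueSymbol_comm hq hs.monic hg]
    have h2 : residueSymbol g p ^ 2 = 1 :=
      residueSymbol_sq hq hs.monic ((hs.irr.coprime_iff_not_dvd).mpr hpg).symm
    obtain ⟨m, hm⟩ := hv
    have : (residueSymbol g p : ℂ) ^ (∑ j with Γ.Adj i j, b j) = residueSymbol g p := by
      rw [hm, pow_succ, pow_mul]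
      have : (residueSymbol g p : ℂ) ^ 2 = 1 := by exact_mod_cast h2
      rw [this, one_pow, one_mul]
    rw [this]
    push_cast
    ring

/-- With even exponent the symbol at p disappears, and what remains is the series of u' without its
Euler factor at p. To identify that factor, compare with the same decomposition for b = 0: there the
initial conditions make every local weight 1, so the factor is a geometric series. -/
theorem IsTwisted.vertexSeries_even {h : (V → F[X]) → ℂ} (hh : IsTwisted Γ h)
    (hq : Nat.card F % 4 = 1) {i : V} {p : F[X]} {b : V → ℕ} {u' : V → F[X]}
    (hs : SplitPrime i p b u') {E : F[X]} (hE : E.Monic)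
    (hv : Even (∑ j with Γ.Adj i j, b j)) :
    vertexSeries h i (fun j => p ^ b j * u' j) E =
      PowerSeries.C (twist Γ (fun j => p ^ b j) u' : ℂ) *
      PowerSeries.expand p.natDegree hs.irr.natDegree_pos.ne'
        (PowerSeries.rescale (residueSymbol p (nbrs Γ i u' * E) : ℂ)
          ((PowerSeries.mk fun k => h (Function.update (fun j => p ^ b j) i (p ^ k))) *
            (1 - PowerSeries.X))) *
      vertexSeries h i u' E := by
  classical
  have hs0 : SplitPrime i p (fun _ => 0) u' := { hs with b_self := rfl }
  have h1 : monicSeries (fun g => if p ∣ g then 0 else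
        h (Function.update u' i g) * (residueSymbol g E : ℂ) *
          (residueSymbol p g : ℂ) ^ (∑ j with Γ.Adj i j, b j)) =
      monicSeries (fun g => if p ∣ g then 0 else
        h (Function.update u' i g) * (residueSymbol g E : ℂ)) := by
    refine monicSeries_congr fun g hg => ?_
    by_cases hpg : p ∣ g
    · rw [if_pos hpg, if_pos hpg]
    · rw [if_neg hpg, if_neg hpg]
      have h2 : residueSymbol p g ^ 2 = 1 :=
        residueSymbol_sq hq hg ((hs.irr.coprime_iff_not_dvd).mpr hpg)
      obtain ⟨m, hm⟩ := hv
      have : (residueSymbol p g : ℂ) ^ 2 = 1 := by exact_mod_cast h2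
      rw [hm, ← two_mul, pow_mul, this, one_pow, mul_one]
  have h0 := hh.vertexSeries_eq_mul hq hs0 hE
  have e1 : (fun j => p ^ (0 : ℕ) * u' j) = u' := by
    funext j
    simp
  have e2 : twist Γ (fun _ => p ^ (0 : ℕ)) u' = 1 := by
    simp [twist, residueSymbol_one_left]
  have e3 : (PowerSeries.mk fun k => h (Function.update (fun _ => p ^ (0 : ℕ)) i (p ^ k))) *
      (1 - PowerSeries.X) = 1 := by
    have : (fun k => h (Function.update (fun _ => p ^ (0 : ℕ)) i (p ^ k))) = fun _ => 1 := by
      funext k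
      rw [← hh.single i (p ^ k) (hs.monic.pow k), pow_zero]
      rfl
    rw [this]
    exact PowerSeries.mk_one_mul_one_sub_eq_one ℂ
  simp only [Finset.sum_const_zero, pow_zero, mul_one] at h0
  simp only [pow_zero] at e1 e2 e3
  rw [e1, e2, Int.cast_one, map_one, one_mul] at h0
  rw [hh.vertexSeries_eq_mul hq hs hE, h1, h0, map_mul, map_mul, mul_assoc, mul_assoc,
    mul_assoc]
  congr 2
  rw [← mul_assoc, ← map_mul, ← map_mul, mul_comm (1 - PowerSeries.X), e3, map_one, map_one,
    one_mul]

end Vertex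

end

end AffineMDS

open scoped Polynomial

namespace AffineMDS

noncomputable section

/-! ### The structure of the series attached to a vertex -/

section Structure

open Polynomial

variable {V : Type*} [Fintype V] [DecidableEq V] {Γ : SimpleGraph V} [DecidableRel Γ.Adj]
variable {F : Type*} [Field F]

/-- The local functional equation: `∑ αₖ yᵏ` is a palindromic polynomial, divided by `1 - y`
if `v` is even. -/
def LocalFE (Q : ℂ) (v : ℕ) (α : ℕ → ℂ) : Prop :=
  ∃ P : ℂ[X], IsPal Q (v / 2) P ∧
    (Odd v → PowerSeries.mk α = (P : PowerSeries ℂ)) ∧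
    (Even v → PowerSeries.mk α * (1 - PowerSeries.X) = (P : PowerSeries ℂ))

theorem LocalFE.eq_zero {Q : ℂ} {v : ℕ} {α : ℕ → ℂ} (h : LocalFE Q v α) (hv : Odd v) :
    α v = 0 := by
  obtain ⟨P, h1, h2, _⟩ := h
  have := congrArg (PowerSeries.coeff v) (h2 hv)
  rw [PowerSeries.coeff_mk, Polynomial.coeff_coe] at this
  rw [this]
  refine coeff_eq_zero_of_natDegree_lt (h1.1.trans_lt ?_)
  obtain ⟨m, rfl⟩ := hv
  omega

/-- Dividing by 1 - y forms partial sums of coefficients, and at v the sum is complete. It lets the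
value of a local numerator at 1 be read as a single local weight. -/
theorem eval_one_eq_coeff {P : ℂ[X]} {v : ℕ} (hP : P.natDegree ≤ v) {f : PowerSeries ℂ}
    (h : f * (1 - PowerSeries.X) = (P : PowerSeries ℂ)) : P.eval 1 = PowerSeries.coeff v f := by
  have h1 : f = (P : PowerSeries ℂ) * PowerSeries.mk 1 := by
    rw [← h, mul_assoc, mul_comm (1 - PowerSeries.X), PowerSeries.mk_one_mul_one_sub_eq_one ℂ,
      mul_one]
  rw [h1, PowerSeries.coeff_mul, Polynomial.eval_eq_sum_range' (Nat.lt_succ_of_le hP),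
    Finset.Nat.sum_antidiagonal_eq_sum_range_succ_mk]
  refine Finset.sum_congr rfl fun k _ => ?_
  simp

theorem expand_rescale_coe {d : ℕ} (hd : d ≠ 0) (δ : ℂ) (P : ℂ[X]) :
    PowerSeries.expand d hd (PowerSeries.rescale δ (P : PowerSeries ℂ)) =
      ((Polynomial.expand ℂ d (P.comp (C δ * X)) : ℂ[X]) : PowerSeries ℂ) := by
  ext n
  rw [PowerSeries.coeff_expand, Polynomial.coeff_coe, coeff_expand (Nat.pos_of_ne_zero hd)]
  split_ifs
  · rw [PowerSeries.coeff_rescale, Polynomial.coeff_coe, comp_C_mul_X_coeff, mul_comm]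
  · rfl

theorem nbrs_pow_mul (i : V) (p : F[X]) (b : V → ℕ) (u' : V → F[X]) :
    nbrs Γ i (fun j => p ^ b j * u' j) = p ^ (∑ j with Γ.Adj i j, b j) * nbrs Γ i u' := by
  rw [nbrs, Finset.prod_mul_distrib, Finset.prod_pow_eq_pow_sum]
  rfl

/-- Splitting a prime off a tuple. -/
theorem exists_splitPrime {i : V} {u : V → F[X]} (hu : ∀ j, (u j).Monic) (hi : u i = 1)
    {p : F[X]} (hp : p.Monic) (hirr : Irreducible p) :
    ∃ u' : V → F[X], SplitPrime i p (fun j => multiplicity p (u j)) u' ∧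
      u = fun j => p ^ multiplicity p (u j) * u' j := by
  choose u' h1 h2 h3 using fun j => exists_monic_eq_pow_mul hp hirr (hu j)
  have h0 : multiplicity p (u i) = 0 := by
    rw [hi, multiplicity_eq_zero]
    exact fun h => hirr.not_isUnit (isUnit_of_dvd_one h)
  refine ⟨u', ⟨hp, hirr, h0, ?_, h1, h3⟩, funext h2⟩
  have := h2 i
  rw [h0, pow_zero, one_mul, hi] at this
  exact this.symm

theorem multiplicity_pow_mul_of_ne {p p' : F[X]} (hp : p.Monic) (hirr : Irreducible p)
    (hp' : p'.Monic) (hirr' : Irreducible p') (hne : p' ≠ p) (n : ℕ) {x : F[X]} (hx : x ≠ 0) :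
    multiplicity p' (p ^ n * x) = multiplicity p' x := by
  have h1 : ¬ p' ∣ p ^ n := by
    intro h
    have h2 := hirr'.prime.dvd_of_dvd_pow h
    exact hne (eq_of_monic_of_associated hp' hp (hirr'.associated_of_dvd hirr h2))
  rw [multiplicity_mul hirr'.prime (finiteMultiplicity_of_irreducible hirr'
    (mul_ne_zero (pow_ne_zero _ hp.ne_zero) hx)), multiplicity_eq_zero.mpr h1, zero_add]

variable [Finite F]

/-- The local weights of a tuple `u` at a prime `p`. -/
def localWeight (h : (V → F[X]) → ℂ) (i : V) (u : V → F[X]) (p : F[X]) (k : ℕ) : ℂ :=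
  h (Function.update (fun j => p ^ multiplicity p (u j)) i (p ^ k))

/-- Induction on the degree of ∏ u_j, removing one prime p at a time. If the exponent v of p in the
product over the neighbours is even, p goes into s; if v is odd, one copy goes into D₀ and is also
moved into E, so a general E is needed for the induction. Each prime contributes one palindromic
factor to Q. The last two clauses follow the weight at g = `nbrs Γ i u`: its local factor is the
value at 1 of the numerator when v is even, and 0 when v is odd because the local polynomial has
degree at most v - 1. -/
theorem IsTwisted.exists_vertexSeries_eq {h : (V → F[X]) → ℂ} (hh : IsTwisted Γ h)
    (hq : Nat.card F % 4 = 1) {i : V} (u : V → F[X]) (hu : ∀ j, (u j).Monic) (hi : u i = 1)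
    (hloc : ∀ p : F[X], p.Monic → Irreducible p → p ∣ ∏ j, u j →
      LocalFE ((Nat.card F : ℂ) ^ p.natDegree) (∑ j with Γ.Adj i j, multiplicity p (u j))
        (localWeight h i u p))
    (E : F[X]) (hE : E.Monic) (hc : IsCoprime E (∏ j, u j)) :
    ∃ (D₀ s : F[X]) (Q : ℂ[X]) (n : ℕ), D₀.Monic ∧ Squarefree D₀ ∧ s.Monic ∧
      nbrs Γ i u = D₀ * s ^ 2 ∧ (nbrs Γ i u).natDegree = D₀.natDegree + 2 * n ∧
      IsPal (Nat.card F) n Q ∧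
      vertexSeries h i u E = (Q : PowerSeries ℂ) * symbolSeries (E * D₀) ∧
      (D₀ = 1 → E = 1 → Q.eval 1 = h (Function.update u i (nbrs Γ i u))) ∧
      (D₀ ≠ 1 → h (Function.update u i (nbrs Γ i u)) = 0) := by
  have hq0 : (Nat.card F : ℂ) ≠ 0 := by
    rw [Nat.cast_ne_zero]
    omega
  induction hN : (∏ j, u j).natDegree using Nat.strong_induction_on generalizing u E with
  | _ N ih =>
  have hprod : (∏ j, u j).Monic := monic_prod_of_monic _ _ fun j _ => hu j
  by_cases h0 : (∏ j, u j).natDegree = 0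
  · have hu1 : u = fun _ => 1 := by
      funext j
      have h1 := hprod.natDegree_eq_zero.mp h0
      exact (hu j).eq_one_of_isUnit (isUnit_of_dvd_one (h1 ▸ Finset.dvd_prod_of_mem u
        (Finset.mem_univ j)))
    subst hu1
    have hn : nbrs Γ i (fun _ : V => (1 : F[X])) = 1 := by simp [nbrs]
    refine ⟨1, 1, 1, 0, monic_one, squarefree_one, monic_one, ?_, ?_, isPal_one _, ?_, ?_, ?_⟩
    · simp [hn]
    · simp [hn]
    · rw [vertexSeries_one hh]
      simp
    · intro _ _
      rw [hn, eval_one]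
      exact (hh.single i 1 monic_one).symm
    · intro h
      exact absurd rfl h
  obtain ⟨p, hp, hirr, hpd⟩ := exists_monic_irreducible_factor (∏ j, u j)
    (fun h => h0 (natDegree_eq_zero_of_isUnit h))
  obtain ⟨u', hs, hu'⟩ := exists_splitPrime hu hi hp hirr
  set b : V → ℕ := fun j => multiplicity p (u j) with hb
  set v := ∑ j with Γ.Adj i j, b j with hv
  have hα := hloc p hp hirr hpd
  have hprod' : (∏ j, u' j).Monic := monic_prod_of_monic _ _ fun j _ => hs.u_monic j
  have hprodeq : ∏ j, u j = p ^ (∑ j, b j) * ∏ j, u' j := by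
    conv_lhs => rw [hu']
    rw [Finset.prod_mul_distrib, Finset.prod_pow_eq_pow_sum]
  have hpu' : ¬ p ∣ ∏ j, u' j := by
    intro h
    obtain ⟨j, _, hj⟩ := (hirr.prime.dvd_finsetProd_iff _).mp h
    exact hs.not_dvd j hj
  have hlt : (∏ j, u' j).natDegree < N := by
    have h1 : (∑ j, b j) ≠ 0 := by
      intro h1
      rw [h1, pow_zero, one_mul] at hprodeq
      exact hpu' (hprodeq ▸ hpd)
    rw [← hN, hprodeq, (hp.pow _).natDegree_mul hprod', hp.natDegree_pow]
    have := Nat.mul_pos (Nat.pos_of_ne_zero h1) hirr.natDegree_pos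
    omega
  have hpE : ¬ p ∣ E := fun h => hirr.not_isUnit (hc.isUnit_of_dvd' h hpd)
  have hcE' : IsCoprime E (∏ j, u' j) := by
    rw [hprodeq] at hc
    exact hc.of_mul_right_right
  have hloc' : ∀ p' : F[X], p'.Monic → Irreducible p' → p' ∣ ∏ j, u' j →
      LocalFE ((Nat.card F : ℂ) ^ p'.natDegree) (∑ j with Γ.Adj i j, multiplicity p' (u' j))
        (localWeight h i u' p') := by
    intro p' hp' hirr' hd'
    have hne : p' ≠ p := by
      rintro rfl
      exact hpu' hd'
    have hm : ∀ j, multiplicity p' (u j) = multiplicity p' (u' j) := by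
      intro j
      conv_lhs => rw [hu']
      exact multiplicity_pow_mul_of_ne hp hirr hp' hirr' hne _ (hs.u_monic j).ne_zero
    have := hloc p' hp' hirr' (hprodeq ▸ hd'.mul_left _)
    simp only [hm] at this
    unfold localWeight at this ⊢
    simpa only [hm] using this
  have hnb : nbrs Γ i u = p ^ v * nbrs Γ i u' := by
    conv_lhs => rw [hu']
    exact nbrs_pow_mul i p b u'
  have hnm : (nbrs Γ i u').Monic := nbrs_monic hs.u_monic
  have hcn : IsCoprime p (nbrs Γ i u') :=
    (hirr.coprime_iff_not_dvd).mpr hs.not_dvd_nbrs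
  have hval : h (Function.update u i (nbrs Γ i u)) =
      localWeight h i u p v * h (Function.update u' i (nbrs Γ i u')) *
        (twist Γ (fun j => p ^ b j) u' : ℤ) := by
    conv_lhs => rw [hnb, hu']
    rw [hh.update_mul hq hs v hnm hs.not_dvd_nbrs]
    -- The symbol (p / `nbrs Γ i u'`)^v occurs twice, once from p^v in position i and once from the
    -- cofactor in that position.
    have h2 : residueSymbol p (nbrs Γ i u') ^ v * residueSymbol p (nbrs Γ i u') ^ v = 1 := by
      rw [← mul_pow, ← sq, residueSymbol_sq hq hnm hcn, one_pow]
    rw [mul_assoc (twist Γ _ u'), h2, mul_one]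
    rfl
  have hδ : (residueSymbol p (nbrs Γ i u' * E) : ℂ) ^ 2 = 1 := by
    have := residueSymbol_sq hq (hnm.mul hE)
      (hcn.mul_right ((hirr.coprime_iff_not_dvd).mpr hpE))
    exact_mod_cast this
  obtain ⟨P, hP, hPodd, hPeven⟩ := hα
  rcases Nat.even_or_odd v with hve | hvo
  · obtain ⟨D₀, s, Q, n, k1, k2, k3, k4, k5, k6, k7, k8, k9⟩ :=
      ih _ hlt u' hs.u_monic hs.u_self hloc' E hE hcE' rfl
    obtain ⟨m, hm⟩ := hve
    have hv2 : v / 2 = m := by omega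
    refine ⟨D₀, p ^ m * s, C (twist Γ (fun j => p ^ b j) u' : ℂ) *
      Polynomial.expand ℂ p.natDegree (P.comp (C (residueSymbol p (nbrs Γ i u' * E) : ℂ) * X)) *
      Q, p.natDegree * m + n, k1, k2, (hp.pow _).mul k3, ?_, ?_, ?_, ?_, ?_, ?_⟩
    · rw [hnb, k4, hm]
      ring
    · rw [hnb, (hp.pow _).natDegree_mul hnm, hp.natDegree_pow, k5, hm]
      ring
    · refine IsPal.mul hq0 (IsPal.C_mul ?_ _) k6
      rw [hv2] at hP
      exact hP.expand hirr.natDegree_pos hδ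
    · conv_lhs => rw [hu']
      rw [hh.vertexSeries_even hq hs hE ⟨m, hm⟩, k7]
      have := hPeven ⟨m, hm⟩
      unfold localWeight at this
      rw [this, expand_rescale_coe]
      push_cast
      ring
    · intro hD hE1
      rw [hval, ← k8 hD hE1]
      -- The remaining product over the neighbours is the square s², so the sign in the substitution
      -- is trivial.
      have e1 : (residueSymbol p (nbrs Γ i u' * E) : ℂ) = 1 := by
        rw [hE1, mul_one, k4, hD, one_mul, residueSymbol_pow_right _ k3]
        have : IsCoprime p s := by
          rw [k4, hD, one_mul, sq] at hcn
          exact hcn.of_mul_right_left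
        rw [residueSymbol_sq hq k3 this, Int.cast_one]
      have e2 : P.eval 1 = localWeight h i u p v := by
        rw [eval_one_eq_coeff (v := v) (hP.1.trans (Nat.mul_div_le v 2)) (hPeven ⟨m, hm⟩),
          PowerSeries.coeff_mk]
      rw [eval_mul, eval_mul, eval_C, expand_eval, one_pow, e1, eval_comp, eval_mul, eval_C,
        eval_X, mul_one, e2]
      ring
    · intro hD
      rw [hval, k9 hD]
      ring
  · obtain ⟨D₀, s, Q, n, k1, k2, k3, k4, k5, k6, k7, k8, k9⟩ :=
      ih _ hlt u' hs.u_monic hs.u_self hloc' (E * p) (hE.mul hp)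
        (hcE'.mul_left ((hirr.coprime_iff_not_dvd).mpr hpu')) rfl
    have hαv := LocalFE.eq_zero ⟨P, hP, hPodd, hPeven⟩ hvo
    obtain ⟨m, hm⟩ := hvo
    have hv2 : v / 2 = m := by omega
    have hpD : ¬ p ∣ D₀ := fun h => hs.not_dvd_nbrs (by
      rw [k4]
      exact h.mul_right _)
    refine ⟨p * D₀, p ^ m * s, C (twist Γ (fun j => p ^ b j) u' : ℂ) *
      Polynomial.expand ℂ p.natDegree (P.comp (C (residueSymbol p (nbrs Γ i u' * E) : ℂ) * X)) *
      Q, p.natDegree * m + n, hp.mul k1, ?_, (hp.pow _).mul k3, ?_, ?_, ?_, ?_, ?_, ?_⟩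
    · rw [squarefree_mul_iff]
      exact ⟨((hirr.coprime_iff_not_dvd).mpr hpD).isRelPrime, hirr.squarefree, k2⟩
    · rw [hnb, k4, hm]
      ring
    · rw [hnb, (hp.pow _).natDegree_mul hnm, hp.natDegree_pow, k5, hm, hp.natDegree_mul k1]
      ring
    · refine IsPal.mul hq0 (IsPal.C_mul ?_ _) k6
      rw [hv2] at hP
      exact hP.expand hirr.natDegree_pos hδ
    · conv_lhs => rw [hu']
      rw [hh.vertexSeries_odd hq hs hE ⟨m, hm⟩, k7]
      have := hPodd ⟨m, hm⟩
      unfold localWeight at this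
      rw [this, expand_rescale_coe, mul_assoc E p]
      push_cast
      ring
    · intro hD
      exfalso
      exact hirr.not_isUnit (isUnit_of_dvd_one (hD ▸ dvd_mul_right p D₀))
    · intro _
      rw [hval, hαv]
      ring

end Structure

end

end AffineMDS

open scoped Polynomial

namespace AffineMDS

noncomputable section

/-! ### Stability and functional equations of the coefficients -/

section Stability

open Polynomial

/-- The powers of 5 are infinitely many admissible values of q, enough to turn numerical identities
into polynomial ones. -/
theorem exists_field_card (n : ℕ) (hn : n ≠ 0) :
    ∃ (F : Type) (_ : Field F) (_ : Finite F), Nat.card F = 5 ^ n ∧ Nat.card F % 4 = 1 := by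
  have : Fact (Nat.Prime 5) := ⟨by norm_num⟩
  refine ⟨GaloisField 5 n, inferInstance, ?_, GaloisField.card 5 n hn, ?_⟩
  · refine Nat.finite_of_card_ne_zero ?_
    rw [GaloisField.card 5 n hn]
    positivity
  · rw [GaloisField.card 5 n hn, Nat.pow_mod]
    norm_num

theorem eq_of_eval_five_pow {P Q : ℂ[X]}
    (h : ∀ n : ℕ, n ≠ 0 → P.eval ((5 : ℂ) ^ n) = Q.eval ((5 : ℂ) ^ n)) : P = Q := by
  refine Polynomial.eq_of_infinite_eval_eq P Q ?_
  have hinj : Function.Injective fun n : ℕ => (5 : ℂ) ^ (n + 1) := by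
    intro a b hab
    have hab' : ((5 ^ (a + 1) : ℕ) : ℂ) = ((5 ^ (b + 1) : ℕ) : ℂ) := by
      push_cast
      exact hab
    have := Nat.pow_right_injective (le_refl 2 |>.trans (by norm_num : 2 ≤ 5))
      (Nat.cast_injective hab')
    omega
  refine (Set.infinite_range_of_injective hinj).mono ?_
  rintro _ ⟨n, rfl⟩
  exact h (n + 1) n.succ_ne_zero

/-- A polynomial all of whose terms have degree greater than `M / 2` and which satisfies
`e(q) = q ^ M e(1 / q)` vanishes. -/
theorem eq_zero_of_dominant {e : ℂ[X]} {M : ℕ} (hd : ∀ d, e.coeff d ≠ 0 → M < 2 * d)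
    (h : ∀ n : ℕ, n ≠ 0 →
      e.eval ((5 : ℂ) ^ n) = ((5 : ℂ) ^ n) ^ M * e.eval (((5 : ℂ) ^ n)⁻¹)) : e = 0 := by
  by_contra he
  -- Comparing degrees gives deg e + (trailing degree of e) = M, whereas both summands exceed M / 2.
  have key : X ^ e.natDegree * e = X ^ M * e.reverse := by
    refine eq_of_eval_five_pow fun n hn => ?_
    have hq : ((5 : ℂ) ^ n) ≠ 0 := pow_ne_zero _ (by norm_num)
    rw [eval_mul, eval_mul, eval_pow, eval_pow, eval_X, h n hn]
    let _ : Invertible (((5 : ℂ) ^ n)⁻¹) := invertibleOfNonzero (inv_ne_zero hq)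
    have h2 := eval₂_reverse_mul_pow (RingHom.id ℂ) ((5 : ℂ) ^ n)⁻¹ e
    rw [invOf_eq_inv, inv_inv] at h2
    rw [← eval, ← eval] at h2
    rw [← h2, inv_pow]
    field_simp
  have h1 := congrArg natDegree key
  rw [natDegree_mul (pow_ne_zero _ X_ne_zero) he, natDegree_mul (pow_ne_zero _ X_ne_zero)
    (by simpa using he), natDegree_X_pow, natDegree_X_pow, reverse_natDegree] at h1
  have h2 := hd e.natTrailingDegree (by simpa using he)
  have h3 := natTrailingDegree_le_natDegree e
  omega

variable {V : Type*} [Fintype V] [DecidableEq V] (Γ : SimpleGraph V) [DecidableRel Γ.Adj]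

/-- `∑_{j ∼ i} aⱼ`. -/
def nbrDeg (i : V) (a : V →₀ ℕ) : ℕ := ∑ j with Γ.Adj i j, a j

/-- `∑_{j ≠ i} aⱼ`. -/
def restDeg (i : V) (a : V →₀ ℕ) : ℕ := ∑ j ∈ Finset.univ.erase i, a j

/-- The coefficients of `∑ₖ sₖ yᵏ`, multiplied by `1 - X y` if `A` is even. -/
def hat (A : ℕ) (s : ℕ → ℂ[X]) : ℕ → ℂ[X]
  | 0 => s 0
  | k + 1 => if Even A then s (k + 1) - X * s k else s (k + 1)

/-- As a series in `xᵢ`, the coefficient of the other variables is a palindromic polynomial,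
divided by `1 - q xᵢ` if `A(i)` is even. -/
def StableFE (c : (V →₀ ℕ) → ℂ[X]) (i : V) (a : V →₀ ℕ) : Prop :=
  (∀ k, 2 * (nbrDeg Γ i a / 2) < k → hat (nbrDeg Γ i a) (fun k => c (a.update i k)) k = 0) ∧
  ∀ j k, j + k = 2 * (nbrDeg Γ i a / 2) →
    X ^ k * hat (nbrDeg Γ i a) (fun k => c (a.update i k)) j =
      X ^ (nbrDeg Γ i a / 2) * hat (nbrDeg Γ i a) (fun k => c (a.update i k)) k

theorem sum_update (i : V) (a : V →₀ ℕ) (k : ℕ) :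
    ∑ j, (a.update i k) j = restDeg i a + k := by
  rw [← Finset.sum_erase_add _ _ (Finset.mem_univ i), restDeg]
  congr 1
  · refine Finset.sum_congr rfl fun j hj => ?_
    rw [Finsupp.update_apply, if_neg (Finset.mem_erase.mp hj).1]
  · rw [Finsupp.update_apply, if_pos rfl]

variable {Γ} {H : Weights V} {c : (V →₀ ℕ) → ℂ[X]}

theorem SatisfiesAxioms.isTwisted (hH : SatisfiesAxioms Γ H c) (F : Type) [Field F] [Finite F]
    (hq : Nat.card F % 4 = 1) : IsTwisted Γ (H F) where
  mul f g hf hg hc := by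
    rw [hH.twisted_mul F hq f g hf hg hc, twist]
    push_cast
    rfl
  single i f hf := hH.initial F hq i f hf

theorem SatisfiesAxioms.coeff_tuples (hH : SatisfiesAxioms Γ H c) (F : Type) [Field F] [Finite F]
    (hq : Nat.card F % 4 = 1) (a : V →₀ ℕ) :
    (c a).eval (Nat.card F : ℂ) = ∑ f ∈ tuples F a, H F f := by
  rw [← hH.coeff_eq F hq a, Z, coeff_degreeSeries]

/-- Summing over tuples by first fixing all positions but `i`. -/
theorem sum_tuples_update {F : Type*} [Field F] [Finite F] (φ : (V → F[X]) → ℂ) (i : V)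
    (a : V →₀ ℕ) (k : ℕ) :
    ∑ f ∈ tuples F (a.update i k), φ f =
      ∑ u ∈ tuples F (a.update i 0), ∑ g ∈ monics F k, φ (Function.update u i g) := by
  rw [← Finset.sum_product']
  symm
  refine Finset.sum_bij (fun z _ => Function.update z.1 i z.2) ?_ ?_ ?_ ?_
  · rintro ⟨u, g⟩ hz
    rw [Finset.mem_product, mem_tuples, mem_monics] at hz
    obtain ⟨hu, hg⟩ := hz
    rw [mem_tuples]
    intro j
    by_cases hj : j = i
    · subst hj
      simpa using hg
    · have := hu j
      simpa [hj, Finsupp.update_apply] using this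
  · rintro ⟨u, g⟩ hz ⟨u', g'⟩ hz' he
    rw [Finset.mem_product, mem_tuples] at hz hz'
    simp only at he
    have h1 : g = g' := by
      have := congrFun he i
      simpa using this
    have h2 : u = u' := by
      funext j
      by_cases hj : j = i
      · subst hj
        have e1 := hz.1 j
        have e2 := hz'.1 j
        rw [Finsupp.update_apply, if_pos rfl] at e1 e2
        simp only at e1 e2
        rw [e1.1.natDegree_eq_zero.mp e1.2, e2.1.natDegree_eq_zero.mp e2.2]
      · have := congrFun he j
        simpa [hj] using this
    rw [h1, h2]
  · intro f hf
    rw [mem_tuples] at hf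
    refine ⟨(Function.update f i 1, f i), ?_, by simp⟩
    rw [Finset.mem_product, mem_tuples, mem_monics]
    constructor
    · intro j
      by_cases hj : j = i
      · subst hj
        simp
      · have := hf j
        simpa [hj, Finsupp.update_apply] using this
    · have := hf i
      simpa using this
  · intro z _
    rfl

theorem update_zero_apply_self {F : Type*} [Field F] [Finite F] {i : V} {a : V →₀ ℕ}
    {u : V → F[X]} (hu : u ∈ tuples F (a.update i 0)) : u i = 1 := by
  rw [mem_tuples] at hu
  have := hu i
  rw [Finsupp.update_apply, if_pos rfl] at this
  exact this.1.natDegree_eq_zero.mp this.2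

theorem tuples_update_zero {F : Type*} [Field F] [Finite F] {i : V} {a : V →₀ ℕ}
    (h : restDeg i a = 0) : tuples F (a.update i 0) = {1} := by
  ext u
  rw [mem_tuples, Finset.mem_singleton]
  have hz : ∀ j, (a.update i 0) j = 0 := by
    intro j
    rw [Finsupp.update_apply]
    split_ifs with hj
    · rfl
    · exact Finset.sum_eq_zero_iff.mp h j (Finset.mem_erase.mpr ⟨hj, Finset.mem_univ _⟩)
  constructor
  · intro hu
    funext j
    have := hu j
    rw [hz j] at this
    exact this.1.natDegree_eq_zero.mp this.2
  · rintro rfl j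
    rw [hz]
    simp

theorem SatisfiesAxioms.eq_X_pow (hH : SatisfiesAxioms Γ H c) {i : V} {a : V →₀ ℕ}
    (h : restDeg i a = 0) (k : ℕ) : c (a.update i k) = X ^ k := by
  refine eq_of_eval_five_pow fun n hn => ?_
  obtain ⟨F, _, _, hF, hq⟩ := exists_field_card n hn
  have hcast : (5 : ℂ) ^ n = (Nat.card F : ℂ) := by
    rw [hF]
    push_cast
    rfl
  rw [hcast, hH.coeff_tuples F hq, sum_tuples_update, tuples_update_zero h,
    Finset.sum_singleton, eval_pow, eval_X]
  have : ∀ g ∈ monics F k, H F (Function.update 1 i g) = 1 := fun g hg =>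
    hH.initial F hq i g (mem_monics.mp hg).1
  rw [Finset.sum_congr rfl this, Finset.sum_const, card_monics]
  simp

theorem SatisfiesAxioms.eq_X (hH : SatisfiesAxioms Γ H c) {b : V →₀ ℕ}
    (h : ∑ j, b j = 1) : c b = X := by
  obtain ⟨i, hi⟩ : ∃ i, b i ≠ 0 := by
    by_contra hc
    push Not at hc
    rw [Finset.sum_eq_zero fun j _ => hc j] at h
    exact zero_ne_one h
  have h1 := sum_update i b (b i)
  have h2 : b.update i (b i) = b := by
    rw [Finsupp.update_self]
  rw [h2, h] at h1
  have h3 := hH.eq_X_pow (i := i) (a := b) (by omega) (b i)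
  rw [h2, show b i = 1 by omega, pow_one] at h3
  exact h3

/-- Multiplication by X raises the degree by 1 while the bound grows only by 1/2, so the correction
X s_k is dominant as well. When its coefficient has total degree 1, outside the dominance axiom, it
is X itself and X² still satisfies the bound. -/
theorem SatisfiesAxioms.hat_dominance (hH : SatisfiesAxioms Γ H c) (A : ℕ) {i : V} {a : V →₀ ℕ}
    {k : ℕ} (hk : 2 ≤ restDeg i a + k) {d : ℕ}
    (hd : (hat A (fun k => c (a.update i k)) k).coeff d ≠ 0) : restDeg i a + k + 1 < 2 * d := by
  have h1 : ∀ d, (c (a.update i k)).coeff d ≠ 0 → restDeg i a + k + 1 < 2 * d := by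
    intro d hd
    have := hH.dominance (a.update i k) (by rwa [sum_update]) d hd
    rwa [sum_update] at this
  cases k with
  | zero => exact h1 d hd
  | succ k =>
    rw [hat] at hd
    split_ifs at hd
    · rw [coeff_sub] at hd
      by_cases h2 : (c (a.update i (k + 1))).coeff d = 0
      · rw [h2, zero_sub, neg_ne_zero] at hd
        cases d with
        | zero => simp at hd
        | succ d =>
          rw [coeff_X_mul] at hd
          by_cases h3 : 2 ≤ restDeg i a + k
          · have := hH.dominance (a.update i k) (by rwa [sum_update]) d hd
            rw [sum_update] at this
            omega
          · rw [hH.eq_X (b := a.update i k) (by rw [sum_update]; omega), coeff_X] at hd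
            have : 1 = d := by
              by_contra hne
              exact hd (if_neg hne)
            omega
      · exact h1 d h2
    · exact h1 d hd

/-- Local-to-global evaluates the coefficients at Q⁻¹ and rescales by Q to the total degree. This
takes the pole factor 1 - q x to 1 - y and keeps the palindromic symmetry, now for Q = q^(deg p). -/
theorem SatisfiesAxioms.localFE (hH : SatisfiesAxioms Γ H c) {i : V} {b : V →₀ ℕ}
    (hs : StableFE Γ c i b) (F : Type) [Field F] [Finite F] (hq : Nat.card F % 4 = 1) {p : F[X]}
    (hp : p.Monic) (hirr : Irreducible p) :
    LocalFE ((Nat.card F : ℂ) ^ p.natDegree) (nbrDeg Γ i b)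
      (fun k => H F (Function.update (fun j => p ^ b j) i (p ^ k))) := by
  set Q := (Nat.card F : ℂ) ^ p.natDegree with hQ
  have hQ0 : Q ≠ 0 := pow_ne_zero _ (by
    rw [Nat.cast_ne_zero]
    omega)
  have hα : (fun k => H F (Function.update (fun j => p ^ b j) i (p ^ k))) =
      fun k => Q ^ (restDeg i b + k) * (c (b.update i k)).eval Q⁻¹ := by
    funext k
    rw [← sum_update, ← hH.local_global F hq p hp hirr]
    congr 1
    funext j
    rw [Finsupp.update_apply, Function.update_apply]
    split_ifs <;> rfl
  rw [hα]
  set t := hat (nbrDeg Γ i b) (fun k => c (b.update i k)) with ht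
  have hc : ∀ n, (∑ k ∈ Finset.range (2 * (nbrDeg Γ i b / 2) + 1), Polynomial.monomial k
        (Q ^ (restDeg i b + k) * (t k).eval Q⁻¹)).coeff n =
        Q ^ (restDeg i b + n) * (t n).eval Q⁻¹ := by
    intro n
    simp only [finsetSum_coeff, coeff_monomial, Finset.sum_ite_eq', Finset.mem_range]
    split_ifs with h
    · rfl
    · rw [show t n = 0 from hs.1 n (by omega), eval_zero, mul_zero]
  refine ⟨∑ k ∈ Finset.range (2 * (nbrDeg Γ i b / 2) + 1), Polynomial.monomial k
        (Q ^ (restDeg i b + k) * (t k).eval Q⁻¹), ⟨?_, ?_⟩, ?_, ?_⟩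
  · rw [natDegree_le_iff_coeff_eq_zero]
    intro n hn
    rw [hc, show t n = 0 from hs.1 n hn, eval_zero, mul_zero]
  · intro j k hjk
    rw [hc, hc]
    have h1 := congrArg (eval Q⁻¹) (hs.2 j k hjk)
    rw [eval_mul, eval_mul, eval_pow, eval_pow, eval_X, ← ht, inv_pow, inv_pow] at h1
    have h2 : (t j).eval Q⁻¹ = Q ^ k * ((Q ^ (nbrDeg Γ i b / 2))⁻¹ * (t k).eval Q⁻¹) := by
      rw [← h1, mul_inv_cancel_left₀ (pow_ne_zero _ hQ0)]
    rw [h2]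
    have h3 : Q ^ (restDeg i b + j) * Q ^ k = Q ^ (restDeg i b) * Q ^ (nbrDeg Γ i b / 2) *
        Q ^ (nbrDeg Γ i b / 2) := by
      rw [← pow_add, ← pow_add, ← pow_add]
      congr 1
      omega
    have hm := pow_ne_zero (nbrDeg Γ i b / 2) hQ0
    calc Q ^ k * (Q ^ (restDeg i b + j) * (Q ^ k * ((Q ^ (nbrDeg Γ i b / 2))⁻¹ *
          (t k).eval Q⁻¹))) = Q ^ k * (Q ^ (restDeg i b + j) * Q ^ k) *
            (Q ^ (nbrDeg Γ i b / 2))⁻¹ * (t k).eval Q⁻¹ := by ring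
      _ = _ := by
        rw [h3]
        field_simp
        ring
  · intro ho
    ext n
    rw [PowerSeries.coeff_mk, Polynomial.coeff_coe, hc, ht]
    cases n with
    | zero => rfl
    | succ n => rw [hat, if_neg (Nat.not_even_iff_odd.mpr ho)]
  · intro he
    ext n
    rw [Polynomial.coeff_coe, hc, ht, mul_sub, mul_one, map_sub]
    cases n with
    | zero => simp [hat]
    | succ n =>
      rw [PowerSeries.coeff_succ_mul_X, PowerSeries.coeff_mk, PowerSeries.coeff_mk, hat,
        if_pos he, eval_sub, eval_mul, eval_X, ← add_assoc, pow_succ]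
      field_simp

/-- For D₀ = 1 the factor 1 - q x cancels the zeta function. For D₀ ≠ 1 of even degree it completes
the factor 1 - x of the L-series to the palindromic (1 - q x)(1 - x). -/
theorem IsTwisted.exists_isPal {F : Type*} [Field F] [Finite F] {h : (V → F[X]) → ℂ}
    (hh : IsTwisted Γ h) (hq : Nat.card F % 4 = 1) {i : V} (u : V → F[X])
    (hu : ∀ j, (u j).Monic) (hi : u i = 1)
    (hloc : ∀ p : F[X], p.Monic → Irreducible p → p ∣ ∏ j, u j →
      LocalFE ((Nat.card F : ℂ) ^ p.natDegree) (∑ j with Γ.Adj i j, multiplicity p (u j))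
        (localWeight h i u p)) :
    ∃ P : ℂ[X], IsPal (Nat.card F) ((nbrs Γ i u).natDegree / 2) P ∧
      (Odd (nbrs Γ i u).natDegree → vertexSeries h i u 1 = (P : PowerSeries ℂ)) ∧
      (Even (nbrs Γ i u).natDegree →
        (1 - PowerSeries.C (Nat.card F : ℂ) * PowerSeries.X) * vertexSeries h i u 1 =
          (P : PowerSeries ℂ)) := by
  have hq0 : (Nat.card F : ℂ) ≠ 0 := by
    rw [Nat.cast_ne_zero]
    omega
  obtain ⟨D₀, s, Q, n, k1, k2, k3, k4, k5, k6, k7, _, _⟩ :=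
    hh.exists_vertexSeries_eq hq u hu hi hloc 1 monic_one isCoprime_one_left
  rw [one_mul] at k7
  rcases Nat.even_or_odd D₀.natDegree with he | ho
  · by_cases h0 : D₀.natDegree = 0
    · have hD1 := k1.natDegree_eq_zero.mp h0
      refine ⟨Q, ?_, ?_, ?_⟩
      · rwa [k5, h0, show (0 + 2 * n) / 2 = n by omega]
      · intro ho
        rw [k5, h0, zero_add, ← Nat.not_even_iff_odd] at ho
        exact absurd (even_two_mul n) ho
      · intro _
        rw [k7, hD1, mul_left_comm, symbolSeries_one, mul_one]
    · obtain ⟨m, hm⟩ := he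
      obtain ⟨P, hP, hP'⟩ := symbolSeries_even hq k1 k2 (m := m - 1) (by omega)
      refine ⟨((1 - C (Nat.card F : ℂ) * X) * (1 - X)) * (P * Q), ?_, ?_, ?_⟩
      · rw [k5, hm, show (m + m + 2 * n) / 2 = 1 + (m - 1 + n) by omega]
        exact (isPal_linear _).mul hq0 (hP.mul hq0 k6)
      · intro ho
        rw [k5, hm, ← Nat.not_even_iff_odd] at ho
        exact absurd ⟨m + n, by ring⟩ ho
      · intro _
        rw [k7, hP']
        push_cast
        ring
  · obtain ⟨m, hm⟩ := ho
    obtain ⟨P, hP, hP'⟩ := symbolSeries_odd hq k1 k2 hm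
    refine ⟨P * Q, ?_, ?_, ?_⟩
    · rw [k5, hm, show (2 * m + 1 + 2 * n) / 2 = m + n by omega]
      exact hP.mul hq0 k6
    · intro _
      rw [k7, hP']
      push_cast
      ring
    · intro he
      rw [k5, hm] at he
      exact absurd he (Nat.not_even_iff_odd.mpr ⟨m + n, by ring⟩)

end Stability

end

end AffineMDS

open scoped Polynomial

namespace AffineMDS

noncomputable section

/-! ### The induction on the degree in the other variables -/

section Stability

open Polynomial

theorem nbrDeg_le_restDeg {V : Type*} [Fintype V] [DecidableEq V] (Γ : SimpleGraph V)
    [DecidableRel Γ.Adj] (i : V) (a : V →₀ ℕ) : nbrDeg Γ i a ≤ restDeg i a := by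
  refine Finset.sum_le_sum_of_subset fun j hj => ?_
  exact Finset.mem_erase.mpr ⟨(Finset.mem_filter.mp hj).2.ne', Finset.mem_univ _⟩

theorem mk_eval_hat_even {A : ℕ} (hA : Even A) (s : ℕ → ℂ[X]) (q : ℂ) :
    PowerSeries.mk (fun k => (hat A s k).eval q) =
      (1 - PowerSeries.C q * PowerSeries.X) * PowerSeries.mk (fun k => (s k).eval q) := by
  ext n
  cases n with
  | zero => simp [hat]
  | succ n =>
    rw [sub_mul, one_mul, mul_assoc, map_sub, PowerSeries.coeff_C_mul,
      PowerSeries.coeff_succ_X_mul]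
    simp [hat, hA]

theorem hat_of_odd {A : ℕ} (hA : Odd A) (s : ℕ → ℂ[X]) : hat A s = s := by
  funext n
  cases n with
  | zero => rfl
  | succ n => rw [hat, if_neg (Nat.not_even_iff_odd.mpr hA)]

theorem mk_eval_inv_hat {A : ℕ} (hA : Even A) (s : ℕ → ℂ[X]) {q : ℂ} (hq : q ≠ 0) (r : ℕ) :
    PowerSeries.mk (fun k => q ^ (r + k) * (hat A s k).eval q⁻¹) =
      PowerSeries.mk (fun k => q ^ (r + k) * (s k).eval q⁻¹) * (1 - PowerSeries.X) := by
  ext n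
  rw [mul_sub, mul_one, map_sub]
  cases n with
  | zero => simp [hat]
  | succ n =>
    rw [PowerSeries.coeff_succ_mul_X, PowerSeries.coeff_mk, PowerSeries.coeff_mk,
      PowerSeries.coeff_mk, hat, if_pos hA, eval_sub, eval_mul, eval_X, ← add_assoc, pow_succ]
    field_simp

theorem expand_of_eq_one {d : ℕ} (hd : d ≠ 0) (h : d = 1) (f : PowerSeries ℂ) :
    PowerSeries.expand d hd f = f := by
  subst h
  exact PowerSeries.expand_one_apply f

theorem symbolSeries_of_natDegree_one {F : Type*} [Field F] [Finite F]
    (hq : Nat.card F % 4 = 1) {p : F[X]} (hp : p.Monic) (hirr : Irreducible p)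
    (h1 : p.natDegree = 1) : symbolSeries p = 1 := by
  obtain ⟨P, hP, h⟩ := symbolSeries_odd hq hp hirr.squarefree (m := 0) (by omega)
  rw [h, eq_C_of_natDegree_le_zero hP.1, ← Polynomial.coeff_coe, ← h, symbolSeries,
    PowerSeries.coeff_mk, monics_zero, Finset.sum_singleton, residueSymbol_one_left]
  simp

variable {V : Type*} [Fintype V] [DecidableEq V] {Γ : SimpleGraph V} [DecidableRel Γ.Adj]
  {H : Weights V} {c : (V →₀ ℕ) → ℂ[X]}

section

variable (F : Type) [Field F] [Finite F]

/-- The tuple of powers of `X - x` with exponents `a`, except for position `i`. -/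
def linearTuple (i : V) (a : V →₀ ℕ) (x : F) : V → F[X] :=
  fun j => (X - C x) ^ (a.update i 0) j

theorem linearTuple_mem (i : V) (a : V →₀ ℕ) (x : F) :
    linearTuple F i a x ∈ tuples F (a.update i 0) := by
  rw [mem_tuples]
  intro j
  refine ⟨(monic_X_sub_C x).pow _, ?_⟩
  rw [linearTuple, natDegree_pow, natDegree_X_sub_C, mul_one]

theorem linearTuple_injective {i : V} {a : V →₀ ℕ} (h : restDeg i a ≠ 0) :
    Function.Injective (linearTuple F i a) := by
  obtain ⟨j, hj, hj0⟩ := Finset.exists_ne_zero_of_sum_ne_zero h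
  intro x y hxy
  have h1 := congrArg (eval x) (congrFun hxy j)
  have h2 : (a.update i 0) j ≠ 0 := by
    rwa [Finsupp.update_apply, if_neg (Finset.mem_erase.mp hj).1]
  simp only [linearTuple, eval_pow, eval_sub, eval_X, eval_C, sub_self, zero_pow h2] at h1
  exact sub_eq_zero.mp (pow_eq_zero_iff h2 |>.mp h1.symm)

variable {F}

/-- The multiplicities of p are bounded by the a_j. Equality throughout forces p linear and every
u_j to be a power of p, and these are exactly the tuples excluded. -/
theorem restDeg_multiplicity_lt {i : V} {a : V →₀ ℕ} (h : restDeg i a ≠ 0) {u : V → F[X]}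
    (hu : u ∈ tuples F (a.update i 0)) (hl : ∀ x, linearTuple F i a x ≠ u) {p : F[X]}
    (hp : p.Monic) (hirr : Irreducible p) :
    restDeg i (Finsupp.equivFunOnFinite.symm fun j => multiplicity p (u j)) < restDeg i a := by
  have hi := update_zero_apply_self hu
  rw [mem_tuples] at hu
  have hd := hirr.natDegree_pos
  have h1 : ∀ j ∈ Finset.univ.erase i, p.natDegree * multiplicity p (u j) ≤ a j := by
    intro j hj
    have h2 := (hu j).2
    rw [Finsupp.update_apply, if_neg (Finset.mem_erase.mp hj).1] at h2
    rw [← h2]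
    exact multiplicity_mul_natDegree_le hp hirr (hu j).1
  have h2 : ∀ j ∈ Finset.univ.erase i, multiplicity p (u j) ≤ a j := fun j hj =>
    (Nat.le_mul_of_pos_left _ hd).trans (h1 j hj)
  refine lt_of_le_of_ne (Finset.sum_le_sum h2) fun heq => ?_
  have h3 := (Finset.sum_eq_sum_iff_of_le h2).mp heq
  have hp1 : p.natDegree = 1 := by
    obtain ⟨j, hj, hj0⟩ := Finset.exists_ne_zero_of_sum_ne_zero h
    have h4 := h1 j hj
    rw [h3 j hj] at h4
    have h5 : p.natDegree ≤ 1 := by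
      by_contra hlt
      push Not at hlt
      have : 2 * a j ≤ p.natDegree * a j := Nat.mul_le_mul_right _ hlt
      omega
    omega
  have hpx : p = X - C (-p.coeff 0) := by
    rw [C_neg, sub_neg_eq_add]
    exact hp.eq_X_add_C hp1
  refine hl (-p.coeff 0) ?_
  funext j
  rw [linearTuple, ← hpx, Finsupp.update_apply]
  split_ifs with hj
  · rw [hj, hi, pow_zero]
  · obtain ⟨v, hv1, hv2, _⟩ := exists_monic_eq_pow_mul hp hirr (hu j).1
    have h6 := h3 j (Finset.mem_erase.mpr ⟨hj, Finset.mem_univ _⟩)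
    have h7 := (hu j).2
    rw [Finsupp.update_apply, if_neg hj] at h7
    rw [h6] at hv2
    rw [hv2, (hp.pow _).natDegree_mul hv1, natDegree_pow, hp1, mul_one] at h7
    rw [hv2, hv1.natDegree_eq_zero.mp (by omega), mul_one]

theorem natDegree_nbrs {i : V} {a : V →₀ ℕ} {u : V → F[X]}
    (hu : u ∈ tuples F (a.update i 0)) : (nbrs Γ i u).natDegree = nbrDeg Γ i a := by
  rw [mem_tuples] at hu
  rw [nbrs, natDegree_prod_of_monic _ _ fun j _ => (hu j).1]
  refine Finset.sum_congr rfl fun j hj => ?_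
  rw [(hu j).2, Finsupp.update_apply, if_neg (Finset.mem_filter.mp hj).2.ne']

/-- Only one prime occurs and it has degree 1, so the vertex series is the local series at Q = q
times the L-series of p, which is 1, or the zeta function without its factor at p. By
local-to-global the result is again made of the unknown coefficients, now at 1/q. -/
theorem SatisfiesAxioms.vertexSeries_linearTuple (hH : SatisfiesAxioms Γ H c)
    (hq : Nat.card F % 4 = 1) (i : V) (a : V →₀ ℕ) (x : F) :
    (Odd (nbrDeg Γ i a) → vertexSeries (H F) i (linearTuple F i a x) 1 =
      PowerSeries.mk fun k => (Nat.card F : ℂ) ^ (restDeg i a + k) *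
        (hat (nbrDeg Γ i a) (fun k => c (a.update i k)) k).eval (Nat.card F : ℂ)⁻¹) ∧
    (Even (nbrDeg Γ i a) → (1 - PowerSeries.C (Nat.card F : ℂ) * PowerSeries.X) *
        vertexSeries (H F) i (linearTuple F i a x) 1 =
      PowerSeries.mk fun k => (Nat.card F : ℂ) ^ (restDeg i a + k) *
        (hat (nbrDeg Γ i a) (fun k => c (a.update i k)) k).eval (Nat.card F : ℂ)⁻¹) := by
  have hq0 : (Nat.card F : ℂ) ≠ 0 := by
    rw [Nat.cast_ne_zero]
    omega
  have hh := hH.isTwisted F hq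
  have hirr := irreducible_X_sub_C x
  have hmon := monic_X_sub_C x
  have hs : SplitPrime i (X - C x) (a.update i 0) (fun _ => 1) :=
    ⟨hmon, hirr, by simp, rfl, fun _ => monic_one,
      fun _ h => hirr.not_isUnit (isUnit_of_dvd_one h)⟩
  have e1 : linearTuple F i a x = fun j => (X - C x) ^ (a.update i 0) j * 1 := by
    funext j
    rw [linearTuple, mul_one]
  have e2 : twist Γ (fun j => (X - C x) ^ (a.update i 0) j) (fun _ => 1) = 1 := by
    rw [twist]
    exact Finset.prod_eq_one fun j _ => Finset.prod_eq_one fun l _ => residueSymbol_one_right _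
  have e3 : nbrs Γ i (fun _ => (1 : F[X])) = 1 := Finset.prod_eq_one fun _ _ => rfl
  have e4 : (fun k => H F (Function.update (fun j => (X - C x) ^ (a.update i 0) j) i
      ((X - C x) ^ k))) = fun k => (Nat.card F : ℂ) ^ (restDeg i a + k) *
        (c (a.update i k)).eval (Nat.card F : ℂ)⁻¹ := by
    funext k
    have h1 := hH.local_global F hq _ hmon hirr (a.update i k)
    rw [natDegree_X_sub_C, pow_one, sum_update] at h1
    rw [← h1]
    congr 1
    funext j
    rw [Function.update_apply, Finsupp.update_apply, Finsupp.update_apply]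
    split_ifs <;> rfl
  have e5 : ∑ j with Γ.Adj i j, (a.update i 0) j = nbrDeg Γ i a := by
    refine Finset.sum_congr rfl fun j hj => ?_
    rw [Finsupp.update_apply, if_neg (Finset.mem_filter.mp hj).2.ne']
  constructor
  · intro ho
    rw [e1, hh.vertexSeries_odd hq hs monic_one (by rwa [e5]), e2, e3,
      expand_of_eq_one _ (natDegree_X_sub_C x), one_mul, one_mul, residueSymbol_one_right,
      vertexSeries_one hh, symbolSeries_of_natDegree_one hq hmon hirr (natDegree_X_sub_C x), e4,
      hat_of_odd ho]
    simp
  · intro he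
    rw [e1, hh.vertexSeries_even hq hs monic_one (by rwa [e5]), e2, e3,
      expand_of_eq_one _ (natDegree_X_sub_C x), one_mul, residueSymbol_one_right,
      vertexSeries_one hh, e4, mul_left_comm, symbolSeries_one, mk_eval_inv_hat he _ hq0]
    simp

/-- The q linear tuples, distinct because some other a_j is nonzero, all contribute the same dual
series; this is the extra factor q in the exponent `restDeg i a + k + 1`. Every other tuple has
local data of smaller degree and is palindromic by induction. -/
theorem SatisfiesAxioms.exists_isPal (hH : SatisfiesAxioms Γ H c)
    (hq : Nat.card F % 4 = 1) {i : V} {a : V →₀ ℕ} (hr : restDeg i a ≠ 0)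
    (ih : ∀ b, restDeg i b < restDeg i a → StableFE Γ c i b) :
    ∃ P : ℂ[X], IsPal (Nat.card F) (nbrDeg Γ i a / 2) P ∧
      ∀ k, (hat (nbrDeg Γ i a) (fun k => c (a.update i k)) k).eval (Nat.card F : ℂ) =
        (Nat.card F : ℂ) ^ (restDeg i a + k + 1) *
          (hat (nbrDeg Γ i a) (fun k => c (a.update i k)) k).eval (Nat.card F : ℂ)⁻¹ +
        P.coeff k := by
  classical
  have := Fintype.ofFinite F
  have hq0 : (Nat.card F : ℂ) ≠ 0 := by
    rw [Nat.cast_ne_zero]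
    omega
  set A := nbrDeg Γ i a with hA
  set s := fun k => c (a.update i k) with hs
  set L := PowerSeries.mk fun k => (Nat.card F : ℂ) ^ (restDeg i a + k) *
        (hat A s k).eval (Nat.card F : ℂ)⁻¹ with hL
  set G : PowerSeries ℂ := if Even A then 1 - PowerSeries.C (Nat.card F : ℂ) * PowerSeries.X
    else 1 with hG
  have h1 : PowerSeries.mk (fun k => (hat A s k).eval (Nat.card F : ℂ)) =
      ∑ u ∈ tuples F (a.update i 0), G * vertexSeries (H F) i u 1 := by
    have h2 : PowerSeries.mk (fun k => (s k).eval (Nat.card F : ℂ)) =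
        ∑ u ∈ tuples F (a.update i 0), vertexSeries (H F) i u 1 := by
      ext k
      rw [map_sum, PowerSeries.coeff_mk, hs]
      simp only
      rw [hH.coeff_tuples F hq, sum_tuples_update]
      refine Finset.sum_congr rfl fun u _ => ?_
      rw [vertexSeries, monicSeries, PowerSeries.coeff_mk]
      refine Finset.sum_congr rfl fun g _ => ?_
      rw [residueSymbol_one_right]
      simp
    rw [← Finset.mul_sum, ← h2, hG]
    split_ifs with he
    · exact mk_eval_hat_even he s _
    · rw [hat_of_odd (Nat.not_even_iff_odd.mp he), one_mul]
  have h3 : ∀ x, G * vertexSeries (H F) i (linearTuple F i a x) 1 = L := by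
    intro x
    obtain ⟨ho, he⟩ := hH.vertexSeries_linearTuple hq i a x
    rw [hG]
    split_ifs with h
    · exact he h
    · rw [one_mul]
      exact ho (Nat.not_even_iff_odd.mp h)
  set U := tuples F (a.update i 0)
  set W := Finset.univ.image (linearTuple F i a) with hW
  have hWU : W ⊆ U := by
    intro u hu
    obtain ⟨x, _, rfl⟩ := Finset.mem_image.mp hu
    exact linearTuple_mem F i a x
  have h4 : ∑ u ∈ W, G * vertexSeries (H F) i u 1 = PowerSeries.C (Nat.card F : ℂ) * L := by
    rw [hW, Finset.sum_image (linearTuple_injective F hr).injOn,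
      Finset.sum_congr rfl fun x _ => h3 x, Finset.sum_const, Finset.card_univ,
      ← Nat.card_eq_fintype_card, nsmul_eq_mul, map_natCast]
  have h5 : ∀ u ∈ U \ W, ∃ P : ℂ[X], IsPal (Nat.card F) (A / 2) P ∧
      G * vertexSeries (H F) i u 1 = (P : PowerSeries ℂ) := by
    intro u hu
    rw [Finset.mem_sdiff] at hu
    have hu' := hu.1
    rw [mem_tuples] at hu'
    obtain ⟨P, hP1, hP2, hP3⟩ := (hH.isTwisted F hq).exists_isPal hq u (fun j => (hu' j).1)
      (update_zero_apply_self hu.1) fun p hp hirr _ =>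
        hH.localFE (ih _ (restDeg_multiplicity_lt hr hu.1 (fun x hx => hu.2 (by
          rw [hW, ← hx]
          exact Finset.mem_image_of_mem _ (Finset.mem_univ x))) hp hirr)) F hq hp hirr
    rw [natDegree_nbrs hu.1] at hP1 hP2 hP3
    refine ⟨P, hP1, ?_⟩
    rw [hG]
    split_ifs with h
    · exact hP3 h
    · rw [one_mul]
      exact hP2 (Nat.not_even_iff_odd.mp h)
  choose! P hP1 hP2 using h5
  refine ⟨∑ u ∈ U \ W, P u, isPal_sum _ hP1, fun k => ?_⟩
  have h6 : PowerSeries.mk (fun k => (hat A s k).eval (Nat.card F : ℂ)) =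
      ((∑ u ∈ U \ W, P u : ℂ[X]) : PowerSeries ℂ) + PowerSeries.C (Nat.card F : ℂ) * L := by
    rw [h1, ← Finset.sum_sdiff hWU, h4, Finset.sum_congr rfl hP2]
    congr 1
    exact (map_sum (Polynomial.coeToPowerSeries.ringHom) _ _).symm
  have h7 := congrArg (PowerSeries.coeff k) h6
  rw [map_add, PowerSeries.coeff_C_mul, PowerSeries.coeff_mk, hL, PowerSeries.coeff_mk,
    Polynomial.coeff_coe] at h7
  rw [h7]
  ring

end

/-- The palindromic part cancels from each defect e of the functional equation, leaving e(q) = q^M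
e(1/q) with M one more than the total degree. Dominance is exactly what rules this out. -/
theorem SatisfiesAxioms.stableFE_of_lt (hH : SatisfiesAxioms Γ H c) {i : V} {a : V →₀ ℕ}
    (hr : restDeg i a ≠ 0) (ih : ∀ b, restDeg i b < restDeg i a → StableFE Γ c i b) :
    StableFE Γ c i a := by
  set A := nbrDeg Γ i a with hA
  set t := hat A (fun k => c (a.update i k)) with ht
  have key : ∀ n : ℕ, n ≠ 0 → ∃ P : ℂ[X], IsPal ((5 : ℂ) ^ n) (A / 2) P ∧ ∀ k,
      (t k).eval ((5 : ℂ) ^ n) = ((5 : ℂ) ^ n) ^ (restDeg i a + k + 1) *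
        (t k).eval ((5 : ℂ) ^ n)⁻¹ + P.coeff k := by
    intro n hn
    obtain ⟨F, _, _, hF, hq⟩ := exists_field_card n hn
    have := hH.exists_isPal hq hr ih
    have hcast : (Nat.card F : ℂ) = (5 : ℂ) ^ n := by
      rw [hF]
      push_cast
      rfl
    rwa [hcast] at this
  have hsym : ∀ k, k ≤ A / 2 → t (2 * (A / 2) - k) = X ^ (A / 2 - k) * t k := by
    intro k hk
    rcases hk.eq_or_lt with rfl | hlt
    · rw [Nat.sub_self, pow_zero, one_mul]
      congr 1
      omega
    -- Since k < A / 2, this gives total degree at least 2, as dominance requires.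
    have hle := nbrDeg_le_restDeg Γ i a
    set m := A / 2 with hm
    rw [← sub_eq_zero]
    refine eq_zero_of_dominant (M := restDeg i a + (2 * m - k) + 1) ?_ ?_
    · intro d hd
      rw [coeff_sub] at hd
      by_cases h1 : (t (2 * m - k)).coeff d = 0
      · rw [h1, zero_sub, neg_ne_zero, coeff_X_pow_mul'] at hd
        split_ifs at hd with h2
        · have := hH.hat_dominance A (i := i) (a := a) (k := k) (by omega) hd
          omega
        · exact absurd rfl hd
      · exact hH.hat_dominance A (i := i) (a := a) (by omega) h1
    · intro n hn
      obtain ⟨P, hP, h1⟩ := key n hn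
      have hq0 : ((5 : ℂ) ^ n) ≠ 0 := pow_ne_zero _ (by norm_num)
      set q := (5 : ℂ) ^ n
      have h2 := hP.2 (2 * m - k) k (by omega)
      have h3 : P.coeff (2 * m - k) = q ^ (m - k) * P.coeff k := by
        refine mul_left_cancel₀ (pow_ne_zero k hq0) ?_
        rw [h2, ← mul_assoc, ← pow_add]
        congr 2
        omega
      rw [eval_sub, eval_sub, eval_mul, eval_mul, eval_pow, eval_pow, eval_X, eval_X, h1, h1, h3,
        inv_pow]
      have h4 : q ^ (restDeg i a + (2 * m - k) + 1) =
          q ^ (m - k) * q ^ (m - k) * q ^ (restDeg i a + k + 1) := by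
        rw [← pow_add, ← pow_add]
        congr 1
        omega
      have h5 := pow_ne_zero (m - k) hq0
      rw [h4]
      field_simp
      ring
  constructor
  · intro k hk
    refine eq_zero_of_dominant (M := restDeg i a + k + 1)
      (fun d hd => hH.hat_dominance A (i := i) (a := a) (by omega) hd) fun n hn => ?_
    obtain ⟨P, hP, h1⟩ := key n hn
    rw [← ht, h1 k, coeff_eq_zero_of_natDegree_lt (hP.1.trans_lt hk), add_zero]
  · intro j k hjk
    rcases le_or_gt k (A / 2) with hk | hk
    · have := hsym k hk
      rw [show 2 * (A / 2) - k = j by omega] at this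
      rw [← ht, this, ← mul_assoc, ← pow_add]
      congr 2
      omega
    · have := hsym j (by omega)
      rw [show 2 * (A / 2) - j = k by omega] at this
      rw [← ht, this, ← mul_assoc, ← pow_add]
      congr 2
      omega

theorem SatisfiesAxioms.stableFE (hH : SatisfiesAxioms Γ H c) (i : V) (a : V →₀ ℕ) :
    StableFE Γ c i a := by
  induction h : restDeg i a using Nat.strong_induction_on generalizing a with
  | _ r ih =>
    subst h
    -- Base case: only x_i is present, and the series is 1 / (1 - X x_i).
    by_cases hr : restDeg i a = 0
    · have hA : nbrDeg Γ i a = 0 := by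
        have := nbrDeg_le_restDeg Γ i a
        omega
      rw [StableFE, hA]
      constructor
      · intro k hk
        obtain ⟨k, rfl⟩ : ∃ l, k = l + 1 := ⟨k - 1, by omega⟩
        rw [hat, if_pos (by decide), hH.eq_X_pow hr, hH.eq_X_pow hr, pow_succ', sub_self]
      · intro j k hjk
        obtain ⟨rfl, rfl⟩ : j = 0 ∧ k = 0 := by omega
        rfl
    · exact hH.stableFE_of_lt hr fun b hb => ih _ hb b rfl

end Stability

end

end AffineMDS

open scoped Polynomial

namespace AffineMDS

noncomputable section

/-! ### The residue -/

section Residue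

variable {V : Type*} [Fintype V] [DecidableEq V] {A : Type*} [CommRing A]

theorem coeff_update_linear_mul (q : A) (i : V) (z : MvPowerSeries V A) (m : V →₀ ℕ) (k : ℕ) :
    MvPowerSeries.coeff (m.update i (k + 1))
        ((1 - MvPowerSeries.C q * MvPowerSeries.X i) * z) =
      MvPowerSeries.coeff (m.update i (k + 1)) z - q * MvPowerSeries.coeff (m.update i k) z := by
  have h : m.update i (k + 1) = Finsupp.single i 1 + m.update i k := by
    ext j
    rw [Finsupp.add_apply, Finsupp.update_apply, Finsupp.update_apply, Finsupp.single_apply]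
    by_cases hj : j = i
    · subst hj
      simp [add_comm]
    · rw [if_neg hj, if_neg hj, if_neg (Ne.symm hj), zero_add]
  rw [sub_mul, one_mul, mul_assoc, map_sub, MvPowerSeries.coeff_C_mul]
  congr 2
  rw [h, MvPowerSeries.X, MvPowerSeries.coeff_add_monomial_mul, one_mul]

theorem coeff_update_zero_linear_mul (q : A) (i : V) (z : MvPowerSeries V A) (m : V →₀ ℕ) :
    MvPowerSeries.coeff (m.update i 0)
        ((1 - MvPowerSeries.C q * MvPowerSeries.X i) * z) =
      MvPowerSeries.coeff (m.update i 0) z := by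
  rw [sub_mul, one_mul, mul_assoc, map_sub, MvPowerSeries.coeff_C_mul, MvPowerSeries.X,
    MvPowerSeries.coeff_monomial_mul, if_neg, mul_zero, sub_zero]
  intro h
  have := h i
  simp at this

/-- Telescoping in one variable. -/
theorem sum_coeff_linear_mul {q q' : A} (hq : q * q' = 1) (i : V) (z : MvPowerSeries V A)
    (m : V →₀ ℕ) (N : ℕ) :
    ∑ k ∈ Finset.range (N + 1), MvPowerSeries.coeff (m.update i k)
        ((1 - MvPowerSeries.C q * MvPowerSeries.X i) * z) * q' ^ k =
      MvPowerSeries.coeff (m.update i N) z * q' ^ N := by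
  induction N with
  | zero => simp [coeff_update_zero_linear_mul]
  | succ N ih =>
    rw [Finset.sum_range_succ, ih, coeff_update_linear_mul, pow_succ]
    linear_combination - MvPowerSeries.coeff (m.update i N) z * q' ^ N * hq

/-- The functions that are at most `N` on `U` and agree with `m` elsewhere. -/
def box (U : Finset V) (N m : V → ℕ) : Finset (V → ℕ) :=
  Fintype.piFinset fun i => if i ∈ U then Finset.range (N i + 1) else {m i}

theorem mem_box {U : Finset V} {N m f : V → ℕ} :
    f ∈ box U N m ↔ ∀ i, (i ∈ U → f i ≤ N i) ∧ (i ∉ U → f i = m i) := by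
  rw [box, Fintype.mem_piFinset]
  refine forall_congr' fun i => ?_
  split_ifs with h <;> simp [h]

/-- Telescoping in one variable after another leaves only the top corner of the box. -/
theorem sum_box_coeff {q q' : A} (hq : q * q' = 1) (U : Finset V) (N : V → ℕ) :
    ∀ (z : MvPowerSeries V A) (m : V → ℕ), ∑ f ∈ box U N m,
        MvPowerSeries.coeff (Finsupp.equivFunOnFinite.symm f)
          ((∏ i ∈ U, (1 - MvPowerSeries.C q * MvPowerSeries.X i)) * z) * ∏ i ∈ U, q' ^ f i =
      MvPowerSeries.coeff (Finsupp.equivFunOnFinite.symm fun i => if i ∈ U then N i else m i) z *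
        ∏ i ∈ U, q' ^ N i := by
  induction U using Finset.induction_on with
  | empty =>
    intro z m
    have : box ∅ N m = {m} := by
      ext f
      rw [mem_box, Finset.mem_singleton, funext_iff]
      simp
    simp [this]
  | insert i U hi ih =>
    intro z m
    rw [← Finset.sum_fiberwise_of_maps_to (t := Finset.range (N i + 1)) (g := fun f => f i)]
    swap
    · intro f hf
      rw [mem_box] at hf
      exact Finset.mem_range.mpr (Nat.lt_succ_of_le ((hf i).1 (Finset.mem_insert_self _ _)))
    have h1 : ∀ k ∈ Finset.range (N i + 1),
        (box (insert i U) N m).filter (fun f => f i = k) = box U N (Function.update m i k) := by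
      intro k hk
      rw [Finset.mem_range, Nat.lt_succ_iff] at hk
      ext f
      rw [Finset.mem_filter, mem_box, mem_box]
      constructor
      · rintro ⟨h1, h2⟩ j
        refine ⟨fun hj => (h1 j).1 (Finset.mem_insert_of_mem hj), fun hj => ?_⟩
        rw [Function.update_apply]
        split_ifs with hji
        · rw [hji, h2]
        · exact (h1 j).2 (by simp [hj, hji])
      · intro h
        have h2 := (h i).2 hi
        rw [Function.update_self] at h2
        refine ⟨fun j => ⟨fun hj => ?_, fun hj => ?_⟩, h2⟩
        · rcases Finset.mem_insert.mp hj with rfl | hj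
          · rwa [h2]
          · exact (h j).1 hj
        · rw [Finset.mem_insert, not_or] at hj
          rw [(h j).2 hj.2, Function.update_of_ne hj.1]
    have h2 : ∀ k ∈ Finset.range (N i + 1),
        ∑ f ∈ (box (insert i U) N m).filter (fun f => f i = k),
          MvPowerSeries.coeff (Finsupp.equivFunOnFinite.symm f)
            ((∏ i ∈ insert i U, (1 - MvPowerSeries.C q * MvPowerSeries.X i)) * z) *
            ∏ i ∈ insert i U, q' ^ f i =
        MvPowerSeries.coeff ((Finsupp.equivFunOnFinite.symm fun j => if j ∈ U then N j else
          m j).update i k) ((1 - MvPowerSeries.C q * MvPowerSeries.X i) * z) * q' ^ k *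
          ∏ i ∈ U, q' ^ N i := by
      intro k hk
      have e1 : (Finsupp.equivFunOnFinite.symm fun j => if j ∈ U then N j else m j).update i k =
          Finsupp.equivFunOnFinite.symm fun j => if j ∈ U then N j else
            Function.update m i k j := by
        ext j
        rw [Finsupp.update_apply]
        simp only [Finsupp.equivFunOnFinite_symm_apply_apply, Function.update_apply]
        by_cases hj : j = i
        · subst hj
          simp [hi]
        · simp [hj]
      rw [h1 k hk, e1, mul_right_comm, ← ih, Finset.sum_mul]
      refine Finset.sum_congr rfl fun f hf => ?_
      have h3 := ((mem_box.mp hf) i).2 hi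
      rw [Function.update_self] at h3
      rw [Finset.prod_insert hi, Finset.prod_insert hi, h3,
        mul_comm (1 - MvPowerSeries.C q * MvPowerSeries.X i), mul_assoc (∏ i ∈ U, _)]
      ring
    rw [Finset.sum_congr rfl h2, ← Finset.sum_mul, sum_coeff_linear_mul hq,
      Finset.prod_insert hi, mul_assoc]
    congr 2
    congr 1
    ext j
    rw [Finsupp.update_apply]
    simp only [Finsupp.equivFunOnFinite_symm_apply_apply, Finset.mem_insert]
    by_cases hj : j = i
    · subst hj
      simp
    · simp [hj]

variable (Γ : SimpleGraph V) [DecidableRel Γ.Adj]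

theorem nbrDeg_update {i j : V} (h : ¬ Γ.Adj i j) (m : V →₀ ℕ) (k : ℕ) :
    nbrDeg Γ i (m.update j k) = nbrDeg Γ i m := by
  refine Finset.sum_congr rfl fun l hl => ?_
  rw [Finsupp.update_apply, if_neg]
  rintro rfl
  exact h (Finset.mem_filter.mp hl).2

/-- In the variable `xᵢ`, the only pole of `z` is a simple one at `q⁻¹`, with a bound on the
degree of the polynomial part. -/
def PoleAt (q : A) (i : V) (z : MvPowerSeries V A) : Prop :=
  ∀ (m : V →₀ ℕ) (k : ℕ), nbrDeg Γ i m ≤ k →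
    MvPowerSeries.coeff (m.update i (k + 1)) z = q * MvPowerSeries.coeff (m.update i k) z

variable {Γ}

theorem update_update_comm (m : V →₀ ℕ) {i j : V} (h : i ≠ j) (k l : ℕ) :
    (m.update i k).update j l = (m.update j l).update i k := by
  ext x
  simp only [Finsupp.update_apply]
  split_ifs with h1 h2
  · exact absurd (h2.symm.trans h1) h
  all_goals rfl

/-- Changing the exponent of a vertex not adjacent to i leaves A(i) alone, so clearing the pole
there does not disturb the recursion in x_i. -/
theorem PoleAt.linear_mul {q : A} {i : V} {z : MvPowerSeries V A} (h : PoleAt Γ q i z) {j : V}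
    (hij : ¬ Γ.Adj i j) (hne : i ≠ j) :
    PoleAt Γ q i ((1 - MvPowerSeries.C q * MvPowerSeries.X j) * z) := by
  intro m k hk
  have e : m = m.update j (m j) := (Finsupp.update_self m j).symm
  have hk' : ∀ l, nbrDeg Γ i (m.update j l) ≤ k := fun l => by rwa [nbrDeg_update Γ hij]
  rw [e, update_update_comm _ hne.symm, update_update_comm _ hne.symm]
  cases m j with
  | zero =>
    rw [coeff_update_zero_linear_mul, coeff_update_zero_linear_mul,
      ← update_update_comm _ hne.symm, ← update_update_comm _ hne.symm, h _ _ (hk' _)]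
  | succ l =>
    rw [coeff_update_linear_mul, coeff_update_linear_mul,
      ← update_update_comm _ hne.symm, ← update_update_comm _ hne.symm,
      ← update_update_comm _ hne.symm, ← update_update_comm _ hne.symm, h _ _ (hk' _),
      h _ _ (hk' _)]
    ring

theorem PoleAt.prod_mul {q : A} {i : V} {z : MvPowerSeries V A} (h : PoleAt Γ q i z)
    (U : Finset V) (hU : ∀ j ∈ U, ¬ Γ.Adj i j ∧ i ≠ j) :
    PoleAt Γ q i ((∏ j ∈ U, (1 - MvPowerSeries.C q * MvPowerSeries.X j)) * z) := by
  induction U using Finset.induction_on with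
  | empty => simpa using h
  | insert j U hj ih =>
    rw [Finset.prod_insert hj, mul_assoc]
    have := hU j (Finset.mem_insert_self _ _)
    exact (ih fun l hl => hU l (Finset.mem_insert_of_mem hl)).linear_mul this.1 this.2

variable {S : Finset V}

theorem nbrDeg_glueExp (hS : ∀ i j, Γ.Adj i j → (i ∈ S ↔ j ∉ S)) {i : V} (hi : i ∉ S) (a : S →₀ ℕ) (b : {i // i ∉ S} →₀ ℕ) :
    nbrDeg Γ i (glueExp S a b) = nbrSum Γ S a i := by
  symm
  refine Finset.sum_bij (fun j _ => j.1) ?_ ?_ ?_ ?_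
  · intro j hj
    simpa using hj
  · intro j _ l _ h
    exact Subtype.ext h
  · intro j hj
    have hj' := (Finset.mem_filter.mp hj).2
    refine ⟨⟨j, ?_⟩, by simpa using hj', rfl⟩
    by_contra h
    exact hi ((hS i j hj').mpr h)
  · intro j _
    simp [glueExp]

theorem coeff_clearPoles_ne_zero (hS : ∀ i j, Γ.Adj i j → (i ∈ S ↔ j ∉ S))
    {q : A} {z : MvPowerSeries V A}
    (hz : ∀ i, i ∉ S → PoleAt Γ q i z) {a : S →₀ ℕ} {b : {i // i ∉ S} →₀ ℕ}
    (h : MvPowerSeries.coeff (glueExp S a b) (clearPoles q S z) ≠ 0) (i : {i // i ∉ S}) :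
    b i ≤ nbrSum Γ S a i := by
  by_contra hlt
  push Not at hlt
  refine h ?_
  have hi : i.1 ∈ Sᶜ := Finset.mem_compl.mpr i.2
  have hb : glueExp S a b i = b i := by simp [glueExp, i.2]
  have e : glueExp S a b = (glueExp S a b).update i ((b i - 1) + 1) := by
    rw [show b i - 1 + 1 = b i by omega, ← hb, Finsupp.update_self]
  rw [clearPoles, ← Finset.mul_prod_erase _ _ hi, mul_assoc, e, coeff_update_linear_mul]
  refine sub_eq_zero.mpr ((hz i i.2).prod_mul _ (fun j hj => ?_) _ _ ?_)
  · rw [Finset.mem_erase, Finset.mem_compl] at hj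
    exact ⟨fun h => i.2 ((hS _ _ h).mpr hj.2), hj.1.symm⟩
  · rw [nbrDeg_glueExp hS i.2]
    omega

theorem residueExists_of_poleAt (hS : ∀ i j, Γ.Adj i j → (i ∈ S ↔ j ∉ S))
    {q : A} {z : MvPowerSeries V A}
    (hz : ∀ i, i ∉ S → PoleAt Γ q i z) : ResidueExists q S z := by
  intro a
  refine (Set.finite_Iic (Finsupp.equivFunOnFinite.symm
    fun i : {i // i ∉ S} => nbrSum Γ S a i)).subset fun b hb i => ?_
  exact coeff_clearPoles_ne_zero hS hz hb i

/-- Double counting of edges, each of which has exactly one end in S. -/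
theorem sum_nbrSum (hS : ∀ i j, Γ.Adj i j → (i ∈ S ↔ j ∉ S)) (a : S →₀ ℕ) :
    ∑ i ∈ Sᶜ, nbrSum Γ S a i = ∑ j : S, a j * Γ.degree j := by
  simp only [nbrSum]
  rw [Finset.sum_congr rfl fun i _ => Finset.sum_filter _ _, Finset.sum_comm]
  refine Finset.sum_congr rfl fun j _ => ?_
  rw [← Finset.sum_filter, Finset.sum_const, smul_eq_mul, mul_comm, ← Γ.card_neighborFinset_eq_degree]
  congr 2
  ext i
  rw [Finset.mem_filter, Finset.mem_compl, SimpleGraph.mem_neighborFinset, Γ.adj_comm]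
  exact ⟨fun h => h.2, fun h => ⟨(hS _ _ h).mp j.2, h⟩⟩

/-- After clearing, coefficients vanish once some b_i exceeds A(i). The evaluation is therefore a
sum over the box b ≤ A, which telescopes to its corner, the exponent a'. -/
theorem coeff_residue (hS : ∀ i j, Γ.Adj i j → (i ∈ S ↔ j ∉ S))
    {q q' : A} (hq : q * q' = 1) {z : MvPowerSeries V A}
    (hz : ∀ i, i ∉ S → PoleAt Γ q i z) (a : S →₀ ℕ) :
    MvPowerSeries.coeff a (residue q q' S z) =
      MvPowerSeries.coeff (extendExp Γ S a) z * q' ^ (∑ i : S, a i * Γ.degree i) := by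
  classical
  set N : V → ℕ := fun i => nbrSum Γ S a i with hN
  set m : V → ℕ := ⇑(extendExp Γ S a) with hm
  let g : (V → ℕ) → ({i // i ∉ S} →₀ ℕ) := fun f =>
    Finsupp.equivFunOnFinite.symm fun i => f i
  have hg : ∀ f ∈ box Sᶜ N m, glueExp S a (g f) = Finsupp.equivFunOnFinite.symm f := by
    intro f hf
    ext i
    simp only [glueExp, Finsupp.equivFunOnFinite_symm_apply_apply, g]
    split_ifs with hi
    · rw [((mem_box.mp hf) i).2 (by simpa using hi), hm]
      simp [extendExp, hi]
    · rfl
  have h1 : MvPowerSeries.coeff a (residue q q' S z) = ∑ b ∈ (box Sᶜ N m).image g,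
      MvPowerSeries.coeff (glueExp S a b) (clearPoles q S z) * ∏ i, q' ^ b i := by
    refine finsum_eq_sum_of_support_subset _ fun b hb => ?_
    have hb' := coeff_clearPoles_ne_zero hS hz (left_ne_zero_of_mul hb)
    refine Finset.mem_coe.mpr (Finset.mem_image.mpr ⟨glueExp S a b, mem_box.mpr fun i =>
      ⟨fun hi => ?_, fun hi => ?_⟩, ?_⟩)
    · have hi' := Finset.mem_compl.mp hi
      simpa [glueExp, hi'] using hb' ⟨i, hi'⟩
    · have hi' : i ∈ S := by simpa using hi
      simp [glueExp, hm, extendExp, hi']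
    · ext i
      simp [g, glueExp, i.2]
  have hinj : Set.InjOn g (box Sᶜ N m) := by
    intro f hf f' hf' h
    have h2 := hg f hf
    rw [h, hg f' hf'] at h2
    exact (Finsupp.equivFunOnFinite.symm.injective h2).symm
  rw [h1, Finset.sum_image hinj]
  have h3 := sum_box_coeff hq Sᶜ N z m
  have h4 : (Finsupp.equivFunOnFinite.symm fun i => if i ∈ Sᶜ then N i else m i) =
      extendExp Γ S a := by
    ext i
    by_cases hi : i ∈ S <;> simp [hN, hm, hi, extendExp]
  rw [h4, Finset.prod_pow_eq_pow_sum, sum_nbrSum hS] at h3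
  rw [← h3]
  refine Finset.sum_congr rfl fun f hf => ?_
  rw [hg f hf, clearPoles]
  congr 1
  exact (Finset.prod_subtype Sᶜ (by simp) (fun i => q' ^ f i)).symm

variable {H : Weights V} {c : (V →₀ ℕ) → ℂ[X]}

/-- For even A(i) this is the vanishing of `hat` beyond degree A(i). For odd A(i) both sides are
zero, the series being a polynomial of degree at most A(i) - 1. -/
theorem SatisfiesAxioms.update_succ (hH : SatisfiesAxioms Γ H c) {i : V} {m : V →₀ ℕ} {k : ℕ}
    (hk : nbrDeg Γ i m ≤ k) : c (m.update i (k + 1)) = Polynomial.X * c (m.update i k) := by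
  have h := (hH.stableFE i m).1
  rcases Nat.even_or_odd (nbrDeg Γ i m) with he | ho
  · have := h (k + 1) (by omega)
    rw [hat, if_pos he, sub_eq_zero] at this
    exact this
  · rw [hat_of_odd ho] at h
    have : 2 * (nbrDeg Γ i m / 2) < k := by
      obtain ⟨l, hl⟩ := ho
      omega
    rw [h k this, h (k + 1) (by omega), mul_zero]

theorem SatisfiesAxioms.eq_zero_of_odd (hH : SatisfiesAxioms Γ H c) {i : V} {m : V →₀ ℕ}
    (ho : Odd (nbrDeg Γ i m)) (hm : nbrDeg Γ i m = m i) : c m = 0 := by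
  have h := (hH.stableFE i m).1 (m i)
  rw [hat_of_odd ho, Finsupp.update_self] at h
  refine h ?_
  obtain ⟨l, hl⟩ := ho
  omega

theorem SatisfiesAxioms.poleAt (hH : SatisfiesAxioms Γ H c) {F : Type} [Field F] [Finite F]
    (hq : Nat.card F % 4 = 1) (i : V) : PoleAt Γ (Nat.card F : ℂ) i (Z H F) := by
  intro m k hk
  rw [hH.coeff_eq F hq, hH.coeff_eq F hq, hH.update_succ hk, Polynomial.eval_mul,
    Polynomial.eval_X]

theorem SatisfiesAxioms.formal_poleAt (hH : SatisfiesAxioms Γ H c) (i : V) :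
    PoleAt Γ (LaurentPolynomial.T 1) i (formalZ c) := by
  intro m k hk
  change Polynomial.toLaurent _ = _ * Polynomial.toLaurent _
  rw [hH.update_succ hk, map_mul, Polynomial.toLaurent_X]

theorem SatisfiesAxioms.even_of_ne_zero (hS : ∀ i j, Γ.Adj i j → (i ∈ S ↔ j ∉ S))
    (hH : SatisfiesAxioms Γ H c) {a : S →₀ ℕ} (h : c (extendExp Γ S a) ≠ 0) {i : V}
    (hi : i ∉ S) : Even (nbrSum Γ S a i) := by
  by_contra ho
  rw [Nat.not_even_iff_odd] at ho
  have e : extendExp Γ S a = glueExp S a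
      (Finsupp.equivFunOnFinite.symm fun i : {i // i ∉ S} => nbrSum Γ S a i) := rfl
  have h1 : nbrDeg Γ i (extendExp Γ S a) = nbrSum Γ S a i := by
    rw [e, nbrDeg_glueExp hS hi]
  refine h (hH.eq_zero_of_odd (i := i) (by rwa [h1]) ?_)
  rw [h1]
  simp [extendExp, hi]

end Residue

end

end AffineMDS

open scoped Polynomial

namespace AffineMDS

noncomputable section

/-! ### The residue as a sum over tuples of polynomials -/

section ResidueSum

open Polynomial

theorem coe_sqrt_sq (q : ℕ) : ((Real.sqrt q : ℝ) : ℂ) ^ 2 = q := by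
  rw [← Complex.ofReal_pow, Real.sq_sqrt (Nat.cast_nonneg q), Complex.ofReal_natCast]

/-- The coefficient is ∑ Q_j q^(2n - j), and palindromicity rewrites each term as q^n Q_(2n - j). -/
theorem IsPal.coeff_mul_geometric {q : ℂ} {n : ℕ} {Q : ℂ[X]} (hQ : IsPal q n Q)
    {f : PowerSeries ℂ} (hf : (1 - PowerSeries.C q * PowerSeries.X) * f = 1) :
    PowerSeries.coeff (2 * n) ((Q : PowerSeries ℂ) * f) = q ^ n * Q.eval 1 := by
  have h0 : ∀ k, PowerSeries.coeff k f = q ^ k := by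
    intro k
    have h1 : ∀ k, PowerSeries.coeff (k + 1) f = q * PowerSeries.coeff k f := by
      intro k
      have := congrArg (PowerSeries.coeff (k + 1)) hf
      rw [sub_mul, one_mul, mul_assoc, map_sub, PowerSeries.coeff_C_mul,
        PowerSeries.coeff_succ_X_mul, PowerSeries.coeff_one, if_neg k.succ_ne_zero] at this
      exact sub_eq_zero.mp this
    induction k with
    | zero =>
      have := congrArg (PowerSeries.coeff 0) hf
      simpa [sub_mul, mul_assoc] using this
    | succ k ih => rw [h1, ih, pow_succ']
  rw [PowerSeries.coeff_mul, Finset.Nat.sum_antidiagonal_eq_sum_range_succ_mk,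
    Polynomial.eval_eq_sum_range' (Nat.lt_succ_of_le hQ.1), Finset.mul_sum,
    ← Finset.sum_range_reflect (fun k => q ^ n * (Q.coeff k * 1 ^ k))]
  refine Finset.sum_congr rfl fun k hk => ?_
  rw [Finset.mem_range] at hk
  rw [h0, Polynomial.coeff_coe, one_pow, mul_one, show 2 * n + 1 - 1 - k = 2 * n - k by omega,
    ← hQ.2 k (2 * n - k) (by omega), mul_comm]

variable {V : Type*} [Fintype V] [DecidableEq V] {Γ : SimpleGraph V} [DecidableRel Γ.Adj]

/-- For D₀ = 1 the series is Q times the zeta function, with coefficient q^n Q(1) at degree 2n. For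
D₀ ≠ 1 it is a polynomial of degree less than that of the product over the neighbours, so the
coefficient vanishes, as does the weight. -/
theorem IsTwisted.sum_monics {F : Type*} [Field F] [Finite F] {h : (V → F[X]) → ℂ}
    (hh : IsTwisted Γ h) (hq : Nat.card F % 4 = 1) {i : V} {u : V → F[X]}
    (hu : ∀ j, (u j).Monic) (hi : u i = 1)
    (hloc : ∀ p : F[X], p.Monic → Irreducible p → p ∣ ∏ j, u j →
      LocalFE ((Nat.card F : ℂ) ^ p.natDegree) (∑ j with Γ.Adj i j, multiplicity p (u j))
        (localWeight h i u p)) :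
    ∑ g ∈ monics F (nbrs Γ i u).natDegree, h (Function.update u i g) =
        ((Real.sqrt (Nat.card F) : ℝ) : ℂ) ^ (nbrs Γ i u).natDegree *
          h (Function.update u i (nbrs Γ i u)) ∧
      (h (Function.update u i (nbrs Γ i u)) ≠ 0 → IsSquare (nbrs Γ i u)) := by
  obtain ⟨D₀, s, Q, n, k1, k2, k3, k4, k5, k6, k7, k8, k9⟩ :=
    hh.exists_vertexSeries_eq hq u hu hi hloc 1 monic_one isCoprime_one_left
  have hsum : ∑ g ∈ monics F (nbrs Γ i u).natDegree, h (Function.update u i g) =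
      PowerSeries.coeff (nbrs Γ i u).natDegree (vertexSeries h i u 1) := by
    rw [vertexSeries, monicSeries, PowerSeries.coeff_mk]
    refine Finset.sum_congr rfl fun g _ => ?_
    rw [residueSymbol_one_right]
    simp
  rw [hsum, k7, one_mul]
  by_cases hD : D₀ = 1
  · constructor
    · rw [k5, hD, natDegree_one, zero_add, k6.coeff_mul_geometric symbolSeries_one, k8 hD rfl,
        pow_mul, coe_sqrt_sq]
    · intro _
      rw [k4, hD, one_mul, sq]
      exact IsSquare.mul_self s
  · refine ⟨?_, fun h0 => absurd (k9 hD) h0⟩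
    rw [k9 hD, mul_zero]
    have hD0 : D₀.natDegree ≠ 0 := fun h0 => hD (k1.natDegree_eq_zero.mp h0)
    rcases Nat.even_or_odd D₀.natDegree with ⟨m, hm⟩ | ⟨m, hm⟩
    · obtain ⟨P, hP, hP'⟩ := symbolSeries_even hq k1 k2 (m := m - 1) (by omega)
      rw [hP', ← Polynomial.coe_mul, Polynomial.coeff_coe]
      refine coeff_eq_zero_of_natDegree_lt ?_
      have h1 : (1 - X : ℂ[X]).natDegree ≤ 1 := by compute_degree
      have h2 := natDegree_mul_le (p := Q) (q := (1 - X) * P)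
      have h3 := natDegree_mul_le (p := 1 - X) (q := P)
      have h4 := hP.1
      have h5 := k6.1
      omega
    · obtain ⟨P, hP, hP'⟩ := symbolSeries_odd hq k1 k2 hm
      rw [hP', ← Polynomial.coe_mul, Polynomial.coeff_coe]
      refine coeff_eq_zero_of_natDegree_lt ?_
      have h2 := natDegree_mul_le (p := Q) (q := P)
      have h4 := hP.1
      have h5 := k6.1
      omega

variable {H : Weights V} {c : (V →₀ ℕ) → ℂ[X]} {F : Type} [Field F] [Finite F]

theorem SatisfiesAxioms.sum_monics (hH : SatisfiesAxioms Γ H c) (hq : Nat.card F % 4 = 1) {i : V}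
    {u : V → F[X]} (hu : ∀ j, (u j).Monic) :
    ∑ g ∈ monics F (nbrs Γ i u).natDegree, H F (Function.update u i g) =
        ((Real.sqrt (Nat.card F) : ℝ) : ℂ) ^ (nbrs Γ i u).natDegree *
          H F (Function.update u i (nbrs Γ i u)) ∧
      (H F (Function.update u i (nbrs Γ i u)) ≠ 0 → IsSquare (nbrs Γ i u)) := by
  have h1 : nbrs Γ i (Function.update u i 1) = nbrs Γ i u := by
    refine Finset.prod_congr rfl fun j hj => ?_
    rw [Function.update_of_ne (Finset.mem_filter.mp hj).2.ne']
  have h2 := (hH.isTwisted F hq).sum_monics hq (i := i) (u := Function.update u i 1) (fun j => by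
      rw [Function.update_apply]
      split_ifs
      · exact monic_one
      · exact hu j) (by simp) fun p hp hirr _ =>
    hH.localFE (hH.stableFE i (Finsupp.equivFunOnFinite.symm fun j =>
      multiplicity p (Function.update u i 1 j))) F hq hp hirr
  rw [h1] at h2
  simpa only [Function.update_idem] using h2

/-- The tuples of monic polynomials of degrees `N` on `U` that agree with `w` elsewhere. -/
def polyBox (U : Finset V) (N : V → ℕ) (w : V → F[X]) : Finset (V → F[X]) :=
  Fintype.piFinset fun i => if i ∈ U then monics F (N i) else {w i}

theorem mem_polyBox {U : Finset V} {N : V → ℕ} {w f : V → F[X]} : f ∈ polyBox U N w ↔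
    ∀ i, (i ∈ U → (f i).Monic ∧ (f i).natDegree = N i) ∧ (i ∉ U → f i = w i) := by
  rw [polyBox, Fintype.mem_piFinset]
  refine forall_congr' fun i => ?_
  split_ifs with h <;> simp [h, mem_monics]

/-- The vertices of U are summed out one at a time; as U contains no edges, changing one entry does
not affect the neighbour products of the others. -/
theorem SatisfiesAxioms.sum_polyBox (hH : SatisfiesAxioms Γ H c) (hq : Nat.card F % 4 = 1)
    (U : Finset V) (hU : ∀ i ∈ U, ∀ j ∈ U, ¬ Γ.Adj i j) : ∀ w : V → F[X], (∀ j, (w j).Monic) →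
      ∑ f ∈ polyBox U (fun i => (nbrs Γ i w).natDegree) w, H F f =
        ((Real.sqrt (Nat.card F) : ℝ) : ℂ) ^ (∑ i ∈ U, (nbrs Γ i w).natDegree) *
          H F (fun i => if i ∈ U then nbrs Γ i w else w i) := by
  classical
  induction U using Finset.induction_on with
  | empty =>
    intro w _
    have : polyBox ∅ (fun i => (nbrs Γ i w).natDegree) w = {w} := by
      ext f
      rw [mem_polyBox, Finset.mem_singleton, funext_iff]
      simp
    simp [this]
  | insert i U hi ih =>
    intro w hw
    have hU' : ∀ j ∈ insert i U, ¬ Γ.Adj j i := fun j hj => hU j hj i (Finset.mem_insert_self _ _)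
    have hN : ∀ g, ∀ j ∈ insert i U, nbrs Γ j (Function.update w i g) = nbrs Γ j w := by
      intro g j hj
      refine Finset.prod_congr rfl fun l hl => ?_
      rw [Function.update_of_ne]
      rintro rfl
      exact hU' j hj (Finset.mem_filter.mp hl).2
    rw [← Finset.sum_fiberwise_of_maps_to (t := monics F (nbrs Γ i w).natDegree)
      (g := fun f => f i)]
    swap
    · intro f hf
      exact mem_monics.mpr (((mem_polyBox.mp hf) i).1 (Finset.mem_insert_self _ _))
    set v : V → F[X] := fun j => if j ∈ U then nbrs Γ j w else w j with hv
    have h2 : ∀ g ∈ monics F (nbrs Γ i w).natDegree,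
        ∑ f ∈ (polyBox (insert i U) (fun i => (nbrs Γ i w).natDegree) w).filter
          (fun f => f i = g), H F f =
        ((Real.sqrt (Nat.card F) : ℝ) : ℂ) ^ (∑ i ∈ U, (nbrs Γ i w).natDegree) *
          H F (Function.update v i g) := by
      intro g hg
      rw [mem_monics] at hg
      have h3 := ih (fun j hj l hl => hU j (Finset.mem_insert_of_mem hj) l
        (Finset.mem_insert_of_mem hl)) (Function.update w i g) fun j => by
          rw [Function.update_apply]
          split_ifs
          · exact hg.1
          · exact hw j
      rw [Finset.sum_congr rfl fun j hj => congrArg natDegree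
        (hN g j (Finset.mem_insert_of_mem hj))] at h3
      have h4 : (fun j => if j ∈ U then nbrs Γ j (Function.update w i g) else
          Function.update w i g j) = Function.update v i g := by
        funext j
        by_cases hj : j = i
        · subst hj
          simp [hi]
        · rw [Function.update_of_ne hj, Function.update_of_ne hj, hv]
          simp only
          split_ifs with hjU
          · exact hN g j (Finset.mem_insert_of_mem hjU)
          · rfl
      rw [h4] at h3
      rw [← h3]
      refine Finset.sum_congr ?_ fun _ _ => rfl
      ext f
      rw [Finset.mem_filter, mem_polyBox, mem_polyBox]
      constructor
      · rintro ⟨h5, h6⟩ j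
        refine ⟨fun hj => ?_, fun hj => ?_⟩
        · rw [hN g j (Finset.mem_insert_of_mem hj)]
          exact (h5 j).1 (Finset.mem_insert_of_mem hj)
        · rw [Function.update_apply]
          split_ifs with hji
          · rw [hji, h6]
          · exact (h5 j).2 (by simp [hj, hji])
      · intro h
        have h6 := (h i).2 hi
        rw [Function.update_self] at h6
        refine ⟨fun j => ⟨fun hj => ?_, fun hj => ?_⟩, h6⟩
        · rcases Finset.mem_insert.mp hj with rfl | hj'
          · rwa [h6]
          · rw [← hN g j hj]
            exact (h j).1 hj'
        · rw [Finset.mem_insert, not_or] at hj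
          rw [(h j).2 hj.2, Function.update_of_ne hj.1]
    have hvm : ∀ j, (v j).Monic := by
      intro j
      rw [hv]
      simp only
      split_ifs
      · exact nbrs_monic hw
      · exact hw j
    have hvi : nbrs Γ i v = nbrs Γ i w := by
      refine Finset.prod_congr rfl fun l hl => ?_
      rw [hv]
      simp only
      rw [if_neg]
      intro hlU
      exact hU' l (Finset.mem_insert_of_mem hlU) (Finset.mem_filter.mp hl).2.symm
    have h7 := (hH.sum_monics hq hvm (i := i)).1
    rw [hvi] at h7
    rw [Finset.sum_congr rfl h2, ← Finset.mul_sum, h7, Finset.sum_insert hi, pow_add]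
    have h8 : (fun j => if j ∈ insert i U then nbrs Γ j w else w j) =
        Function.update v i (nbrs Γ i w) := by
      funext j
      by_cases hj : j = i
      · subst hj
        simp
      · simp [hj, hv]
    rw [h8]
    ring

variable {S : Finset V}

theorem extendPoly_monic {f : S → F[X]} (hf : ∀ i, (f i).Monic) (i : V) :
    (extendPoly Γ S f i).Monic := by
  rw [extendPoly]
  split_ifs
  · exact hf _
  · exact monic_prod_of_monic _ _ fun j _ => hf j

theorem nbrs_of_eq (hS : ∀ i j, Γ.Adj i j → (i ∈ S ↔ j ∉ S)) {i : V} (hi : i ∉ S)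
    {w : V → F[X]} {f : S → F[X]} (h : ∀ j : S, w j = f j) : nbrs Γ i w = nbrProd Γ S f i := by
  symm
  refine Finset.prod_bij (fun j _ => j.1) ?_ ?_ ?_ ?_
  · intro j hj
    simpa using hj
  · intro j _ l _ h
    exact Subtype.ext h
  · intro j hj
    have hj' := (Finset.mem_filter.mp hj).2
    refine ⟨⟨j, ?_⟩, by simpa using hj', rfl⟩
    by_contra h
    exact hi ((hS i j hj').mpr h)
  · intro j _
    exact (h j).symm

theorem nbrs_extendPoly (hS : ∀ i j, Γ.Adj i j → (i ∈ S ↔ j ∉ S)) {i : V} (hi : i ∉ S)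
    (f : S → F[X]) : nbrs Γ i (extendPoly Γ S f) = nbrProd Γ S f i :=
  nbrs_of_eq hS hi fun j => by simp [extendPoly]

theorem natDegree_nbrProd {f : S → F[X]} {a : S →₀ ℕ}
    (hf : ∀ i, (f i).Monic ∧ (f i).natDegree = a i) (i : V) :
    (nbrProd Γ S f i).natDegree = nbrSum Γ S a i := by
  rw [nbrProd, natDegree_prod_of_monic _ _ fun j _ => (hf j).1]
  exact Finset.sum_congr rfl fun j _ => (hf j).2

theorem SatisfiesAxioms.isSquare_nbrProd (hS : ∀ i j, Γ.Adj i j → (i ∈ S ↔ j ∉ S))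
    (hH : SatisfiesAxioms Γ H c) (hq : Nat.card F % 4 = 1) {f : S → F[X]}
    (hf : ∀ i, (f i).Monic) (h : H F (extendPoly Γ S f) ≠ 0) {i : V} (hi : i ∉ S) :
    IsSquare (nbrProd Γ S f i) := by
  have h1 := (hH.sum_monics hq (extendPoly_monic (Γ := Γ) hf) (i := i)).2
  rw [nbrs_extendPoly hS hi] at h1
  refine h1 ?_
  have e : nbrProd Γ S f i = extendPoly Γ S f i := by simp [extendPoly, hi]
  rwa [e, Function.update_eq_self]

theorem SatisfiesAxioms.eval_extendExp (hS : ∀ i j, Γ.Adj i j → (i ∈ S ↔ j ∉ S))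
    (hH : SatisfiesAxioms Γ H c) (hq : Nat.card F % 4 = 1) (a : S →₀ ℕ) :
    (c (extendExp Γ S a)).eval (Nat.card F : ℂ) =
      ((Real.sqrt (Nat.card F) : ℝ) : ℂ) ^ (∑ i : S, a i * Γ.degree i) *
        ∑ f ∈ tuples F a, H F (extendPoly Γ S f) := by
  classical
  rw [hH.coeff_tuples F hq, ← Finset.sum_fiberwise_of_maps_to (t := tuples F a)
    (g := fun f (i : S) => f i), Finset.mul_sum]
  swap
  · intro f hf
    rw [mem_tuples] at hf ⊢
    intro i
    have := hf i
    simpa [extendExp] using this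
  refine Finset.sum_congr rfl fun f hf => ?_
  rw [mem_tuples] at hf
  have h1 := hH.sum_polyBox hq Sᶜ (fun i hi j hj hij => (Finset.mem_compl.mp hi)
    ((hS i j hij).mpr (Finset.mem_compl.mp hj))) (extendPoly Γ S f)
    (extendPoly_monic fun i => (hf i).1)
  have h2 : ∀ i ∈ Sᶜ, (nbrs Γ i (extendPoly Γ S f)).natDegree = nbrSum Γ S a i := fun i hi => by
    rw [nbrs_extendPoly hS (Finset.mem_compl.mp hi), natDegree_nbrProd hf]
  rw [Finset.sum_congr rfl h2, sum_nbrSum hS] at h1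
  have h3 : (fun i => if i ∈ Sᶜ then nbrs Γ i (extendPoly Γ S f) else extendPoly Γ S f i) =
      extendPoly Γ S f := by
    funext i
    split_ifs with hi
    · rw [nbrs_extendPoly hS (Finset.mem_compl.mp hi)]
      simp [extendPoly, Finset.mem_compl.mp hi]
    · rfl
  rw [h3] at h1
  rw [← h1]
  refine Finset.sum_congr ?_ fun _ _ => rfl
  ext v
  rw [Finset.mem_filter, mem_tuples, mem_polyBox]
  constructor
  · rintro ⟨h4, h5⟩ i
    refine ⟨fun hi => ?_, fun hi => ?_⟩
    · rw [h2 i hi]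
      have := h4 i
      simpa [extendExp, Finset.mem_compl.mp hi] using this
    · have hi' : i ∈ S := by simpa using hi
      have := congrFun h5 ⟨i, hi'⟩
      simpa [extendPoly, hi'] using this
  · intro h4
    have h5 : ∀ i : S, v i = f i := fun i => by
      have := (h4 i).2 (by simp)
      simpa [extendPoly] using this
    refine ⟨fun i => ?_, funext h5⟩
    by_cases hi : i ∈ S
    · have := hf ⟨i, hi⟩
      rw [← h5 ⟨i, hi⟩] at this
      simpa [extendExp, hi] using this
    · have := (h4 i).1 (Finset.mem_compl.mpr hi)
      rw [h2 i (Finset.mem_compl.mpr hi)] at this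
      simpa [extendExp, hi] using this

/-- With N = ∑ a_i N(i), the sums over T produce q^(N/2) and the residue q^(-N), which leaves
q^(-N/2). -/
theorem SatisfiesAxioms.residue_eq_degreeSeries (hS : ∀ i j, Γ.Adj i j → (i ∈ S ↔ j ∉ S))
    (hH : SatisfiesAxioms Γ H c) (hq : Nat.card F % 4 = 1) :
    residue (Nat.card F : ℂ) (Nat.card F : ℂ)⁻¹ S (Z H F) =
      degreeSeries F (fun f : S → F[X] =>
        H F (extendPoly Γ S f) * ∏ i : S, sqrtWeight Γ (Nat.card F) i ^ (f i).natDegree) := by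
  have hq0 : (Nat.card F : ℂ) ≠ 0 := by
    rw [Nat.cast_ne_zero]
    omega
  have hs := coe_sqrt_sq (Nat.card F)
  have hs0 : ((Real.sqrt (Nat.card F) : ℝ) : ℂ) ≠ 0 := by
    intro h
    rw [h, zero_pow two_ne_zero] at hs
    exact hq0 hs.symm
  ext a
  rw [coeff_residue hS (mul_inv_cancel₀ hq0) (fun i _ => hH.poleAt hq i), hH.coeff_eq F hq,
    hH.eval_extendExp hS hq, coeff_degreeSeries]
  have h1 : ∀ f ∈ tuples F a, H F (extendPoly Γ S f) *
      ∏ i : S, sqrtWeight Γ (Nat.card F) i ^ (f i).natDegree =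
      H F (extendPoly Γ S f) *
        ((Real.sqrt (Nat.card F) : ℝ) : ℂ)⁻¹ ^ (∑ i : S, a i * Γ.degree i) := by
    intro f hf
    rw [mem_tuples] at hf
    rw [← Finset.prod_pow_eq_pow_sum]
    congr 1
    refine Finset.prod_congr rfl fun i _ => ?_
    rw [(hf i).2, sqrtWeight, ← pow_mul, mul_comm]
  rw [Finset.sum_congr rfl h1, ← Finset.sum_mul, ← hs]
  generalize (∑ i : S, a i * Γ.degree i) = N
  rw [inv_pow, inv_pow, ← pow_mul, two_mul, pow_add]
  field_simp

/-- If both weights are nonzero, their entries at T are squares. Every edge has an end in T, so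
every symbol in the twist has a square argument and equals 1. Otherwise both sides vanish. -/
theorem SatisfiesAxioms.extendPoly_mul (hS : ∀ i j, Γ.Adj i j → (i ∈ S ↔ j ∉ S))
    (hH : SatisfiesAxioms Γ H c) (hq : Nat.card F % 4 = 1) {f g : S → F[X]}
    (hf : ∀ i, (f i).Monic) (hg : ∀ i, (g i).Monic) (hfg : IsCoprime (∏ i, f i) (∏ i, g i)) :
    H F (extendPoly Γ S (fun i => f i * g i)) =
      H F (extendPoly Γ S f) * H F (extendPoly Γ S g) := by
  have hf' := extendPoly_monic (Γ := Γ) hf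
  have hg' := extendPoly_monic (Γ := Γ) hg
  have hcf : ∀ (i : S) (j : S), IsCoprime (f i) (g j) := fun i j =>
    (hfg.of_isCoprime_of_dvd_left
      (Finset.dvd_prod_of_mem _ (Finset.mem_univ i))).of_isCoprime_of_dvd_right
        (Finset.dvd_prod_of_mem _ (Finset.mem_univ j))
  have hc : ∀ i j, IsCoprime (extendPoly Γ S f i) (extendPoly Γ S g j) := by
    intro i j
    rw [extendPoly, extendPoly]
    split_ifs
    · exact hcf _ _
    · exact IsCoprime.prod_right fun l _ => hcf _ l
    · exact IsCoprime.prod_left fun k _ => hcf k _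
    · exact IsCoprime.prod_left fun k _ => IsCoprime.prod_right fun l _ => hcf k l
  have e : extendPoly Γ S (fun i => f i * g i) =
      fun i => extendPoly Γ S f i * extendPoly Γ S g i := by
    funext i
    rw [extendPoly, extendPoly, extendPoly]
    split_ifs
    · rfl
    · exact Finset.prod_mul_distrib
  rw [e, hH.twisted_mul F hq _ _ hf' hg'
    (IsCoprime.prod_left fun i _ => IsCoprime.prod_right fun j _ => hc i j)]
  by_cases h1 : H F (extendPoly Γ S f) = 0
  · rw [h1, zero_mul, zero_mul]
  by_cases h2 : H F (extendPoly Γ S g) = 0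
  · rw [h2, mul_zero, zero_mul]
  rw [Finset.prod_eq_one fun i _ => Finset.prod_eq_one fun j hij => ?_, mul_one]
  have hadj := (Finset.mem_filter.mp hij).2
  have hij' := hc i j
  suffices h : residueSymbol (extendPoly Γ S f i) (extendPoly Γ S g j) = 1 by
    rw [h, Int.cast_one]
  by_cases hi : i ∈ S
  · have hj := (hS i j hadj).mp hi
    obtain ⟨s, hs⟩ := hH.isSquare_nbrProd hS hq hg h2 hj
    have hs' : extendPoly Γ S g j = s * s := by
      rw [← hs]
      simp [extendPoly, hj]
    rw [residueSymbol_comm hq (hf' i) (hg' j), hs', residueSymbol_mul_left hq _ _ (hf' i), ← sq]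
    rw [hs'] at hij'
    exact residueSymbol_sq hq (hf' i) (hij'.of_mul_right_left).symm
  · obtain ⟨s, hs⟩ := hH.isSquare_nbrProd hS hq hf h1 hi
    have hs' : extendPoly Γ S f i = s * s := by
      rw [← hs]
      simp [extendPoly, hi]
    rw [hs', residueSymbol_mul_left hq _ _ (hg' j), ← sq]
    rw [hs'] at hij'
    exact residueSymbol_sq hq (hg' j) hij'.of_mul_left_left

end ResidueSum

end

end AffineMDS

open scoped Polynomial

namespace AffineMDS

noncomputable section

/-! ### The Euler product -/

section EulerProduct

open Polynomial

variable {V : Type*} [Fintype V] [DecidableEq V] {Γ : SimpleGraph V} [DecidableRel Γ.Adj]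
  {H : Weights V} {c : (V →₀ ℕ) → ℂ[X]} {F : Type} [Field F] [Finite F] {S : Finset V}

theorem extendPoly_pow (p : F[X]) (a : S →₀ ℕ) :
    extendPoly Γ S (fun i => p ^ a i) = fun i => p ^ extendExp Γ S a i := by
  funext i
  rw [extendPoly]
  by_cases hi : i ∈ S
  · simp [hi, extendExp]
  · simp [hi, extendExp, nbrProd, nbrSum, Finset.prod_pow_eq_pow_sum]

/-- The summand of the residue at a tuple of monic polynomials. -/
def residueWeight (Γ : SimpleGraph V) [DecidableRel Γ.Adj] (H : Weights V) (S : Finset V)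
    (f : S → F[X]) : ℂ :=
  H F (extendPoly Γ S f) * ∏ i : S, sqrtWeight Γ (Nat.card F) i ^ (f i).natDegree

theorem eulerFactor_eq_dilate {p : F[X]} (hp : p.Monic) : eulerFactor Γ H S F p =
    dilate p.natDegree (fun a => residueWeight Γ H S fun i => p ^ a i) := by
  funext m
  rw [eulerFactor, dilate]
  by_cases h : ∀ i, p.natDegree ∣ m i
  · rw [if_pos h, if_pos h, residueWeight, extendPoly_pow]
    congr 1
    refine Finset.prod_congr rfl fun i _ => ?_
    rw [hp.natDegree_pow, Finsupp.mapRange_apply, Nat.div_mul_cancel (h i)]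
  · rw [if_neg h, if_neg h]

theorem SatisfiesAxioms.residueWeight_mul (hS : ∀ i j, Γ.Adj i j → (i ∈ S ↔ j ∉ S))
    (hH : SatisfiesAxioms Γ H c) (hq : Nat.card F % 4 = 1) {f g : S → F[X]}
    (hf : ∀ i, (f i).Monic) (hg : ∀ i, (g i).Monic) (hfg : IsCoprime (∏ i, f i) (∏ i, g i)) :
    residueWeight Γ H S (fun i => f i * g i) =
      residueWeight Γ H S f * residueWeight Γ H S g := by
  rw [residueWeight, hH.extendPoly_mul hS hq hf hg hfg,
    Finset.prod_congr rfl fun i _ => by rw [(hf i).natDegree_mul (hg i), pow_add],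
    Finset.prod_mul_distrib, residueWeight, residueWeight]
  ring

open Classical in
theorem SatisfiesAxioms.degreeSeries_eq_prod_mul (hS : ∀ i j, Γ.Adj i j → (i ∈ S ↔ j ∉ S))
    (hH : SatisfiesAxioms Γ H c) (hq : Nat.card F % 4 = 1)
    (s : Finset {p : F[X] // p.Monic ∧ Irreducible p}) :
    degreeSeries F (residueWeight Γ H S) = (∏ p ∈ s, eulerFactor Γ H S F p.1) *
      degreeSeries F (fun f => if ∀ p ∈ s, ∀ i, ¬ p.1 ∣ f i then residueWeight Γ H S f else 0) := by
  induction s using Finset.induction_on with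
  | empty => simp
  | insert p s hps ih =>
    obtain ⟨hp, hirr⟩ := p.2
    rw [ih, degreeSeries_eq_dilate_mul hp hirr
      (α := fun a => residueWeight Γ H S fun i => p.1 ^ a i)
      (φ' := fun f => if ∀ p ∈ s, ∀ i, ¬ p.1 ∣ f i then residueWeight Γ H S f else 0)]
    · rw [← eulerFactor_eq_dilate hp, Finset.prod_insert hps,
        mul_comm (eulerFactor Γ H S F p.1) (∏ p ∈ s, _), mul_assoc]
      refine congrArg (fun w => _ * (_ * degreeSeries F w)) (funext fun f => ?_)
      simp only [Finset.forall_mem_insert]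
      split_ifs <;> first | rfl | (exfalso; tauto)
    · intro a f hf hpf
      have h1 : (∀ p' ∈ s, ∀ i, ¬ p'.1 ∣ p.1 ^ a i * f i) ↔ ∀ p' ∈ s, ∀ i, ¬ p'.1 ∣ f i := by
        refine forall₂_congr fun p' hp' => forall_congr' fun i => not_congr ⟨fun h => ?_, fun h =>
          Dvd.dvd.mul_left h _⟩
        rcases p'.2.2.prime.dvd_or_dvd h with h2 | h2
        · have h3 := p'.2.2.prime.dvd_of_dvd_pow h2
          have h4 : p' = p := Subtype.ext
            (eq_of_monic_of_associated p'.2.1 hp (p'.2.2.associated_of_dvd hirr h3))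
          rw [h4] at hp'
          exact absurd hp' hps
        · exact h2
      simp only [h1]
      split_ifs
      · refine hH.residueWeight_mul hS hq (fun i => hp.pow _) hf ?_
        exact IsCoprime.prod_left fun i _ => IsCoprime.prod_right fun j _ =>
          isCoprime_pow_of_not_dvd hirr (hpf j) _
      · rw [mul_zero]

theorem finite_primes_natDegree_le (N : ℕ) :
    {p : {p : F[X] // p.Monic ∧ Irreducible p} | p.1.natDegree ≤ N}.Finite := by
  classical
  refine Set.Finite.of_finite_image (f := Subtype.val) ?_ Subtype.val_injective.injOn
  refine ((Finset.range (N + 1)).biUnion fun k => monics F k).finite_toSet.subset ?_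
  rintro _ ⟨p, hp, rfl⟩
  rw [Finset.mem_coe, Finset.mem_biUnion]
  exact ⟨p.1.natDegree, Finset.mem_range.mpr (Nat.lt_succ_of_le hp),
    mem_monics.mpr ⟨p.2.1, rfl⟩⟩

theorem SatisfiesAxioms.residueWeight_one [Nonempty V] (hH : SatisfiesAxioms Γ H c)
    (hq : Nat.card F % 4 = 1) : residueWeight Γ H S (fun _ => (1 : F[X])) = 1 := by
  have i : V := Classical.arbitrary V
  have h := hH.initial F hq i 1 monic_one
  rw [Pi.mulSingle_one] at h
  have e : extendPoly Γ S (fun _ => (1 : F[X])) = 1 := by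
    funext j
    simp [extendPoly, nbrProd]
  rw [residueWeight, e, h]
  simp

/-- Once all primes of degree at most |m| are split off, every nontrivial tuple prime to them has
too large a degree to affect the coefficient at m. -/
theorem SatisfiesAxioms.formalHasProd_eulerFactor [Nonempty V]
    (hS : ∀ i j, Γ.Adj i j → (i ∈ S ↔ j ∉ S))
    (hH : SatisfiesAxioms Γ H c) (hq : Nat.card F % 4 = 1) :
    FormalHasProd (fun p : {p : F[X] // p.Monic ∧ Irreducible p} => eulerFactor Γ H S F p.1)
      (degreeSeries F (residueWeight Γ H S)) := by
  classical
  intro m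
  rw [Filter.eventually_atTop]
  refine ⟨(finite_primes_natDegree_le (F := F) (m.sum fun _ k => k)).toFinset, fun s hs => ?_⟩
  rw [hH.degreeSeries_eq_prod_mul hS hq s, MvPowerSeries.coeff_mul,
    Finset.sum_eq_single_of_mem (m, 0) (by simp)]
  · rw [coeff_degreeSeries, Finset.sum_eq_single_of_mem (fun _ => 1), if_pos,
      hH.residueWeight_one hq, mul_one]
    · intro p _ _ h
      exact p.2.2.not_isUnit (isUnit_of_dvd_one h)
    · rw [mem_tuples]
      simp
    · intro f hf hne
      rw [mem_tuples] at hf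
      exact absurd (funext fun i => (hf i).1.natDegree_eq_zero.mp (hf i).2) hne
  · rintro ⟨b, n⟩ hbn hne
    rw [Finset.HasAntidiagonal.mem_antidiagonal] at hbn
    simp only at hbn
    have hn : n ≠ 0 := by
      rintro rfl
      rw [add_zero] at hbn
      exact hne (by rw [hbn])
    rw [coeff_degreeSeries, Finset.sum_eq_zero, mul_zero]
    intro f hf
    rw [mem_tuples] at hf
    rw [if_neg]
    intro h
    obtain ⟨i, hi⟩ : ∃ i, n i ≠ 0 := by
      by_contra h0
      push Not at h0
      exact hn (Finsupp.ext h0)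
    have hu : ¬ IsUnit (f i) := by
      intro hu
      rw [(hf i).1.isUnit_iff] at hu
      have := (hf i).2
      rw [hu, natDegree_one] at this
      exact hi this.symm
    obtain ⟨p, hp, hirr, hdvd⟩ := exists_monic_irreducible_factor (f i) hu
    refine h ⟨p, hp, hirr⟩ (hs ?_) i hdvd
    rw [Set.Finite.mem_toFinset]
    change p.natDegree ≤ _
    have h1 := natDegree_le_of_dvd hdvd (hf i).1.ne_zero
    have h2 : n i ≤ m i := by
      rw [← hbn]
      simp
    have h3 : m i ≤ m.sum fun _ k => k := by
      rw [Finsupp.sum_fintype _ _ fun _ => rfl]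
      exact Finset.single_le_sum (f := fun j => m j) (fun _ _ => Nat.zero_le _)
        (Finset.mem_univ i)
    rw [(hf i).2] at h1
    exact h1.trans (h2.trans h3)

theorem IsAffineDiagram.nonempty {V : Type*} {Γ : SimpleGraph V} (h : IsAffineDiagram Γ) :
    Nonempty V := by
  rcases h with ⟨n, _, ⟨e⟩⟩ | ⟨n, _, ⟨e⟩⟩ | ⟨⟨e⟩⟩ | ⟨⟨e⟩⟩ | ⟨⟨e⟩⟩
  all_goals exact ⟨e.symm 0⟩

end EulerProduct

end

end AffineMDS

open scoped Polynomial

namespace AffineMDS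

noncomputable section

/-! ### Factorizations of formal power series -/

section Factorization

variable {σ : Type*} {A B : Type*} [CommRing A] [CommRing B] [Algebra ℂ A] [Algebra ℂ B]

/-- The coefficients of `(1 - y)^{-l}`. -/
def binomialCoeff (l : ℂ) (k : ℕ) : ℂ := (ascPochhammer ℂ k).eval l / (k.factorial : ℂ)

theorem binomialCoeff_zero (l : ℂ) : binomialCoeff l 0 = 1 := by simp [binomialCoeff]

theorem binomialCoeff_one (l : ℂ) : binomialCoeff l 1 = l := by simp [binomialCoeff]

open Classical in
/-- The power series `(1 - c x^ν)^{-l}`, for `ν ≠ 0`. -/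
def powerFactor (c : A) (ν : σ →₀ ℕ) (l : ℂ) : MvPowerSeries σ A :=
  fun m => ∑ k ∈ Finset.range (m.degree + 1),
    if m = k • ν then algebraMap ℂ A (binomialCoeff l k) * c ^ k else 0

theorem binomialFactor_eq (μ : ℤ) (ν : σ →₀ ℕ) (l : ℂ) :
    binomialFactor μ ν l = powerFactor (LaurentPolynomial.T μ) ν l := by
  funext m
  rw [binomialFactor, powerFactor]
  refine Finset.sum_congr rfl fun k _ => ?_
  rw [LaurentPolynomial.T_pow]
  rfl

theorem map_powerFactor (φ : A →ₐ[ℂ] B) (c : A) (ν : σ →₀ ℕ) (l : ℂ) :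
    MvPowerSeries.map φ.toRingHom (powerFactor c ν l) = powerFactor (φ c) ν l := by
  ext m
  rw [MvPowerSeries.coeff_map, MvPowerSeries.coeff_apply, MvPowerSeries.coeff_apply, powerFactor,
    powerFactor, map_sum]
  refine Finset.sum_congr rfl fun k _ => ?_
  split_ifs
  · simp
  · simp

theorem degree_pos_of_ne_zero {ν : σ →₀ ℕ} (hν : ν ≠ 0) : 0 < ν.degree := by
  rw [Nat.pos_iff_ne_zero]
  exact fun h => hν ((Finsupp.degree_eq_zero_iff ν).mp h)

theorem nsmul_left_injective_of_ne_zero {ν : σ →₀ ℕ} (hν : ν ≠ 0) {j k : ℕ}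
    (h : j • ν = k • ν) : j = k := by
  have h1 := congrArg Finsupp.degree h
  rw [map_nsmul, map_nsmul, smul_eq_mul, smul_eq_mul] at h1
  exact Nat.eq_of_mul_eq_mul_right (degree_pos_of_ne_zero hν) h1

theorem coeff_nsmul_powerFactor (c : A) {ν : σ →₀ ℕ} (hν : ν ≠ 0) (l : ℂ) (k : ℕ) :
    MvPowerSeries.coeff (k • ν) (powerFactor c ν l) =
      algebraMap ℂ A (binomialCoeff l k) * c ^ k := by
  rw [MvPowerSeries.coeff_apply, powerFactor, Finset.sum_eq_single_of_mem k, if_pos rfl]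
  · rw [Finset.mem_range, map_nsmul, smul_eq_mul]
    exact Nat.lt_succ_of_le (Nat.le_mul_of_pos_right _ (degree_pos_of_ne_zero hν))
  · intro j _ hj
    rw [if_neg]
    exact fun h => hj (nsmul_left_injective_of_ne_zero hν h).symm

theorem coeff_powerFactor_eq_zero (c : A) {ν : σ →₀ ℕ} (l : ℂ) {m : σ →₀ ℕ}
    (hm : ∀ k : ℕ, m ≠ k • ν) : MvPowerSeries.coeff m (powerFactor c ν l) = 0 := by
  rw [MvPowerSeries.coeff_apply, powerFactor]
  exact Finset.sum_eq_zero fun k _ => if_neg (hm k)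

theorem coeff_zero_powerFactor (c : A) {ν : σ →₀ ℕ} (hν : ν ≠ 0) (l : ℂ) :
    MvPowerSeries.coeff 0 (powerFactor c ν l) = 1 := by
  have := coeff_nsmul_powerFactor c hν l 0
  rwa [zero_smul, binomialCoeff_zero, map_one, pow_zero, mul_one] at this

theorem coeff_self_powerFactor (c : A) {ν : σ →₀ ℕ} (hν : ν ≠ 0) (l : ℂ) :
    MvPowerSeries.coeff ν (powerFactor c ν l) = algebraMap ℂ A l * c := by
  have := coeff_nsmul_powerFactor c hν l 1
  rwa [one_smul, binomialCoeff_one, pow_one] at this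

theorem powerFactor_zero (c : A) {ν : σ →₀ ℕ} (hν : ν ≠ 0) : powerFactor c ν 0 = 1 := by
  classical
  ext m
  rw [MvPowerSeries.coeff_one]
  split_ifs with h
  · rw [h, coeff_zero_powerFactor c hν]
  · by_cases h1 : ∃ k : ℕ, m = k • ν
    · obtain ⟨k, rfl⟩ := h1
      rw [coeff_nsmul_powerFactor c hν]
      cases k with
      | zero => simp at h
      | succ k => simp [binomialCoeff]
    · push Not at h1
      exact coeff_powerFactor_eq_zero c 0 h1

/-! #### Agreement up to a given degree -/

/-- The coefficients of `f` and `g` agree in degrees up to `d`. -/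
def AgreeTo (d : ℕ) (f g : MvPowerSeries σ A) : Prop :=
  ∀ n : σ →₀ ℕ, n.degree ≤ d → MvPowerSeries.coeff n f = MvPowerSeries.coeff n g

theorem AgreeTo.refl (d : ℕ) (f : MvPowerSeries σ A) : AgreeTo d f f := fun _ _ => rfl

theorem AgreeTo.symm {d : ℕ} {f g : MvPowerSeries σ A} (h : AgreeTo d f g) : AgreeTo d g f :=
  fun n hn => (h n hn).symm

theorem AgreeTo.trans {d : ℕ} {f g k : MvPowerSeries σ A} (h : AgreeTo d f g)
    (h' : AgreeTo d g k) : AgreeTo d f k := fun n hn => (h n hn).trans (h' n hn)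

theorem AgreeTo.mul {d : ℕ} {f g f' g' : MvPowerSeries σ A} (h : AgreeTo d f g)
    (h' : AgreeTo d f' g') : AgreeTo d (f * f') (g * g') := by
  classical
  intro n hn
  rw [MvPowerSeries.coeff_mul, MvPowerSeries.coeff_mul]
  refine Finset.sum_congr rfl fun x hx => ?_
  rw [Finset.HasAntidiagonal.mem_antidiagonal] at hx
  have h1 := congrArg Finsupp.degree hx
  rw [map_add] at h1
  rw [h _ (by omega), h' _ (by omega)]

theorem AgreeTo.prod {ι : Type*} {d : ℕ} (s : Finset ι) {f g : ι → MvPowerSeries σ A}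
    (h : ∀ i ∈ s, AgreeTo d (f i) (g i)) : AgreeTo d (∏ i ∈ s, f i) (∏ i ∈ s, g i) := by
  classical
  induction s using Finset.induction_on with
  | empty => exact AgreeTo.refl _ _
  | insert a s ha ih =>
    rw [Finset.prod_insert ha, Finset.prod_insert ha]
    exact (h a (Finset.mem_insert_self _ _)).mul
      (ih fun i hi => h i (Finset.mem_insert_of_mem hi))

theorem AgreeTo.map {d : ℕ} {f g : MvPowerSeries σ A} (h : AgreeTo d f g) (φ : A →+* B) :
    AgreeTo d (MvPowerSeries.map φ f) (MvPowerSeries.map φ g) := by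
  intro n hn
  rw [MvPowerSeries.coeff_map, MvPowerSeries.coeff_map, h n hn]

/-! #### Existence and uniqueness -/

/-- The indices of the factors. -/
abbrev FactorIndex (σ : Type*) : Type _ := ℤ × {ν : σ →₀ ℕ // ν ≠ 0}

/-- The factor `(1 - q^μ x^ν)^{-lam(μ, ν)}`. -/
def factor (lam : FactorIndex σ → ℂ) (k : FactorIndex σ) :
    MvPowerSeries σ (LaurentPolynomial ℂ) :=
  powerFactor (LaurentPolynomial.T k.1) k.2.1 (lam k)

theorem coeff_zero_prod_factor (lam : FactorIndex σ → ℂ) (s : Finset (FactorIndex σ)) :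
    MvPowerSeries.coeff 0 (∏ k ∈ s, factor lam k) = 1 := by
  rw [MvPowerSeries.coeff_zero_eq_constantCoeff, map_prod]
  refine Finset.prod_eq_one fun k _ => ?_
  rw [← MvPowerSeries.coeff_zero_eq_constantCoeff]
  exact coeff_zero_powerFactor _ k.2.2 _

open Classical in
-- If |ν| ≥ d, the multiples kν with k ≥ 2 have degree beyond d, so only the linear term of the
-- binomial series is seen.
theorem coeff_factor_sub {d : ℕ} {lam lam' : FactorIndex σ → ℂ} {k : FactorIndex σ}
    (h : k.2.1.degree < d → lam k = lam' k) {m : σ →₀ ℕ} (hm : m.degree ≤ d) :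
    MvPowerSeries.coeff m (factor lam k) - MvPowerSeries.coeff m (factor lam' k) =
      if k.2.1 = m then LaurentPolynomial.C (lam k - lam' k) * LaurentPolynomial.T k.1 else 0 := by
  obtain ⟨μ, ν, hν⟩ := k
  rw [factor, factor]
  simp only at h ⊢
  split_ifs with h1
  · rw [← h1, coeff_self_powerFactor _ hν, coeff_self_powerFactor _ hν, ← sub_mul, ← map_sub]
    rfl
  · rcases lt_or_ge ν.degree d with h2 | h2
    · rw [h h2, sub_self]
    · by_cases h3 : ∃ k : ℕ, m = k • ν
      · obtain ⟨k, rfl⟩ := h3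
        have h4 : k = 0 := by
          rw [map_nsmul, smul_eq_mul] at hm
          have h5 := degree_pos_of_ne_zero hν
          rcases Nat.lt_or_ge 1 k with hk | hk
          · have : 2 * ν.degree ≤ k * ν.degree := Nat.mul_le_mul_right _ hk
            omega
          · rcases Nat.le_one_iff_eq_zero_or_eq_one.mp hk with rfl | rfl
            · rfl
            · exact absurd (one_smul _ _).symm h1
        rw [h4, zero_smul, coeff_zero_powerFactor _ hν, coeff_zero_powerFactor _ hν, sub_self]
      · push Not at h3
        rw [coeff_powerFactor_eq_zero _ _ h3, coeff_powerFactor_eq_zero _ _ h3, sub_self]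

open Classical in
-- First-order perturbation: all factors have constant term 1, so changes of the exponents in degree
-- d add up in the coefficients of degree d. Both existence and uniqueness of the factorization rest
-- on this.
theorem coeff_prod_factor_sub {d : ℕ} {lam lam' : FactorIndex σ → ℂ} (s : Finset (FactorIndex σ))
    (h : ∀ k ∈ s, k.2.1.degree < d → lam k = lam' k) {m : σ →₀ ℕ} (hm : m.degree ≤ d) :
    MvPowerSeries.coeff m (∏ k ∈ s, factor lam k) -
        MvPowerSeries.coeff m (∏ k ∈ s, factor lam' k) =
      ∑ k ∈ s, if k.2.1 = m then LaurentPolynomial.C (lam k - lam' k) * LaurentPolynomial.T k.1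
        else 0 := by
  induction s using Finset.induction_on generalizing m with
  | empty => simp
  | insert k s hk ih =>
    have ih' := fun {m : σ →₀ ℕ} (hm : m.degree ≤ d) =>
      ih (fun k hk => h k (Finset.mem_insert_of_mem hk)) hm
    have h0 := h k (Finset.mem_insert_self _ _)
    have hz1 : ∀ n : σ →₀ ℕ, n.degree < d →
        MvPowerSeries.coeff n (factor lam k) = MvPowerSeries.coeff n (factor lam' k) := by
      intro n hn
      rw [← sub_eq_zero, coeff_factor_sub h0 hn.le]
      split_ifs with h1
      · rw [h0 (by rwa [h1]), sub_self, map_zero, zero_mul]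
      · rfl
    have hz2 : ∀ n : σ →₀ ℕ, n.degree < d → MvPowerSeries.coeff n (∏ k ∈ s, factor lam k) =
        MvPowerSeries.coeff n (∏ k ∈ s, factor lam' k) := by
      intro n hn
      rw [← sub_eq_zero, ih' hn.le]
      refine Finset.sum_eq_zero fun l hl => ?_
      split_ifs with h1
      · rw [h l (Finset.mem_insert_of_mem hl) (by rwa [h1]), sub_self, map_zero, zero_mul]
      · rfl
    rw [Finset.prod_insert hk, Finset.prod_insert hk, Finset.sum_insert hk,
      ← coeff_factor_sub h0 hm, ← ih' hm]
    have key : ∀ f f' g g' : MvPowerSeries σ (LaurentPolynomial ℂ),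
        (∀ n : σ →₀ ℕ, n.degree < d → MvPowerSeries.coeff n f = MvPowerSeries.coeff n f') →
        (∀ n : σ →₀ ℕ, n.degree < d → MvPowerSeries.coeff n g = MvPowerSeries.coeff n g') →
        MvPowerSeries.coeff 0 g = 1 → MvPowerSeries.coeff 0 f' = 1 →
        MvPowerSeries.coeff m (f * g) - MvPowerSeries.coeff m (f' * g') =
          (MvPowerSeries.coeff m f - MvPowerSeries.coeff m f') +
            (MvPowerSeries.coeff m g - MvPowerSeries.coeff m g') := by
      intro f f' g g' hf hg hg0 hf0
      rw [show MvPowerSeries.coeff m (f * g) - MvPowerSeries.coeff m (f' * g') =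
        MvPowerSeries.coeff m ((f - f') * g) + MvPowerSeries.coeff m (f' * (g - g')) by
          rw [sub_mul, mul_sub, map_sub, map_sub]
          ring, MvPowerSeries.coeff_mul, MvPowerSeries.coeff_mul,
        Finset.sum_eq_single_of_mem (m, 0) (by simp), Finset.sum_eq_single_of_mem (0, m) (by simp)]
      · simp only
        rw [hg0, hf0, mul_one, one_mul, map_sub, map_sub]
      · rintro ⟨a, b⟩ hab hne
        rw [Finset.HasAntidiagonal.mem_antidiagonal] at hab
        simp only at hab
        have h1 := congrArg Finsupp.degree hab
        rw [map_add] at h1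
        have h2 : a ≠ 0 := by
          rintro rfl
          rw [zero_add] at hab
          exact hne (by rw [hab])
        have h3 := degree_pos_of_ne_zero h2
        rw [map_sub, hg b (by omega), sub_self, mul_zero]
      · rintro ⟨a, b⟩ hab hne
        rw [Finset.HasAntidiagonal.mem_antidiagonal] at hab
        simp only at hab
        have h1 := congrArg Finsupp.degree hab
        rw [map_add] at h1
        have h2 : b ≠ 0 := by
          rintro rfl
          rw [add_zero] at hab
          exact hne (by rw [hab])
        have h3 := degree_pos_of_ne_zero h2
        rw [map_sub, hf a (by omega), sub_self, zero_mul]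
    exact key _ _ _ _ hz1 hz2 (coeff_zero_prod_factor _ _) (coeff_zero_powerFactor _ k.2.2 _)

open Classical in
theorem coeff_sum_C_mul_T (s : Finset (FactorIndex σ)) (a : FactorIndex σ → ℂ)
    (ν : {ν : σ →₀ ℕ // ν ≠ 0}) (μ : ℤ) :
    (∑ k ∈ s, if k.2.1 = ν.1 then LaurentPolynomial.C (a k) * LaurentPolynomial.T k.1
      else 0 : LaurentPolynomial ℂ).coeff μ = if (μ, ν) ∈ s then a (μ, ν) else 0 := by
  have h1 : ∀ k : FactorIndex σ, (if k.2.1 = ν.1 then LaurentPolynomial.C (a k) *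
      LaurentPolynomial.T k.1 else 0 : LaurentPolynomial ℂ).coeff μ =
        if k = (μ, ν) then a (μ, ν) else 0 := by
    rintro ⟨μ', ν'⟩
    by_cases hν : ν'.1 = ν.1
    · have hν' : ν' = ν := Subtype.ext hν
      subst hν'
      rw [if_pos rfl, ← LaurentPolynomial.single_eq_C_mul_T, AddMonoidAlgebra.coeff_single]
      by_cases hμ : μ' = μ
      · subst hμ
        rw [Finsupp.single_eq_same, if_pos rfl]
      · rw [if_neg fun h => hμ (congrArg Prod.fst h), Finsupp.single_eq_of_ne' hμ]
    · rw [if_neg hν, if_neg fun h => hν (congrArg (fun k : FactorIndex σ => k.2.1) h)]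
      simp
  have h2 : ∀ f : FactorIndex σ → LaurentPolynomial ℂ,
      (∑ k ∈ s, f k).coeff μ = ∑ k ∈ s, (f k).coeff μ := by
    intro f
    induction s using Finset.induction_on with
    | empty => simp
    | insert k s hk ih => rw [Finset.sum_insert hk, Finset.sum_insert hk, ← ih]; rfl
  rw [h2, Finset.sum_congr rfl fun k _ => h1 k, Finset.sum_ite_eq']

variable {P : MvPowerSeries σ (LaurentPolynomial ℂ)}

theorem isFactorization_iff {lam : ℤ → {ν : σ →₀ ℕ // ν ≠ 0} → ℂ} :
    IsFactorization P lam ↔ FormalHasProd (factor fun k => lam k.1 k.2) P := by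
  rw [IsFactorization]
  have : (fun k : FactorIndex σ => binomialFactor k.1 k.2.1 (lam k.1 k.2)) =
      factor fun k => lam k.1 k.2 := by
    funext k
    rw [binomialFactor_eq, factor]
  rw [this]

/-- Induction on the degree of ν. If the exponents agree below, the coefficients at ν differ by ∑_μ
(λ - λ')(μ, ν) q^μ, whose vanishing gives equality for every μ. -/
theorem formalHasProd_factor_unique {lam lam' : FactorIndex σ → ℂ}
    (h : FormalHasProd (factor lam) P) (h' : FormalHasProd (factor lam') P) : lam = lam' := by
  classical
  have key : ∀ d : ℕ, ∀ k : FactorIndex σ, k.2.1.degree = d → lam k = lam' k := by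
    intro d
    induction d using Nat.strong_induction_on with
    | _ d ih =>
      rintro ⟨μ, ν⟩ hd
      have h1 := (h ν.1).and ((h' ν.1).and (Filter.eventually_ge_atTop {(μ, ν)}))
      obtain ⟨s, h2, h3, h4⟩ := h1.exists
      have h5 := coeff_prod_factor_sub (d := d) (lam := lam) (lam' := lam') s
        (fun k _ hk => ih _ hk k rfl) (m := ν.1) hd.le
      rw [h2, h3, sub_self] at h5
      have h6 := coeff_sum_C_mul_T s (fun k => lam k - lam' k) ν μ
      rw [← h5, if_pos (h4 (Finset.mem_singleton_self _))] at h6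
      exact sub_eq_zero.mp h6.symm
  exact funext fun k => key _ k rfl

/-- The product of the factors with `ν` of degree at most `d` agrees with `P` up to degree `d`. -/
def FactorsTo (P : MvPowerSeries σ (LaurentPolynomial ℂ)) (lam : FactorIndex σ → ℂ) (d : ℕ)
    (s : Finset (FactorIndex σ)) : Prop :=
  (∀ k, k.2.1.degree ≤ d → lam k ≠ 0 → k ∈ s) ∧ AgreeTo d (∏ k ∈ s, factor lam k) P

/-- Up to degree d, exponents in higher degree may be replaced by 0, and a zero exponent gives the
factor 1. So any finite index set containing the relevant indices will do. -/
theorem agreeTo_prod_factor {d : ℕ} {lam lam' : FactorIndex σ → ℂ} {s s' : Finset (FactorIndex σ)}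
    (hs : ∀ k, k.2.1.degree ≤ d → lam k ≠ 0 → k ∈ s)
    (hs' : ∀ k, k.2.1.degree ≤ d → lam k ≠ 0 → k ∈ s')
    (h : ∀ k, k.2.1.degree ≤ d → lam k = lam' k) :
    AgreeTo d (∏ k ∈ s, factor lam k) (∏ k ∈ s', factor lam' k) := by
  classical
  let lam'' : FactorIndex σ → ℂ := fun k => if k.2.1.degree ≤ d then lam k else 0
  have h0 : ∀ (lam : FactorIndex σ → ℂ) (s : Finset (FactorIndex σ)),
      (∀ k, k.2.1.degree ≤ d → lam k = lam'' k) → AgreeTo d (∏ k ∈ s, factor lam k)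
        (∏ k ∈ s, factor lam'' k) := by
    intro lam s h m hm
    rw [← sub_eq_zero, coeff_prod_factor_sub s (fun k _ hk => h k hk.le) hm]
    refine Finset.sum_eq_zero fun k _ => ?_
    split_ifs with h1
    · rw [h k (by rwa [h1]), sub_self, map_zero, zero_mul]
    · rfl
  have h1 : ∀ s : Finset (FactorIndex σ), (∀ k, k.2.1.degree ≤ d → lam k ≠ 0 → k ∈ s) →
      ∏ k ∈ s ∪ s', factor lam'' k = ∏ k ∈ s, factor lam'' k := by
    intro s hs
    symm
    refine Finset.prod_subset Finset.subset_union_left fun k _ hk => ?_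
    have : lam'' k = 0 := by
      by_contra hne
      simp only [lam'', ite_eq_right_iff, Classical.not_imp] at hne
      exact hk (hs k hne.1 hne.2)
    rw [factor, this, powerFactor_zero _ k.2.2]
  have h2 : ∏ k ∈ s, factor lam'' k = ∏ k ∈ s', factor lam'' k := by
    rw [← h1 s hs]
    symm
    refine Finset.prod_subset Finset.subset_union_right fun k _ hk => ?_
    have : lam'' k = 0 := by
      by_contra hne
      simp only [lam'', ite_eq_right_iff, Classical.not_imp] at hne
      exact hk (hs' k hne.1 hne.2)
    rw [factor, this, powerFactor_zero _ k.2.2]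
  refine (h0 lam s fun k hk => ?_).trans ?_
  · simp [lam'', hk]
  · rw [h2]
    refine (h0 lam' s' fun k hk => ?_).symm
    simp [lam'', hk, h k hk]

theorem formalHasProd_of_factorsTo {lam : FactorIndex σ → ℂ}
    (h : ∀ d, ∃ s, FactorsTo P lam d s) : FormalHasProd (factor lam) P := by
  intro m
  obtain ⟨s, h1, h2⟩ := h m.degree
  refine Filter.eventually_atTop.mpr ⟨s, fun t ht => ?_⟩
  rw [← h2 m le_rfl]
  exact agreeTo_prod_factor (fun k hk hne => ht (h1 k hk hne)) h1 (fun _ _ => rfl) m le_rfl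

/-- At each ν of degree d + 1 the error is a Laurent polynomial, and its coefficients are the
required λ(μ, ν). Only finitely many are nonzero because σ is finite. -/
theorem exists_factorsTo_succ [Finite σ] {lam : FactorIndex σ → ℂ} {d : ℕ}
    {s : Finset (FactorIndex σ)} (h : FactorsTo P lam d s) :
    ∃ (lam' : FactorIndex σ → ℂ) (s' : Finset (FactorIndex σ)), FactorsTo P lam' (d + 1) s' ∧
      ∀ k, k.2.1.degree ≤ d → lam' k = lam k := by
  classical
  -- Exponents beyond degree d are not controlled by `FactorsTo P lam d s`, so they are reset before
  -- the error is measured.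
  let lam₀ : FactorIndex σ → ℂ := fun k => if k.2.1.degree ≤ d then lam k else 0
  let e : (σ →₀ ℕ) → LaurentPolynomial ℂ := fun m =>
    MvPowerSeries.coeff m P - MvPowerSeries.coeff m (∏ k ∈ s, factor lam₀ k)
  let lam' : FactorIndex σ → ℂ := fun k =>
    if k.2.1.degree = d + 1 then (e k.2.1).coeff k.1 else lam₀ k
  have hfin : {k : FactorIndex σ | k.2.1.degree = d + 1 ∧ (e k.2.1).coeff k.1 ≠ 0}.Finite := by
    have h1 : {ν : {ν : σ →₀ ℕ // ν ≠ 0} | ν.1.degree ≤ d + 1}.Finite :=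
      (Finsupp.finite_of_degree_le (σ := σ) (d + 1)).preimage Subtype.val_injective.injOn
    refine (h1.biUnion fun ν _ => ((e ν.1).coeff.support.finite_toSet.image
      fun μ => ((μ, ν) : FactorIndex σ))).subset ?_
    rintro ⟨μ, ν⟩ ⟨hk1, hk2⟩
    refine Set.mem_biUnion (x := ν) (le_of_eq hk1) ⟨μ, ?_, rfl⟩
    exact Finset.mem_coe.mpr (Finsupp.mem_support_iff.mpr hk2)
  have hlow : ∀ k, k.2.1.degree ≤ d → lam' k = lam k := by
    intro k hk
    simp only [lam', lam₀]
    rw [if_neg (by omega), if_pos hk]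
  refine ⟨lam', s ∪ hfin.toFinset, ⟨?_, ?_⟩, hlow⟩
  · intro k hk hne
    rcases Nat.lt_or_ge k.2.1.degree (d + 1) with h1 | h1
    · rw [hlow k (by omega)] at hne
      exact Finset.mem_union_left _ (h.1 k (by omega) hne)
    · have h2 : k.2.1.degree = d + 1 := le_antisymm hk h1
      refine Finset.mem_union_right _ (hfin.mem_toFinset.mpr ⟨h2, ?_⟩)
      simpa only [lam', if_pos h2] using hne
  · intro m hm
    have h2 : ∏ k ∈ s ∪ hfin.toFinset, factor lam₀ k = ∏ k ∈ s, factor lam₀ k := by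
      symm
      refine Finset.prod_subset Finset.subset_union_left fun k _ hk => ?_
      have : lam₀ k = 0 := by
        by_contra hne
        simp only [lam₀, ite_eq_right_iff, Classical.not_imp] at hne
        exact hk (h.1 k hne.1 hne.2)
      rw [factor, this, powerFactor_zero _ k.2.2]
    rcases Nat.lt_or_ge m.degree (d + 1) with h1 | h1
    · rw [← h.2 m (by omega)]
      have hs : ∀ k, k.2.1.degree ≤ d → lam' k ≠ 0 → k ∈ s := by
        intro k hk hne
        rw [hlow k hk] at hne
        exact h.1 k hk hne
      exact agreeTo_prod_factor (lam := lam') (lam' := lam)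
        (fun k hk hne => Finset.mem_union_left _ (hs k hk hne)) hs hlow m (by omega)
    · have h3 : m.degree = d + 1 := le_antisymm hm h1
      have hm0 : m ≠ 0 := by
        rintro rfl
        simp at h3
      have h4 := coeff_prod_factor_sub (d := d + 1) (lam := lam') (lam' := lam₀)
        (s ∪ hfin.toFinset) (fun k _ hk => by simp only [lam', if_neg hk.ne]) hm
      rw [h2] at h4
      have h5 : ∑ k ∈ s ∪ hfin.toFinset, (if k.2.1 = m then
          LaurentPolynomial.C (lam' k - lam₀ k) * LaurentPolynomial.T k.1 else 0) = e m := by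
        refine LaurentPolynomial.ext fun μ => ?_
        rw [coeff_sum_C_mul_T _ (fun k => lam' k - lam₀ k) ⟨m, hm0⟩ μ]
        have h6 : lam' (μ, ⟨m, hm0⟩) - lam₀ (μ, ⟨m, hm0⟩) = (e m).coeff μ := by
          simp only [lam', lam₀]
          rw [if_pos h3, if_neg (by omega), sub_zero]
        rw [h6]
        split_ifs with h7
        · rfl
        · by_contra hne
          exact h7 (Finset.mem_union_right _ (hfin.mem_toFinset.mpr ⟨h3, fun h => hne h.symm⟩))
      rw [h5] at h4
      simpa only [e, sub_left_inj] using h4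

theorem exists_factorsTo [Finite σ] (hP : MvPowerSeries.coeff 0 P = 1) :
    ∃ lam : FactorIndex σ → ℂ, ∀ d, ∃ s, FactorsTo P lam d s := by
  have h0 : FactorsTo P 0 0 ∅ := by
    refine ⟨fun k _ h => absurd rfl h, fun m hm => ?_⟩
    rw [Nat.le_zero, Finsupp.degree_eq_zero_iff] at hm
    rw [hm, hP, Finset.prod_empty]
    simp
  -- Each stage keeps the exponents already chosen, so the value at an index is the one found at the
  -- stage of its own degree.
  let step : (d : ℕ) → {x : (FactorIndex σ → ℂ) × Finset (FactorIndex σ) // FactorsTo P x.1 d x.2} :=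
    fun d => Nat.rec ⟨(0, ∅), h0⟩ (fun d x => ⟨(Classical.choose (exists_factorsTo_succ x.2),
      Classical.choose (Classical.choose_spec (exists_factorsTo_succ x.2))),
      (Classical.choose_spec (Classical.choose_spec (exists_factorsTo_succ x.2))).1⟩) d
  have hstep : ∀ d k, k.2.1.degree ≤ d → (step (d + 1)).1.1 k = (step d).1.1 k := fun d k hk =>
    (Classical.choose_spec (Classical.choose_spec (exists_factorsTo_succ (step d).2))).2 k hk
  have hstep' : ∀ d k, k.2.1.degree ≤ d → (step d).1.1 k = (step k.2.1.degree).1.1 k := by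
    intro d k hk
    induction d, hk using Nat.le_induction with
    | base => rfl
    | succ d hd ih => rw [hstep d k hd, ih]
  refine ⟨fun k => (step k.2.1.degree).1.1 k, fun d => ⟨(step d).1.2, fun k hk hne => ?_, ?_⟩⟩
  · simp only at hne
    rw [← hstep' d k hk] at hne
    exact (step d).2.1 k hk hne
  · refine AgreeTo.trans ?_ (step d).2.2
    have h1 : ∀ k : FactorIndex σ, k.2.1.degree ≤ d → (step k.2.1.degree).1.1 k ≠ 0 →
        k ∈ (step d).1.2 := by
      intro k hk hne
      rw [← hstep' d k hk] at hne
      exact (step d).2.1 k hk hne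
    exact agreeTo_prod_factor h1 h1 fun k hk => (hstep' d k hk).symm

theorem existsUnique_isFactorization [Finite σ] (hP : MvPowerSeries.coeff 0 P = 1) :
    ∃! lam, IsFactorization P lam := by
  obtain ⟨lam, hlam⟩ := exists_factorsTo hP
  refine ⟨fun μ ν => lam (μ, ν), isFactorization_iff.mpr (formalHasProd_of_factorsTo hlam),
    fun lam' h' => ?_⟩
  have h1 := formalHasProd_factor_unique (isFactorization_iff.mp h')
    (formalHasProd_of_factorsTo hlam)
  funext μ ν
  exact congrFun h1 (μ, ν)

/-- That only finitely many exponents in each degree are nonzero is known for the constructed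
family, and uniqueness transfers it to any convergent one. -/
theorem FormalHasProd.factorsTo [Finite σ] (hP : MvPowerSeries.coeff 0 P = 1)
    {lam : FactorIndex σ → ℂ} (h : FormalHasProd (factor lam) P) (d : ℕ) :
    ∃ s, FactorsTo P lam d s := by
  obtain ⟨lam', hlam'⟩ := exists_factorsTo hP
  rw [formalHasProd_factor_unique h (formalHasProd_of_factorsTo hlam')]
  exact hlam' d

end Factorization

end

end AffineMDS

open scoped Polynomial

namespace AffineMDS

noncomputable section

/-! ### Powers of the zeta function of `F[t]` -/

section ZetaPower

/-- The power series `(1 - c y)^{-l}`. -/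
def binomialSeries (c l : ℂ) : PowerSeries ℂ := PowerSeries.mk fun k => binomialCoeff l k * c ^ k

theorem binomialCoeff_succ (l : ℂ) (k : ℕ) :
    binomialCoeff (l + 1) (k + 1) - binomialCoeff (l + 1) k = binomialCoeff l (k + 1) := by
  have h1 : (ascPochhammer ℂ (k + 1)).eval l = l * (ascPochhammer ℂ k).eval (l + 1) := by
    rw [ascPochhammer_succ_left, Polynomial.eval_mul, Polynomial.eval_X, Polynomial.eval_comp]
    simp
  have h2 : (k.factorial : ℂ) ≠ 0 := Nat.cast_ne_zero.mpr k.factorial_ne_zero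
  have h3 : (k : ℂ) + 1 ≠ 0 := Nat.cast_add_one_ne_zero k
  rw [binomialCoeff, binomialCoeff, binomialCoeff, h1, ascPochhammer_succ_eval,
    Nat.factorial_succ]
  push_cast
  field_simp
  ring

theorem linear_mul_binomialSeries (c l : ℂ) :
    (1 - PowerSeries.C c * PowerSeries.X) * binomialSeries c (l + 1) = binomialSeries c l := by
  ext k
  rw [sub_mul, one_mul, mul_assoc, map_sub, PowerSeries.coeff_C_mul]
  cases k with
  | zero => simp [binomialSeries, binomialCoeff_zero]
  | succ k =>
    rw [PowerSeries.coeff_succ_X_mul, binomialSeries, binomialSeries, PowerSeries.coeff_mk,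
      PowerSeries.coeff_mk, PowerSeries.coeff_mk, ← binomialCoeff_succ l]
    ring

theorem binomialSeries_zero (c : ℂ) : binomialSeries c 0 = 1 := by
  ext k
  rw [binomialSeries, PowerSeries.coeff_mk, PowerSeries.coeff_one]
  cases k with
  | zero => simp [binomialCoeff_zero]
  | succ k => simp [binomialCoeff]

theorem binomialSeries_natCast_mul (c : ℂ) (n : ℕ) :
    binomialSeries c n * (1 - PowerSeries.C c * PowerSeries.X) ^ n = 1 := by
  induction n with
  | zero => rw [Nat.cast_zero, binomialSeries_zero, pow_zero, mul_one]
  | succ n ih =>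
    rw [pow_succ', Nat.cast_succ, ← mul_assoc, mul_comm (binomialSeries _ _),
      linear_mul_binomialSeries, ih]

theorem linear_mul_geometric (c : ℂ) :
    (1 - PowerSeries.C c * PowerSeries.X) * PowerSeries.mk (fun k => c ^ k) = 1 := by
  ext k
  rw [sub_mul, one_mul, mul_assoc, map_sub, PowerSeries.coeff_C_mul]
  cases k with
  | zero => simp
  | succ k =>
    rw [PowerSeries.coeff_succ_X_mul, PowerSeries.coeff_mk, PowerSeries.coeff_mk,
      PowerSeries.coeff_one, if_neg k.succ_ne_zero, pow_succ', sub_self]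

variable {F : Type*} [Field F]

/-- The monic irreducible polynomials. -/
abbrev MonicPrime (F : Type*) [Field F] : Type _ := {p : F[X] // p.Monic ∧ Irreducible p}

theorem natDegree_ne_zero_of_prime (p : MonicPrime F) : p.1.natDegree ≠ 0 :=
  p.2.2.natDegree_pos.ne'

variable [Finite F]

open Classical in
-- A sieve: each factor removes the multiples of one prime.
theorem prod_linear_mul_monicSeries (w : ℂ) (s : Finset (MonicPrime F)) :
    (∏ p ∈ s, PowerSeries.expand p.1.natDegree (natDegree_ne_zero_of_prime p)
        (1 - PowerSeries.C (w ^ p.1.natDegree) * PowerSeries.X)) *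
      monicSeries (fun g : F[X] => w ^ g.natDegree) =
      monicSeries fun g : F[X] => if ∀ p ∈ s, ¬ p.1 ∣ g then w ^ g.natDegree else 0 := by
  induction s using Finset.induction_on with
  | empty => simp
  | insert p s hps ih =>
    obtain ⟨hp, hirr⟩ := p.2
    rw [Finset.prod_insert hps, mul_assoc, ih,
      monicSeries_eq_mul hp hirr (α := fun a => (w ^ p.1.natDegree) ^ a)
        (φ' := fun g => if ∀ p ∈ s, ¬ p.1 ∣ g then w ^ g.natDegree else 0), ← mul_assoc,
      ← map_mul, linear_mul_geometric, map_one, one_mul]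
    · refine monicSeries_congr fun g _ => ?_
      simp only [Finset.forall_mem_insert]
      split_ifs <;> first | rfl | (exfalso; tauto)
    · intro a g hg hpg
      have h1 : (∀ p' ∈ s, ¬ p'.1 ∣ p.1 ^ a * g) ↔ ∀ p' ∈ s, ¬ p'.1 ∣ g := by
        refine forall₂_congr fun p' hp' => not_congr ⟨fun h => ?_, fun h => Dvd.dvd.mul_left h _⟩
        rcases p'.2.2.prime.dvd_or_dvd h with h2 | h2
        · have h3 := p'.2.2.prime.dvd_of_dvd_pow h2
          have h4 : p' = p := Subtype.ext
            (Polynomial.eq_of_monic_of_associated p'.2.1 hp (p'.2.2.associated_of_dvd hirr h3))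
          rw [h4] at hp'
          exact absurd hp' hps
        · exact h2
      simp only [h1]
      split_ifs
      · rw [(hp.pow a).natDegree_mul hg, hp.natDegree_pow, pow_add, ← pow_mul, mul_comm a]
      · rw [mul_zero]

theorem linear_mul_monicSeries (w : ℂ) :
    (1 - PowerSeries.C ((Nat.card F : ℂ) * w) * PowerSeries.X) *
      monicSeries (fun g : F[X] => w ^ g.natDegree) = 1 := by
  have h : monicSeries (fun g : F[X] => w ^ g.natDegree) =
      PowerSeries.mk fun k => ((Nat.card F : ℂ) * w) ^ k := by
    ext k
    rw [monicSeries, PowerSeries.coeff_mk, PowerSeries.coeff_mk,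
      Finset.sum_congr rfl fun g hg => by rw [(mem_monics.mp hg).2], Finset.sum_const, card_monics,
      nsmul_eq_mul, mul_pow]
    push_cast
    rfl
  rw [h, linear_mul_geometric]

/-- After sieving by all primes of degree at most N, only g = 1 is left up to degree N, while the
full series is 1 / (1 - q w y). -/
theorem dvd_prod_linear_sub (w : ℂ) {N : ℕ} {s : Finset (MonicPrime F)}
    (hs : ∀ p : MonicPrime F, p.1.natDegree ≤ N → p ∈ s) :
    PowerSeries.X ^ (N + 1) ∣ (∏ p ∈ s,
      PowerSeries.expand p.1.natDegree (natDegree_ne_zero_of_prime p)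
        (1 - PowerSeries.C (w ^ p.1.natDegree) * PowerSeries.X)) -
      (1 - PowerSeries.C ((Nat.card F : ℂ) * w) * PowerSeries.X) := by
  classical
  have h1 := prod_linear_mul_monicSeries w s
  have h2 := linear_mul_monicSeries (F := F) w
  set G := monicSeries (fun g : F[X] => w ^ g.natDegree)
  set L := 1 - PowerSeries.C ((Nat.card F : ℂ) * w) * PowerSeries.X
  set T := ∏ p ∈ s, PowerSeries.expand p.1.natDegree (natDegree_ne_zero_of_prime p)
        (1 - PowerSeries.C (w ^ p.1.natDegree) * PowerSeries.X)
  have h3 : T - L = L * (T * G - 1) := by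
    linear_combination -T * h2
  rw [h3, h1]
  refine Dvd.dvd.mul_left (PowerSeries.X_pow_dvd_iff.mpr fun n hn => ?_) _
  rw [map_sub, monicSeries, PowerSeries.coeff_mk, PowerSeries.coeff_one]
  cases n with
  | zero =>
    rw [monics_zero, Finset.sum_singleton, if_pos, if_pos rfl, Polynomial.natDegree_one, pow_zero,
      sub_self]
    exact fun p _ h => p.2.2.not_isUnit (isUnit_of_dvd_one h)
  | succ n =>
    rw [if_neg n.succ_ne_zero, sub_zero]
    refine Finset.sum_eq_zero fun g hg => if_neg fun h => ?_
    rw [mem_monics] at hg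
    have hu : ¬ IsUnit g := by
      intro hu
      rw [hg.1.isUnit_iff] at hu
      have := hg.2
      rw [hu, Polynomial.natDegree_one] at this
      exact n.succ_ne_zero this.symm
    obtain ⟨p, hp, hirr, hdvd⟩ := Polynomial.exists_monic_irreducible_factor g hu
    refine h ⟨p, hp, hirr⟩ (hs _ ?_) hdvd
    have := Polynomial.natDegree_le_of_dvd hdvd hg.1.ne_zero
    simp only
    omega

theorem coeff_prod_binomialSeries_natCast (w : ℂ) {N : ℕ} {s : Finset (MonicPrime F)}
    (hs : ∀ p : MonicPrime F, p.1.natDegree ≤ N → p ∈ s) (l : ℕ) {n : ℕ} (hn : n ≤ N) :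
    PowerSeries.coeff n (∏ p ∈ s,
      PowerSeries.expand p.1.natDegree (natDegree_ne_zero_of_prime p)
        (binomialSeries (w ^ p.1.natDegree) l)) =
      PowerSeries.coeff n (binomialSeries ((Nat.card F : ℂ) * w) l) := by
  have h1 := dvd_prod_linear_sub w hs
  have h2 := binomialSeries_natCast_mul ((Nat.card F : ℂ) * w) l
  set L := 1 - PowerSeries.C ((Nat.card F : ℂ) * w) * PowerSeries.X
  set T := ∏ p ∈ s, PowerSeries.expand p.1.natDegree (natDegree_ne_zero_of_prime p)
        (1 - PowerSeries.C (w ^ p.1.natDegree) * PowerSeries.X)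
  set A := ∏ p ∈ s, PowerSeries.expand p.1.natDegree (natDegree_ne_zero_of_prime p)
        (binomialSeries (w ^ p.1.natDegree) l)
  set B := binomialSeries ((Nat.card F : ℂ) * w) l
  have h3 : A * T ^ l = 1 := by
    rw [← Finset.prod_pow, ← Finset.prod_mul_distrib]
    refine Finset.prod_eq_one fun p _ => ?_
    rw [← map_pow, ← map_mul, binomialSeries_natCast_mul, map_one]
  have h4 : A - B = -(A * B) * (T ^ l - L ^ l) := by
    linear_combination B * h3 - A * h2
  have h5 : PowerSeries.X ^ (N + 1) ∣ A - B := by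
    rw [h4]
    exact Dvd.dvd.mul_left (h1.trans (sub_dvd_pow_sub_pow _ _ _)) _
  have h6 := PowerSeries.X_pow_dvd_iff.mp h5 n (Nat.lt_succ_of_le hn)
  rw [map_sub] at h6
  exact sub_eq_zero.mp h6

/-- The power series `(1 - c y)^{-l}`, with `l` an indeterminate. -/
def formalBinomialSeries (c : ℂ) : PowerSeries ℂ[X] :=
  PowerSeries.mk fun k => Polynomial.C ((k.factorial : ℂ)⁻¹ * c ^ k) * ascPochhammer ℂ k

theorem map_formalBinomialSeries (c l : ℂ) :
    PowerSeries.map (Polynomial.evalRingHom l) (formalBinomialSeries c) = binomialSeries c l := by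
  ext k
  rw [PowerSeries.coeff_map, formalBinomialSeries, binomialSeries, PowerSeries.coeff_mk,
    PowerSeries.coeff_mk, binomialCoeff, Polynomial.coe_evalRingHom, Polynomial.eval_mul,
    Polynomial.eval_C]
  ring

/-- Both sides are polynomials in l, as `formalBinomialSeries` shows. They agree at natural numbers,
where the series are inverses of honest powers, hence for every complex l. -/
theorem coeff_prod_binomialSeries (w : ℂ) {N : ℕ} {s : Finset (MonicPrime F)}
    (hs : ∀ p : MonicPrime F, p.1.natDegree ≤ N → p ∈ s) (l : ℂ) {n : ℕ} (hn : n ≤ N) :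
    PowerSeries.coeff n (∏ p ∈ s,
      PowerSeries.expand p.1.natDegree (natDegree_ne_zero_of_prime p)
        (binomialSeries (w ^ p.1.natDegree) l)) =
      PowerSeries.coeff n (binomialSeries ((Nat.card F : ℂ) * w) l) := by
  have h1 : ∀ l : ℂ, PowerSeries.coeff n (∏ p ∈ s,
      PowerSeries.expand p.1.natDegree (natDegree_ne_zero_of_prime p)
        (binomialSeries (w ^ p.1.natDegree) l)) =
      (PowerSeries.coeff n (∏ p ∈ s,
        PowerSeries.expand p.1.natDegree (natDegree_ne_zero_of_prime p)
          (formalBinomialSeries (w ^ p.1.natDegree)))).eval l := by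
    intro l
    rw [← Polynomial.coe_evalRingHom, ← PowerSeries.coeff_map,
      map_prod (PowerSeries.map (Polynomial.evalRingHom l))]
    congr 1
    refine Finset.prod_congr rfl fun p _ => ?_
    rw [PowerSeries.map_expand, map_formalBinomialSeries]
  have h2 : ∀ l : ℂ, PowerSeries.coeff n (binomialSeries ((Nat.card F : ℂ) * w) l) =
      (PowerSeries.coeff n (formalBinomialSeries ((Nat.card F : ℂ) * w))).eval l := by
    intro l
    rw [← Polynomial.coe_evalRingHom, ← PowerSeries.coeff_map, map_formalBinomialSeries]
  rw [h1, h2]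
  congr 1
  refine Polynomial.eq_of_infinite_eval_eq _ _ ((Set.infinite_range_of_injective
    (Nat.cast_injective (R := ℂ))).mono ?_)
  rintro _ ⟨m, rfl⟩
  rw [Set.mem_ofPred_eq, ← h1, ← h2]
  exact coeff_prod_binomialSeries_natCast w hs m hn

/-! #### Substitution of a monomial -/

variable {σ : Type*}

theorem hasSubst_monomial {ν : σ →₀ ℕ} (hν : ν ≠ 0) :
    PowerSeries.HasSubst (MvPowerSeries.monomial ν (1 : ℂ)) := by
  classical
  refine PowerSeries.HasSubst.of_constantCoeff_zero ?_
  rw [← MvPowerSeries.coeff_zero_eq_constantCoeff_apply, MvPowerSeries.coeff_monomial,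
    if_neg hν.symm]

/-- The substitution of `x^ν` for the variable. -/
def substMonomial {ν : σ →₀ ℕ} (hν : ν ≠ 0) : PowerSeries ℂ →ₐ[ℂ] MvPowerSeries σ ℂ :=
  PowerSeries.substAlgHom (hasSubst_monomial hν)

open Classical in
theorem coeff_smul_coeff_monomial_pow (ν : σ →₀ ℕ) (f : PowerSeries ℂ) (m : σ →₀ ℕ) (k : ℕ) :
    PowerSeries.coeff k f • MvPowerSeries.coeff m (MvPowerSeries.monomial ν (1 : ℂ) ^ k) =
      if m = k • ν then PowerSeries.coeff k f else 0 := by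
  rw [MvPowerSeries.monomial_pow, MvPowerSeries.coeff_monomial, one_pow]
  split_ifs <;> simp

theorem coeff_nsmul_substMonomial {ν : σ →₀ ℕ} (hν : ν ≠ 0) (f : PowerSeries ℂ) (k : ℕ) :
    MvPowerSeries.coeff (k • ν) (substMonomial hν f) = PowerSeries.coeff k f := by
  classical
  rw [substMonomial, PowerSeries.coe_substAlgHom, PowerSeries.coeff_subst (hasSubst_monomial hν),
    finsum_eq_single _ k, coeff_smul_coeff_monomial_pow, if_pos rfl]
  intro j hj
  rw [coeff_smul_coeff_monomial_pow, if_neg]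
  exact fun h => hj (nsmul_left_injective_of_ne_zero hν h).symm

theorem coeff_substMonomial_eq_zero {ν : σ →₀ ℕ} (hν : ν ≠ 0) (f : PowerSeries ℂ) {m : σ →₀ ℕ}
    (hm : ∀ k : ℕ, m ≠ k • ν) : MvPowerSeries.coeff m (substMonomial hν f) = 0 := by
  classical
  rw [substMonomial, PowerSeries.coe_substAlgHom, PowerSeries.coeff_subst (hasSubst_monomial hν)]
  refine finsum_eq_zero_of_forall_eq_zero fun k => ?_
  rw [coeff_smul_coeff_monomial_pow, if_neg (hm k)]

theorem substMonomial_expand {ν : σ →₀ ℕ} (hν : ν ≠ 0) {d : ℕ} (hd : d ≠ 0) (c l : ℂ) :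
    substMonomial hν (PowerSeries.expand d hd (binomialSeries c l)) = powerFactor c (d • ν) l := by
  have hdν : d • ν ≠ 0 := fun h => by
    have h1 := congrArg Finsupp.degree h
    rw [map_nsmul, map_zero, smul_eq_mul] at h1
    exact (Nat.mul_ne_zero hd (degree_pos_of_ne_zero hν).ne') h1
  ext m
  by_cases hm : ∃ k : ℕ, m = k • ν
  · obtain ⟨k, rfl⟩ := hm
    rw [coeff_nsmul_substMonomial, PowerSeries.coeff_expand]
    by_cases hk : d ∣ k
    · obtain ⟨j, rfl⟩ := hk
      rw [if_pos (dvd_mul_right _ _), Nat.mul_div_cancel_left _ (Nat.pos_of_ne_zero hd),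
        mul_comm d j, mul_smul, coeff_nsmul_powerFactor _ hdν, binomialSeries,
        PowerSeries.coeff_mk]
      rfl
    · rw [if_neg hk, coeff_powerFactor_eq_zero]
      intro j hj
      rw [← mul_smul] at hj
      exact hk ⟨j, by rw [nsmul_left_injective_of_ne_zero hν hj, mul_comm]⟩
  · push Not at hm
    rw [coeff_substMonomial_eq_zero hν _ hm, coeff_powerFactor_eq_zero]
    intro j hj
    rw [← mul_smul] at hj
    exact hm _ hj

theorem substMonomial_binomialSeries {ν : σ →₀ ℕ} (hν : ν ≠ 0) (c l : ℂ) :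
    substMonomial hν (binomialSeries c l) = powerFactor c ν l := by
  have := substMonomial_expand hν one_ne_zero c l
  rwa [PowerSeries.expand_one_apply, one_smul] at this

/-- The Euler product of `(1 - q w x^ν)^{-l}`, up to a given degree. -/
theorem agreeTo_prod_powerFactor {ν : σ →₀ ℕ} (hν : ν ≠ 0) (w l : ℂ) {N : ℕ}
    {s : Finset (MonicPrime F)} (hs : ∀ p : MonicPrime F, p.1.natDegree ≤ N → p ∈ s) :
    AgreeTo N (∏ p ∈ s, powerFactor (w ^ p.1.natDegree) (p.1.natDegree • ν) l)
      (powerFactor ((Nat.card F : ℂ) * w) ν l) := by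
  rw [← substMonomial_binomialSeries hν,
    ← Finset.prod_congr rfl fun p _ => substMonomial_expand hν (natDegree_ne_zero_of_prime p) _ l,
    ← map_prod]
  intro m hm
  by_cases hk : ∃ k : ℕ, m = k • ν
  · obtain ⟨k, rfl⟩ := hk
    rw [coeff_nsmul_substMonomial, coeff_nsmul_substMonomial]
    refine coeff_prod_binomialSeries w hs l ?_
    rw [map_nsmul, smul_eq_mul] at hm
    exact (Nat.le_mul_of_pos_right _ (degree_pos_of_ne_zero hν)).trans hm
  · push Not at hk
    rw [coeff_substMonomial_eq_zero hν _ hk, coeff_substMonomial_eq_zero hν _ hk]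

end ZetaPower

end

end AffineMDS

open scoped Polynomial

namespace AffineMDS

noncomputable section

/-! ### The symmetry of the factors -/

section Symmetry

/-- Evaluation of a Laurent polynomial at a unit. -/
def evalLaurent (x : ℂˣ) : LaurentPolynomial ℂ →ₐ[ℂ] ℂ :=
  { LaurentPolynomial.eval₂ (RingHom.id ℂ) x with
    commutes' := fun r => LaurentPolynomial.eval₂_C (RingHom.id ℂ) x r }

theorem evalLaurent_T (x : ℂˣ) (n : ℤ) :
    evalLaurent x (LaurentPolynomial.T n) = (x : ℂ) ^ n := by
  rw [← Units.val_zpow_eq_zpow_val]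
  exact LaurentPolynomial.eval₂_T (RingHom.id ℂ) x n

theorem evalLaurent_toLaurent (x : ℂˣ) (P : ℂ[X]) :
    evalLaurent x (Polynomial.toLaurent P) = P.eval (x : ℂ) :=
  LaurentPolynomial.eval₂_toLaurent (RingHom.id ℂ) x P

/-- The substitution of the square of the variable. -/
def laurentSquare : LaurentPolynomial ℂ →ₐ[ℂ] LaurentPolynomial ℂ :=
  AddMonoidAlgebra.mapDomainAlgHom ℂ ℂ (AddMonoidHom.mulLeft (2 : ℤ))

theorem laurentSquare_T (n : ℤ) :
    laurentSquare (LaurentPolynomial.T n) = LaurentPolynomial.T (2 * n) :=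
  AddMonoidAlgebra.mapDomain_single

theorem evalLaurent_laurentSquare (x : ℂˣ) (f : LaurentPolynomial ℂ) :
    evalLaurent x (laurentSquare f) = evalLaurent (x ^ 2) f := by
  have : (evalLaurent x).comp laurentSquare = evalLaurent (x ^ 2) := by
    refine AddMonoidAlgebra.algHom_ext (M := ℤ) (fun n => ?_) (Subsingleton.elim _ _)
    change evalLaurent x (laurentSquare (LaurentPolynomial.T n)) =
      evalLaurent (x ^ 2) (LaurentPolynomial.T n)
    rw [laurentSquare_T, evalLaurent_T, evalLaurent_T, zpow_mul]
    push_cast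
    rfl
  exact DFunLike.congr_fun this f

theorem laurent_eq_of_evalLaurent {f g : LaurentPolynomial ℂ}
    (h : ∀ (n : ℕ) (x : ℂˣ), n ≠ 0 → (x : ℂ) = 5 ^ n → evalLaurent x f = evalLaurent x g) :
    f = g := by
  rw [← sub_eq_zero]
  obtain ⟨N, P, hP⟩ := LaurentPolynomial.exists_T_pow (f - g)
  have hP0 : P = 0 := by
    refine eq_of_eval_five_pow fun n hn => ?_
    let x : ℂˣ := Units.mk0 ((5 : ℂ) ^ n) (pow_ne_zero _ (by norm_num))
    have h1 := congrArg (evalLaurent x) hP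
    rw [evalLaurent_toLaurent, map_mul, map_sub, h n x hn rfl, sub_self, zero_mul] at h1
    rw [Polynomial.eval_zero]
    exact h1
  rw [hP0, map_zero] at hP
  have h2 := congrArg (· * (LaurentPolynomial.T (-(N : ℤ)) : LaurentPolynomial ℂ)) hP
  simp only [zero_mul, LaurentPolynomial.mul_T_assoc, add_neg_cancel, LaurentPolynomial.T_zero,
    mul_one] at h2
  exact h2.symm

/-! ### Rescaling, dilating and reindexing factorizations -/

section Operations

variable {σ : Type*}

theorem AgreeTo.rescale {d : ℕ} {f g : MvPowerSeries σ ℂ} (h : AgreeTo d f g) (t : σ → ℂ) :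
    AgreeTo d (MvPowerSeries.rescale t f) (MvPowerSeries.rescale t g) := by
  intro n hn
  rw [MvPowerSeries.coeff_rescale, MvPowerSeries.coeff_rescale, h n hn]

theorem AgreeTo.expand {d : ℕ} {f g : MvPowerSeries σ ℂ} (h : AgreeTo d f g) {e : ℕ}
    (he : e ≠ 0) :
    AgreeTo d (MvPowerSeries.expand e he f) (MvPowerSeries.expand e he g) := by
  intro n hn
  by_cases hd : ∀ i, e ∣ n i
  · obtain ⟨m, rfl⟩ : ∃ m, n = e • m := by
      refine ⟨n.mapRange (· / e) (Nat.zero_div _), Finsupp.ext fun i => ?_⟩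
      simp [Nat.mul_div_cancel' (hd i)]
    rw [MvPowerSeries.coeff_expand_smul, MvPowerSeries.coeff_expand_smul]
    refine h m ?_
    rw [map_nsmul, smul_eq_mul] at hn
    exact (Nat.le_mul_of_pos_left _ (Nat.pos_of_ne_zero he)).trans hn
  · push Not at hd
    obtain ⟨i, hi⟩ := hd
    rw [MvPowerSeries.coeff_expand_of_not_dvd e he _ hi,
      MvPowerSeries.coeff_expand_of_not_dvd e he _ hi]

theorem rescale_powerFactor (t : σ → ℂ) (c : ℂ) {ν : σ →₀ ℕ} (hν : ν ≠ 0) (l : ℂ) :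
    MvPowerSeries.rescale t (powerFactor c ν l) =
      powerFactor ((ν.prod fun i k => t i ^ k) * c) ν l := by
  ext m
  rw [MvPowerSeries.coeff_rescale]
  by_cases hm : ∃ k : ℕ, m = k • ν
  · obtain ⟨k, rfl⟩ := hm
    rw [coeff_nsmul_powerFactor _ hν, coeff_nsmul_powerFactor _ hν, mul_pow]
    have : (k • ν).prod (fun i k => t i ^ k) = (ν.prod fun i k => t i ^ k) ^ k := by
      rw [Finsupp.prod_of_support_subset _ Finsupp.support_smul _ (by simp), Finsupp.prod,
        ← Finset.prod_pow]
      refine Finset.prod_congr rfl fun i _ => ?_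
      rw [Finsupp.smul_apply, smul_eq_mul, mul_comm, pow_mul]
    rw [this]
    ring
  · push Not at hm
    rw [coeff_powerFactor_eq_zero _ _ hm, coeff_powerFactor_eq_zero _ _ hm, mul_zero]

theorem expand_powerFactor {e : ℕ} (he : e ≠ 0) (c : ℂ) {ν : σ →₀ ℕ} (hν : ν ≠ 0) (l : ℂ) :
    MvPowerSeries.expand e he (powerFactor c ν l) = powerFactor c (e • ν) l := by
  have heν : e • ν ≠ 0 := fun h => by
    have h1 := congrArg Finsupp.degree h
    rw [map_nsmul, map_zero, smul_eq_mul] at h1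
    exact (Nat.mul_ne_zero he (degree_pos_of_ne_zero hν).ne') h1
  ext n
  by_cases hd : ∀ i, e ∣ n i
  · obtain ⟨m, rfl⟩ : ∃ m, n = e • m := by
      refine ⟨n.mapRange (· / e) (Nat.zero_div _), Finsupp.ext fun i => ?_⟩
      simp [Nat.mul_div_cancel' (hd i)]
    rw [MvPowerSeries.coeff_expand_smul]
    by_cases hm : ∃ k : ℕ, m = k • ν
    · obtain ⟨k, rfl⟩ := hm
      rw [coeff_nsmul_powerFactor _ hν, smul_comm, coeff_nsmul_powerFactor _ heν]
    · push Not at hm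
      rw [coeff_powerFactor_eq_zero _ _ hm, coeff_powerFactor_eq_zero]
      intro k hk
      rw [smul_comm] at hk
      exact hm k (nsmul_right_injective he hk)
  · push Not at hd
    obtain ⟨i, hi⟩ := hd
    rw [MvPowerSeries.coeff_expand_of_not_dvd e he _ hi, coeff_powerFactor_eq_zero]
    rintro k rfl
    refine hi ?_
    simp only [Finsupp.smul_apply, smul_eq_mul]
    exact Dvd.dvd.mul_left (dvd_mul_right _ _) _

/-- A product with relabelled exponents μ becomes a factorization in standard form, with exponent 0
off the image, so that uniqueness can be applied to it. -/
theorem factorsTo_extend {P : MvPowerSeries σ (LaurentPolynomial ℂ)} {lam : FactorIndex σ → ℂ}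
    {d : ℕ} {s : Finset (FactorIndex σ)} (hs : ∀ k, k.2.1.degree ≤ d → lam k ≠ 0 → k ∈ s)
    {φ : ℤ → {ν : σ →₀ ℕ // ν ≠ 0} → ℤ} (hφ : ∀ ν, Function.Injective fun μ => φ μ ν)
    (h : AgreeTo d (∏ k ∈ s, powerFactor (LaurentPolynomial.T (φ k.1 k.2)) k.2.1 (lam k)) P) :
    ∃ t, FactorsTo P (Function.extend (fun k : FactorIndex σ => (φ k.1 k.2, k.2)) lam 0) d t := by
  classical
  have hinj : Function.Injective fun k : FactorIndex σ => (φ k.1 k.2, k.2) := by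
    rintro ⟨μ, ν⟩ ⟨μ', ν'⟩ hk
    simp only [Prod.mk.injEq] at hk
    obtain ⟨h1, rfl⟩ := hk
    rw [hφ ν h1]
  refine ⟨s.image fun k => (φ k.1 k.2, k.2), ?_, ?_⟩
  · intro k hk hne
    by_cases hr : ∃ j : FactorIndex σ, (φ j.1 j.2, j.2) = k
    · obtain ⟨j, rfl⟩ := hr
      rw [hinj.extend_apply lam 0 j] at hne
      exact Finset.mem_image_of_mem _ (hs j hk hne)
    · rw [Function.extend_apply' _ _ _ hr] at hne
      exact absurd rfl hne
  · rw [Finset.prod_image hinj.injOn]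
    have : ∀ k ∈ s, factor (Function.extend (fun k : FactorIndex σ => (φ k.1 k.2, k.2)) lam 0)
        (φ k.1 k.2, k.2) = powerFactor (LaurentPolynomial.T (φ k.1 k.2)) k.2.1 (lam k) := by
      intro k _
      rw [factor, hinj.extend_apply lam 0 k]
    rwa [Finset.prod_congr rfl this]

end Operations

variable {V : Type*} [Fintype V] [DecidableEq V] {Γ : SimpleGraph V} [DecidableRel Γ.Adj]
  {H : Weights V} {c : (V →₀ ℕ) → ℂ[X]} {S : Finset V}

theorem SatisfiesAxioms.coeff_formalResidue (hS : ∀ i j, Γ.Adj i j → (i ∈ S ↔ j ∉ S))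
    (hH : SatisfiesAxioms Γ H c) (a : S →₀ ℕ) :
    MvPowerSeries.coeff a (formalResidue S c) = Polynomial.toLaurent (c (extendExp Γ S a)) *
      LaurentPolynomial.T (-((∑ i : S, a i * Γ.degree i : ℕ) : ℤ)) := by
  have h1 : (LaurentPolynomial.T 1 : LaurentPolynomial ℂ) * LaurentPolynomial.T (-1) = 1 := by
    rw [← LaurentPolynomial.T_add, add_neg_cancel, LaurentPolynomial.T_zero]
  rw [formalResidue, coeff_residue hS h1 (fun i _ => hH.formal_poleAt i),
    LaurentPolynomial.T_pow, mul_neg_one]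
  rfl

theorem SatisfiesAxioms.coeff_zero_formalResidue [Nonempty V]
    (hS : ∀ i j, Γ.Adj i j → (i ∈ S ↔ j ∉ S)) (hH : SatisfiesAxioms Γ H c) :
    MvPowerSeries.coeff 0 (formalResidue S c) = 1 := by
  rw [hH.coeff_formalResidue hS]
  have i : V := Classical.arbitrary V
  have h1 := hH.eq_X_pow (i := i) (a := 0) (by simp [restDeg]) 0
  have h2 : (0 : V →₀ ℕ).update i 0 = extendExp Γ S 0 := by
    ext j
    rw [Finsupp.update_apply]
    simp [extendExp, nbrSum]
  rw [h2] at h1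
  rw [h1]
  simp

/-- The exponent `∑ᵢ (2 - N(i)) νᵢ`. -/
def shiftExp (Γ : SimpleGraph V) [DecidableRel Γ.Adj] (ν : S →₀ ℕ) : ℤ :=
  ∑ i : S, (2 - (Γ.degree i : ℤ)) * ν i

theorem sum_extendExp (hS : ∀ i j, Γ.Adj i j → (i ∈ S ↔ j ∉ S)) (a : S →₀ ℕ) :
    ∑ i, extendExp Γ S a i = ∑ i : S, a i + ∑ i : S, a i * Γ.degree i := by
  rw [← Finset.sum_add_sum_compl S, ← sum_nbrSum hS]
  congr 1
  · rw [← Finset.sum_coe_sort]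
    exact Finset.sum_congr rfl fun i _ => by simp [extendExp]
  · refine Finset.sum_congr rfl fun i hi => ?_
    simp [extendExp, Finset.mem_compl.mp hi]

theorem prod_zpow_shift {ρ : ℂ} (hρ : ρ ≠ 0) (a : S →₀ ℕ) :
    (a.prod fun i k => (ρ ^ (2 - (Γ.degree i : ℤ))) ^ k) = ρ ^ shiftExp Γ a := by
  rw [Finsupp.prod_fintype _ _ fun _ => pow_zero _, shiftExp]
  have h : ∀ s : Finset S, ∏ i ∈ s, (ρ ^ (2 - (Γ.degree i : ℤ))) ^ a i =
      ρ ^ (∑ i ∈ s, (2 - (Γ.degree i : ℤ)) * a i) := by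
    intro s
    induction s using Finset.induction_on with
    | empty => simp
    | insert i s hi ih =>
      rw [Finset.prod_insert hi, Finset.sum_insert hi, zpow_add₀ hρ, ih, zpow_mul, zpow_natCast]
  exact h _

variable {F : Type} [Field F] [Finite F]

theorem SatisfiesAxioms.residue_eq_map (hS : ∀ i j, Γ.Adj i j → (i ∈ S ↔ j ∉ S))
    (hH : SatisfiesAxioms Γ H c) (hq : Nat.card F % 4 = 1) {x : ℂˣ} (hx : (x : ℂ) = Nat.card F) :
    residue (Nat.card F : ℂ) (Nat.card F : ℂ)⁻¹ S (Z H F) =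
      MvPowerSeries.map (evalLaurent x).toRingHom (formalResidue S c) := by
  have hq0 : (Nat.card F : ℂ) ≠ 0 := hx ▸ x.ne_zero
  ext a
  rw [MvPowerSeries.coeff_map, hH.coeff_formalResidue hS,
    coeff_residue hS (mul_inv_cancel₀ hq0) (fun i _ => hH.poleAt hq i), hH.coeff_eq F hq, map_mul]
  change _ = evalLaurent x _ * evalLaurent x _
  rw [evalLaurent_toLaurent, evalLaurent_T, hx, zpow_neg, zpow_natCast, inv_pow]

/-- Let ρ² = Q = q^(deg p), M = ∑ a_i and N = ∑ a_i N(i). Local-to-global supplies ρ^(2M + 2N) and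
the weights ρ^(-N). The coefficient of R at q = Q⁻¹ already contains ρ^(2N), so the rescaling must
supply ρ^(2M - N), which is ρ^(2 - N(i)) for each x_i. -/
theorem SatisfiesAxioms.eulerFactor_eq (hS : ∀ i j, Γ.Adj i j → (i ∈ S ↔ j ∉ S))
    (hH : SatisfiesAxioms Γ H c) (hq : Nat.card F % 4 = 1) (p : MonicPrime F) {x : ℂˣ}
    (hx : (x : ℂ) = ((Real.sqrt (Nat.card F) : ℝ) : ℂ)) :
    eulerFactor Γ H S F p.1 =
      MvPowerSeries.expand p.1.natDegree (natDegree_ne_zero_of_prime p)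
        (MvPowerSeries.rescale (fun i : S => ((x : ℂ) ^ p.1.natDegree) ^ (2 - (Γ.degree i : ℤ)))
          (MvPowerSeries.map (evalLaurent ((x ^ p.1.natDegree) ^ 2)⁻¹).toRingHom
            (formalResidue S c))) := by
  set d := p.1.natDegree with hd
  have hd0 : d ≠ 0 := natDegree_ne_zero_of_prime p
  set ρ := (x : ℂ) ^ d with hρ
  have hρ0 : ρ ≠ 0 := pow_ne_zero _ x.ne_zero
  have hQ : (Nat.card F : ℂ) ^ d = ρ ^ 2 := by
    rw [← coe_sqrt_sq, ← hx, ← pow_mul, ← pow_mul, mul_comm]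
  ext n
  rw [MvPowerSeries.coeff_apply, eulerFactor]
  by_cases hdvd : ∀ i, d ∣ n i
  · obtain ⟨m, rfl⟩ : ∃ m, n = d • m := by
      refine ⟨n.mapRange (· / d) (Nat.zero_div _), Finsupp.ext fun i => ?_⟩
      simp [Nat.mul_div_cancel' (hdvd i)]
    have hm : (d • m).mapRange (· / d) (Nat.zero_div _) = m := by
      ext i
      simp [Nat.mul_div_cancel_left _ (Nat.pos_of_ne_zero hd0)]
    rw [if_pos hdvd, MvPowerSeries.coeff_expand_smul, MvPowerSeries.coeff_rescale,
      MvPowerSeries.coeff_map, hH.coeff_formalResidue hS, map_mul, prod_zpow_shift hρ0, hm,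
      hH.local_global F hq p.1 p.2.1 p.2.2]
    change _ = _ * (evalLaurent _ _ * evalLaurent _ _)
    have hu : ((((x ^ d) ^ 2)⁻¹ : ℂˣ) : ℂ) = (ρ ^ 2)⁻¹ := by
      push_cast
      rfl
    rw [evalLaurent_toLaurent, evalLaurent_T, hu, ← hd, hQ, sum_extendExp hS]
    have h1 : ∏ i : S, sqrtWeight Γ (Nat.card F) i ^ (d • m) i =
        ρ⁻¹ ^ (∑ i : S, m i * Γ.degree i) := by
      rw [← Finset.prod_pow_eq_pow_sum]
      refine Finset.prod_congr rfl fun i _ => ?_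
      rw [sqrtWeight, ← hx, hρ, ← inv_pow, ← pow_mul, ← pow_mul, Finsupp.smul_apply, smul_eq_mul]
      congr 1
      ring
    have h2 : shiftExp Γ m = 2 * ((∑ i : S, m i : ℕ) : ℤ) -
        ((∑ i : S, m i * Γ.degree i : ℕ) : ℤ) := by
      rw [shiftExp]
      push_cast
      rw [Finset.mul_sum, ← Finset.sum_sub_distrib]
      exact Finset.sum_congr rfl fun i _ => by ring
    rw [h1, h2]
    generalize (∑ i : S, m i * Γ.degree i) = N
    generalize (∑ i : S, m i) = M
    rw [inv_zpow', neg_neg, zpow_natCast, zpow_sub₀ hρ0, zpow_mul, zpow_natCast, zpow_natCast,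
      inv_pow, pow_add, ← pow_mul ρ 2 N, two_mul N, pow_add]
    have h3 := pow_ne_zero N hρ0
    rw [show ρ ^ (2 : ℤ) = ρ ^ 2 from zpow_natCast ρ 2]
    field_simp
  · rw [if_neg hdvd]
    push Not at hdvd
    obtain ⟨i, hi⟩ := hdvd
    rw [MvPowerSeries.coeff_expand_of_not_dvd d hd0 _ hi]

/-- Insert the factorization into every Euler factor and exchange the products. For fixed (μ, ν) the
product over primes is a zeta power with w = x^(`shiftExp` - 2μ), and q w is the stated base since q
= x². -/
theorem SatisfiesAxioms.agreeTo_map_evalLaurent [Nonempty V]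
    (hS : ∀ i j, Γ.Adj i j → (i ∈ S ↔ j ∉ S)) (hH : SatisfiesAxioms Γ H c)
    (hq : Nat.card F % 4 = 1) {x : ℂˣ} (hx : (x : ℂ) = ((Real.sqrt (Nat.card F) : ℝ) : ℂ))
    {lam : FactorIndex S → ℂ} {d : ℕ} {s : Finset (FactorIndex S)}
    (hs : FactorsTo (formalResidue S c) lam d s) :
    AgreeTo d
      (∏ k ∈ s, powerFactor ((x : ℂ) ^ (2 - 2 * k.1 + shiftExp Γ k.2.1)) k.2.1 (lam k))
      (MvPowerSeries.map (evalLaurent (x ^ 2)).toRingHom (formalResidue S c)) := by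
  classical
  have hx2 : ((x ^ 2 : ℂˣ) : ℂ) = Nat.card F := by
    rw [← coe_sqrt_sq, ← hx]
    push_cast
    rfl
  rw [← hH.residue_eq_map hS hq hx2, hH.residue_eq_degreeSeries hS hq]
  have hE := hH.formalHasProd_eulerFactor hS hq (S := S) (F := F)
  have hE' : ∀ᶠ t : Finset (MonicPrime F) in Filter.atTop,
      AgreeTo d (∏ p ∈ t, eulerFactor Γ H S F p.1) (degreeSeries F (residueWeight Γ H S)) := by
    exact (Filter.eventually_all_finite (Finsupp.finite_of_degree_le (σ := S) d)).mpr
      fun m _ => hE m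
  obtain ⟨t, ht, ht'⟩ := (hE'.and (Filter.eventually_ge_atTop
    (finite_primes_natDegree_le (F := F) d).toFinset)).exists
  refine AgreeTo.trans ?_ ht
  have h1 : ∀ p ∈ t, AgreeTo d (∏ k ∈ s, powerFactor
      (((x : ℂ) ^ (shiftExp Γ k.2.1 - 2 * k.1)) ^ p.1.natDegree) (p.1.natDegree • k.2.1) (lam k))
      (eulerFactor Γ H S F p.1) := by
    intro p _
    rw [hH.eulerFactor_eq hS hq p hx]
    have h2 := ((hs.2.map (evalLaurent ((x ^ p.1.natDegree) ^ 2)⁻¹).toRingHom).rescale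
      (fun i : S => ((x : ℂ) ^ p.1.natDegree) ^ (2 - (Γ.degree i : ℤ)))).expand
        (natDegree_ne_zero_of_prime p)
    rw [map_prod, map_prod, map_prod] at h2
    have h3 : ∀ k ∈ s, MvPowerSeries.expand p.1.natDegree (natDegree_ne_zero_of_prime p)
        (MvPowerSeries.rescale (fun i : S => ((x : ℂ) ^ p.1.natDegree) ^ (2 - (Γ.degree i : ℤ)))
          (MvPowerSeries.map (evalLaurent ((x ^ p.1.natDegree) ^ 2)⁻¹).toRingHom
            (factor lam k))) = powerFactor
      (((x : ℂ) ^ (shiftExp Γ k.2.1 - 2 * k.1)) ^ p.1.natDegree) (p.1.natDegree • k.2.1)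
        (lam k) := by
      intro k _
      rw [factor, map_powerFactor, rescale_powerFactor _ _ k.2.2,
        expand_powerFactor _ _ k.2.2, evalLaurent_T, prod_zpow_shift (pow_ne_zero _ x.ne_zero)]
      congr 1
      have hx0 := x.ne_zero
      push_cast
      rw [← inv_pow, ← inv_pow, ← zpow_natCast, ← zpow_natCast, ← zpow_natCast, ← zpow_natCast,
        ← zpow_mul, ← zpow_mul, ← zpow_mul, ← zpow_mul, inv_zpow', ← zpow_add₀ hx0]
      congr 1
      push_cast
      ring
    rwa [Finset.prod_congr rfl h3] at h2
  refine AgreeTo.trans ?_ (AgreeTo.prod t h1)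
  rw [Finset.prod_comm]
  refine AgreeTo.prod s fun k _ => ?_
  have h4 := agreeTo_prod_powerFactor (F := F) k.2.2
    ((x : ℂ) ^ (shiftExp Γ k.2.1 - 2 * k.1)) (lam k) (N := d) (s := t)
    fun p hp => ht' ((finite_primes_natDegree_le (F := F) d).mem_toFinset.mpr hp)
  have h5 : (Nat.card F : ℂ) * (x : ℂ) ^ (shiftExp Γ k.2.1 - 2 * k.1) =
      (x : ℂ) ^ (2 - 2 * k.1 + shiftExp Γ k.2.1) := by
    rw [← hx2]
    push_cast
    rw [← zpow_natCast, ← zpow_add₀ x.ne_zero]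
    congr 1
    push_cast
    ring
  rw [h5] at h4
  exact h4.symm

/-- The new exponents of √q may be odd, so the comparison takes x = √q as variable and substitutes q
= x². The values x = 5^n, from fields with 5^(2n) elements, determine the Laurent polynomials. -/
theorem SatisfiesAxioms.agreeTo_laurentSquare [Nonempty V]
    (hS : ∀ i j, Γ.Adj i j → (i ∈ S ↔ j ∉ S)) (hH : SatisfiesAxioms Γ H c)
    {lam : FactorIndex S → ℂ} {d : ℕ} {s : Finset (FactorIndex S)}
    (hs : FactorsTo (formalResidue S c) lam d s) :
    AgreeTo d
      (∏ k ∈ s, powerFactor (LaurentPolynomial.T (2 - 2 * k.1 + shiftExp Γ k.2.1)) k.2.1 (lam k))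
      (MvPowerSeries.map laurentSquare.toRingHom (formalResidue S c)) := by
  intro m hm
  refine laurent_eq_of_evalLaurent fun n x hn hx => ?_
  obtain ⟨F, _, _, hF, hq⟩ := exists_field_card (2 * n) (by omega)
  have hx' : (x : ℂ) = ((Real.sqrt (Nat.card F) : ℝ) : ℂ) := by
    rw [hx, hF]
    have : Real.sqrt ((5 ^ (2 * n) : ℕ) : ℝ) = 5 ^ n := by
      push_cast
      rw [mul_comm, pow_mul, Real.sqrt_sq (by positivity)]
    rw [this]
    push_cast
    rfl
  have h1 := hH.agreeTo_map_evalLaurent hS hq hx' hs m hm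
  rw [MvPowerSeries.coeff_map] at h1 ⊢
  change _ = evalLaurent _ _ at h1
  change _ = evalLaurent _ (laurentSquare _)
  rw [evalLaurent_laurentSquare, ← h1]
  have h2 := MvPowerSeries.coeff_map (evalLaurent x).toRingHom m (∏ k ∈ s, powerFactor
    (LaurentPolynomial.T (2 - 2 * k.1 + shiftExp Γ k.2.1)) k.2.1 (lam k))
  refine h2.symm.trans ?_
  rw [map_prod]
  congr 1
  refine Finset.prod_congr rfl fun k _ => ?_
  rw [map_powerFactor, evalLaurent_T]

/-- R with q = x² has two factorizations, one with exponents 2μ and one with exponents 2 - 2μ +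
`shiftExp`. Uniqueness identifies them; a nonzero exponent of the second must lie among the indices
of the first, which is the integrality of μ'. -/
theorem SatisfiesAxioms.symmetry [Nonempty V]
    (hS : ∀ i j, Γ.Adj i j → (i ∈ S ↔ j ∉ S)) (hH : SatisfiesAxioms Γ H c)
    {lam : FactorIndex S → ℂ} (h : FormalHasProd (factor lam) (formalResidue S c))
    (k : FactorIndex S) (hk : lam k ≠ 0) :
    ∃ μ' : ℤ, 2 * μ' = 2 - 2 * k.1 + shiftExp Γ k.2.1 ∧ lam (μ', k.2) = lam k := by
  have hP := hH.coeff_zero_formalResidue hS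
  let φ₁ : ℤ → {ν : S →₀ ℕ // ν ≠ 0} → ℤ := fun μ _ => 2 * μ
  let φ₂ : ℤ → {ν : S →₀ ℕ // ν ≠ 0} → ℤ := fun μ ν => 2 - 2 * μ + shiftExp Γ ν.1
  have hφ₁ : ∀ ν, Function.Injective fun μ => φ₁ μ ν := by
    intro ν a b hab
    simp only [φ₁] at hab
    omega
  have hφ₂ : ∀ ν, Function.Injective fun μ => φ₂ μ ν := by
    intro ν a b hab
    simp only [φ₂] at hab
    omega
  have h1 : ∀ d, ∃ t, FactorsTo (MvPowerSeries.map laurentSquare.toRingHom (formalResidue S c))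
      (Function.extend (fun k : FactorIndex S => (φ₁ k.1 k.2, k.2)) lam 0) d t := by
    intro d
    obtain ⟨s, hs⟩ := h.factorsTo hP d
    refine factorsTo_extend hs.1 hφ₁ ?_
    have h2 := hs.2.map laurentSquare.toRingHom
    rw [map_prod] at h2
    have h3 : ∀ k ∈ s, MvPowerSeries.map laurentSquare.toRingHom (factor lam k) =
        powerFactor (LaurentPolynomial.T (φ₁ k.1 k.2)) k.2.1 (lam k) := fun k _ => by
      rw [factor, map_powerFactor, laurentSquare_T]
    rwa [Finset.prod_congr rfl h3] at h2
  have h2 : ∀ d, ∃ t, FactorsTo (MvPowerSeries.map laurentSquare.toRingHom (formalResidue S c))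
      (Function.extend (fun k : FactorIndex S => (φ₂ k.1 k.2, k.2)) lam 0) d t := by
    intro d
    obtain ⟨s, hs⟩ := h.factorsTo hP d
    exact factorsTo_extend hs.1 hφ₂ (hH.agreeTo_laurentSquare hS hs)
  have h3 := formalHasProd_factor_unique (formalHasProd_of_factorsTo h1)
    (formalHasProd_of_factorsTo h2)
  have hinj : ∀ {φ : ℤ → {ν : S →₀ ℕ // ν ≠ 0} → ℤ}, (∀ ν, Function.Injective fun μ => φ μ ν) →
      Function.Injective fun k : FactorIndex S => (φ k.1 k.2, k.2) := by
    rintro φ hφ ⟨μ, ν⟩ ⟨μ', ν'⟩ hk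
    simp only [Prod.mk.injEq] at hk
    obtain ⟨h1, rfl⟩ := hk
    rw [hφ ν h1]
  have h4 := congrFun h3 (φ₂ k.1 k.2, k.2)
  rw [(hinj hφ₂).extend_apply lam 0 k] at h4
  by_cases hr : ∃ j : FactorIndex S, (φ₁ j.1 j.2, j.2) = (φ₂ k.1 k.2, k.2)
  · obtain ⟨j, hj⟩ := hr
    rw [← hj, (hinj hφ₁).extend_apply lam 0 j] at h4
    rw [Prod.mk.injEq] at hj
    exact ⟨j.1, hj.1, by rw [← hj.2, ← h4]⟩
  · rw [Function.extend_apply' _ _ _ hr] at h4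
    exact absurd h4.symm hk

end Symmetry

end

end AffineMDS

/-! ### The main theorem -/

theorem proposition4p2 {V : Type*} [Fintype V] [DecidableEq V]
    (Γ : SimpleGraph V) [DecidableRel Γ.Adj] (hΓ : IsAffineDiagram Γ)
    (S : Finset V) (hS : ∀ i j, Γ.Adj i j → (i ∈ S ↔ j ∉ S))
    (H : Weights V) (c : (V →₀ ℕ) → ℂ[X]) (hH : SatisfiesAxioms Γ H c) :
    (∀ (F : Type) [Field F] [Finite F], Nat.card F % 4 = 1 →
      -- the residue is well defined
      ResidueExists (Nat.card F : ℂ) S (Z H F) ∧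
      -- its coefficients in terms of those of `Z`
      (∀ a : S →₀ ℕ,
        MvPowerSeries.coeff a (residue (Nat.card F : ℂ) (Nat.card F : ℂ)⁻¹ S (Z H F)) =
          MvPowerSeries.coeff (extendExp Γ S a) (Z H F) *
            (Nat.card F : ℂ)⁻¹ ^ (∑ i : S, a i * Γ.degree i)) ∧
      (∀ a : S →₀ ℕ,
        MvPowerSeries.coeff a (residue (Nat.card F : ℂ) (Nat.card F : ℂ)⁻¹ S (Z H F)) ≠ 0 →
          ∀ i, i ∉ S → Even (nbrSum Γ S a i)) ∧
      -- the residue as a sum over tuples of monic polynomials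
      residue (Nat.card F : ℂ) (Nat.card F : ℂ)⁻¹ S (Z H F) =
        degreeSeries F (fun f : S → F[X] =>
          H F (extendPoly Γ S f) * ∏ i : S, sqrtWeight Γ (Nat.card F) i ^ (f i).natDegree) ∧
      (∀ f : S → F[X], (∀ i, (f i).Monic) → H F (extendPoly Γ S f) ≠ 0 →
        ∀ i, i ∉ S → IsSquare (nbrProd Γ S f i)) ∧
      -- the weights are multiplicative
      (∀ f g : S → F[X], (∀ i, (f i).Monic) → (∀ i, (g i).Monic) →
        IsCoprime (∏ i, f i) (∏ i, g i) →
          H F (extendPoly Γ S (fun i => f i * g i)) =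
            H F (extendPoly Γ S f) * H F (extendPoly Γ S g)) ∧
      -- the Euler product
      FormalHasProd (fun p : {p : F[X] // p.Monic ∧ Irreducible p} => eulerFactor Γ H S F p.1)
        (residue (Nat.card F : ℂ) (Nat.card F : ℂ)⁻¹ S (Z H F))) ∧
    -- the residue with `q` an indeterminate, its factorization, and the symmetry of its factors
    ResidueExists (LaurentPolynomial.T 1) S (formalZ c) ∧
    (∀ a : S →₀ ℕ,
      MvPowerSeries.coeff a (formalResidue S c) =
        Polynomial.toLaurent (c (extendExp Γ S a)) *
          LaurentPolynomial.T (-((∑ i : S, a i * Γ.degree i : ℕ) : ℤ))) ∧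
    (∃! lam, IsFactorization (formalResidue S c) lam) ∧
    (∀ lam, IsFactorization (formalResidue S c) lam →
      ∀ (μ : ℤ) (ν : {ν : S →₀ ℕ // ν ≠ 0}), lam μ ν ≠ 0 →
        ∃ μ' : ℤ, 2 * μ' = 2 * (1 - μ) + ∑ i : S, (2 - (Γ.degree i : ℤ)) * ν.1 i ∧
          lam μ' ν = lam μ ν) := by
  -- A vertex is needed for the initial condition to give H(1, …, 1) = 1, hence constant term 1.
  have := hΓ.nonempty
  refine ⟨fun F _ _ hq => ?_, residueExists_of_poleAt hS fun i _ => hH.formal_poleAt i,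
    hH.coeff_formalResidue hS, existsUnique_isFactorization (hH.coeff_zero_formalResidue hS),
    fun lam h μ ν hne => ?_⟩
  · have hq0 : (Nat.card F : ℂ) ≠ 0 := by
      rw [Nat.cast_ne_zero]
      omega
    have hpole : ∀ i, i ∉ S → PoleAt Γ (Nat.card F : ℂ) i (Z H F) := fun i _ => hH.poleAt hq i
    have hcoeff := coeff_residue hS (mul_inv_cancel₀ hq0) hpole
    refine ⟨residueExists_of_poleAt hS hpole, hcoeff, fun a ha i hi => ?_,
      hH.residue_eq_degreeSeries hS hq, fun f hf h i hi => hH.isSquare_nbrProd hS hq hf h hi,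
      fun f g hf hg hfg => hH.extendPoly_mul hS hq hf hg hfg, ?_⟩
    · refine hH.even_of_ne_zero hS (fun h0 => ha ?_) hi
      rw [hcoeff, hH.coeff_eq F hq, h0, Polynomial.eval_zero, zero_mul]
    · rw [hH.residue_eq_degreeSeries hS hq]
      exact hH.formalHasProd_eulerFactor hS hq
  · obtain ⟨μ', h1, h2⟩ := hH.symmetry hS (isFactorization_iff.mp h) (μ, ν) hne
    refine ⟨μ', ?_, h2⟩
    rw [h1, shiftExp]
    ring
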